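/- **Conventions.** All $C^*$-algebras are separable, $\otimes$ between $C^*$-algebras is the minimal tensor product, $M(\cdot)$ is the multiplier algebra, inner products are linear in the second variable, and slice maps $\mathrm{id}\otimes\varphi$ with $\varphi\in A^*$ are extended strictly to multiplier algebras. $\varphi(1)$ is the value of the strict extension of $\varphi$ at $1\in M(A)$. A *$C^*$-bialgebra* $(A,\delta)$ is a $C^*$-algebra $A$ with a coassociative $\delta\in\mathrm{Mor}(A,A\otimes A)$ (a $*$-homomorphism $A\to M(A\otimes A)$ with $\delta(A)(A\otimes A)$ linearly dense in $A\otimes A$). It is *proper* if $\delta(a)(1\otimes b)$ and $(b\otimes1)\delta(a)$ lie in $A\otimes A$ for all $a,b\in A$; then $\varphi*a:=(\mathrm{id}\otimes\varphi)\delta(a)\in A$ for $\varphi\in A^*$, $a\in A$. It has the *cancellation property* if the linear spans of $\{\delta(a)(1\otimes b)\}$ and of $\{(b\otimes1)\delta(a)\}$ are dense in $A\otimes A$. For a weight $h$ on $A$ let $\mathfrak N_h=\{a\in A: h(a^*a)<\infty\}$, let $\mathfrak M_h$ be the linear span of $\{a\in A_+:h(a)<\infty\}$, and extend $h$ linearly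 to $\mathfrak M_h$. The weight $h$ is *locally finite* if $\mathfrak N_h$ is dense in $A$. It is *strictly faithful* if for every sequence $(a_n)$ in $A$ with $h(a_n^*a_n)$ bounded and $h(a_na_n^*)\to0$, the only $b\in A$ with $h((b-a_n)^*(b-a_n))\le h(a_n^*a_n)$ for all $n$ is $b=0$. It is *right invariant* if $h(\varphi*a)=\varphi(1)h(a)$ for all $a\in A_+$ with $h(a)<\infty$ and all $\varphi\in A^*_+$. A *GNS triple* $(\mathcal H,\pi,\eta)$ of $h$ consists of a Hilbert space $\mathcal H$, a representation $\pi$ of $A$ on $\mathcal H$ and a linear map $\eta:\mathfrak N_h\to\mathcal H$ with dense range, $\eta(ab)=\pi(a)\eta(b)$ and $\|\eta(a)\|^2=h(a^*a)$. For a closed operator $\kappa$ on $A$, we write $\varphi\circ\kappa\in A^*$ if there is $\psi\in A^*$ with $\psi(a)=\varphi(\kappa(a))$ for all $a\in\mathcal D(\kappa)$, and then $\varphi\circ\kappa:=\psi$. A *polar decomposition* $\kappa=R\circ\tau_{i/2}$ consists of a pointwise norm continuous one parameter group $(\tau_t)_{t\in\mathbb R}$ of automorphisms of $A$, with $\tau_{i/2}$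 its analytic continuation to $i/2$ (that is, $a\in\mathcal D(\tau_{i/2})$ and $\tau_{i/2}(a)=b$ if and only if $t\mapsto\tau_t(a)$ extends to a map that is continuous on $0\le\Im z\le\frac12$, holomorphic in the interior, and equal to $b$ at $i/2$), and of an involutive antiautomorphism $R$ of $A$ commuting with all $\tau_t$. A proper $C^*$-bialgebra $(A,\delta)$ with the cancellation property is a *weighted Hopf $C^*$-algebra* with antipode $\kappa$, unitary antipode $R$, scaling group $\tau$ and right Haar weight $h$, if $\kappa$ is a closed densely defined linear map on $A$ with polar decomposition $\kappa=R\circ\tau_{i/2}$, and $h$ is a strictly faithful, locally finite, lower semicontinuous, right invariant weight such that $h\circ\tau_t=\lambda^th$ $(t\in\mathbb R)$ for some $\lambda>0$, and such that *strong right invariance* holds: for all $a,b\in\mathfrak N_h$ and all $\varphi\in A^*$ with $\varphi\circ\kappa\in A^*$, the elements $(\varphi*a^*)b$ and $a^*((\varphi\circ\kappa)*b)$ belong to $\mathfrak M_h$ and $h((\varphi*a^*)b)=h(a^*((\varphi\circ\kappa)*b))$. It is called a weighted Hopf $C^*$-algebra if such data exist. With a GNS triple $(\mathcal H,\pi,\eta)$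 of $h$, its *Kac–Takesaki operator* is the unitary $W$ on $\mathcal H\otimes\mathcal H$ with $(x\otimes z\,|\,W(y\otimes u))=(z\,|\,\pi(W(x,y))u)$, equivalently $(\omega_{x,y}\otimes\mathrm{id})W=\pi(W(x,y))$ or $(\mathrm{id}\otimes\varphi)W=W_\varphi$. Here $\omega_{x,y}(T)=(x|Ty)$, the operators $W_\varphi\in\mathcal L(\mathcal H)$ $(\varphi\in A^*)$ are determined by $W_\varphi\eta(a)=\eta(\varphi*a)$ for $a\in\mathfrak N_h$, and the elements $W(x,y)\in A$ are determined by $\varphi(W(x,y))=(x|W_\varphi y)$ for all $\varphi\in A^*$. **Theorem.** Let $(A,\delta)$ be a proper $C^*$-bialgebra with the cancellation property. Let $\kappa$ be a closed operator on the Banach space $A$ with a polar decomposition $\kappa=R\circ\tau_{i/2}$ as above. Let $h$ be a strictly faithful, locally finite, lower semicontinuous weight on $A$ with $h\circ\tau_t=\lambda^th$ for some $\lambda>0$ and all $t\in\mathbb R$. Let $(\mathcal H,\pi,\eta)$ be a GNS triple of $h$, and identify $A$ with $\pi(A)\subset\mathcal L(\mathcal H)$. Suppose that a unitary $W\in M(\mathcal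 K(\mathcal H)\otimes A)$ satisfies: 1. for all $a\in\mathfrak N_h$ and $\varphi\in A^*$, $\varphi*a\in\mathfrak N_h$ and $\eta(\varphi*a)=\big((\mathrm{id}\otimes\varphi)W\big)\eta(a)$; 2. for all $\varphi\in A^*$ with $\varphi\circ\kappa\in A^*$, $(\mathrm{id}\otimes\varphi\circ\kappa)W=(\mathrm{id}\otimes\varphi)(W^*)$. Then $(A,\delta)$ is a weighted Hopf $C^*$-algebra, with antipode $\kappa$, unitary antipode $R$, scaling group $\tau$ and right Haar weight $h$, and $W$ is its Kac–Takesaki operator. -/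

import Mathlib

open scoped ENNReal InnerProductSpace ComplexOrder TensorProduct Topology
open Filter

namespace WeightedHopf

universe u v w

/-! ### Operators on the tensor product of two Hilbert spaces -/

section HilbertTensor

variable (H : Type u) [NormedAddCommGroup H] [InnerProductSpace ℂ H]
variable (K : Type v) [NormedAddCommGroup K] [InnerProductSpace ℂ K]

/-- The Hilbert space tensor product. -/
abbrev HTensor := UniformSpace.Completion (H ⊗[ℂ] K)

/-- Bounded operators on a Hilbert space. -/
abbrev Op := H →L[ℂ] H

variable {H K}

/-- The elementary tensor `x ⊗ y` in the Hilbert space tensor product. -/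
noncomputable def tvec (x : H) (y : K) : HTensor H K :=
  ((x ⊗ₜ[ℂ] y : H ⊗[ℂ] K) : UniformSpace.Completion (H ⊗[ℂ] K))

/-- The operator `S ⊗ T` on the Hilbert space tensor product. -/
noncomputable def opTensor (S : Op H) (T : Op K) : Op (HTensor H K) :=
  (TensorProduct.mapL S T).completion

theorem opTensor_tvec (S : Op H) (T : Op K) (x : H) (y : K) :
    opTensor S T (tvec x y) = tvec (S x) (T y) := by
  simp [opTensor, tvec]

/-- The map `k ↦ x ⊗ k`. -/
noncomputable def leftLeg (x : H) : K →L[ℂ] HTensor H K :=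
  UniformSpace.Completion.toComplL.comp (TensorProduct.mkL ℂ H K x)

/-- The slice `(ω_{x,y} ⊗ id)(T)`, where `ω_{x,y}(S) = ⟪x, S y⟫`. -/
noncomputable def vecSlice [CompleteSpace K] (x y : H) (T : Op (HTensor H K)) : Op K :=
  (leftLeg x).adjoint ∘L T ∘L leftLeg y

theorem inner_vecSlice [CompleteSpace K] (x y : H) (z u : K) (T : Op (HTensor H K)) :
    ⟪z, vecSlice x y T u⟫_ℂ = ⟪tvec x z, T (tvec y u)⟫_ℂ := by
  simp [vecSlice, ContinuousLinearMap.adjoint_inner_right, leftLeg, tvec]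

/-- The spatial tensor product of two algebras of operators: the norm closure of the linear span
of the operators `S ⊗ T`. -/
noncomputable def spatialTensor (X : Set (Op H)) (Y : Set (Op K)) :
    Submodule ℂ (Op (HTensor H K)) :=
  (Submodule.span ℂ {T | ∃ S ∈ X, ∃ S' ∈ Y, T = opTensor S S'}).topologicalClosure

/-- The multiplier algebra `M(D)` of a C⋆-algebra `D` acting non-degenerately on a Hilbert space,
realised as the idealiser of `D`. -/
def multipliers (D : Submodule ℂ (Op H)) : Set (Op H) :=
  {m | ∀ d ∈ D, m * d ∈ D ∧ d * m ∈ D}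

end HilbertTensor

/-! ### The universal representation -/

section Universal

variable (A : Type u) [NonUnitalCStarAlgebra A] [PartialOrder A] [StarOrderedRing A]
/-- The Hilbert space of the universal representation: the direct sum of the GNS spaces of all
positive functionals on `A`. -/
def UnivSpace : Type u := lp (fun f : A →ₚ[ℂ] ℂ => f.GNS) 2

noncomputable instance : NormedAddCommGroup (UnivSpace A) :=
  inferInstanceAs (NormedAddCommGroup (lp (fun f : A →ₚ[ℂ] ℂ => f.GNS) 2))

noncomputable instance : InnerProductSpace ℂ (UnivSpace A) :=
  inferInstanceAs (InnerProductSpace ℂ (lp (fun f : A →ₚ[ℂ] ℂ => f.GNS) 2))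

instance : CompleteSpace (UnivSpace A) :=
  inferInstanceAs (CompleteSpace (lp (fun f : A →ₚ[ℂ] ℂ => f.GNS) 2))

/-- The direct sum of the GNS representations of all positive functionals on `A`. -/
noncomputable def univRepAux : A →⋆ₙₐ[ℂ] Op (lp (fun f : A →ₚ[ℂ] ℂ => f.GNS) 2) where
  toFun a := lp.mapCLM 2 (fun f : A →ₚ[ℂ] ℂ => f.gnsNonUnitalStarAlgHom a) (norm_nonneg a)
    (fun f => NonUnitalStarAlgHom.norm_apply_le f.gnsNonUnitalStarAlgHom a)
  map_smul' c a := by ext; simp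
  map_zero' := by ext; simp
  map_add' a b := by ext; simp
  map_mul' a b := by ext; simp
  map_star' a := by
    rw [ContinuousLinearMap.star_eq_adjoint, ContinuousLinearMap.eq_adjoint_iff]
    intro x y
    simp only [lp.inner_eq_tsum, lp.mapCLM_apply_coe, map_star,
      ContinuousLinearMap.star_eq_adjoint, ContinuousLinearMap.adjoint_inner_left]

/-- The universal representation of `A`. -/
noncomputable def univRep : A →⋆ₙₐ[ℂ] Op (UnivSpace A) := univRepAux A

variable {A} in
/-- The positive functionals separate the positive elements from zero. -/
theorem exists_positive_functional {x : A} (hx : 0 ≤ x) (h0 : x ≠ 0) :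
    ∃ f : A →ₚ[ℂ] ℂ, f x ≠ 0 := by
  have hconv : Convex ℝ {a : A | 0 ≤ a} := by
    intro a ha b hb s t hs ht _
    exact add_nonneg (smul_nonneg hs ha) (smul_nonneg ht hb)
  have hmem : -x ∉ {a : A | 0 ≤ a} := fun h => h0 (le_antisymm (neg_nonneg.1 h) hx)
  obtain ⟨g, u, hu, hg⟩ := geometric_hahn_banach_point_closed (E := A) hconv
    CStarAlgebra.isClosed_nonneg hmem
  have hu0 : u < 0 := by simpa using hg 0 (le_refl (0 : A))
  have hpos : ∀ a : A, 0 ≤ a → 0 ≤ g a := by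
    intro a ha
    by_contra! hneg
    have h1 := hg ((u / g a) • a) (smul_nonneg (div_nonneg_of_nonpos hu0.le hneg.le) ha)
    rw [map_smul, smul_eq_mul, div_mul_cancel₀ _ hneg.ne] at h1
    exact lt_irrefl _ h1
  let L : A →ₗ[ℂ] ℂ :=
    { toFun := fun a => (g (realPart a : A) : ℂ) + Complex.I * (g (imaginaryPart a : A) : ℂ)
      map_add' := fun a b => by simp; ring
      map_smul' := fun c a => by
        simp only [realPart_smul, imaginaryPart_smul, AddSubgroupClass.coe_sub,
          AddMemClass.coe_add, selfAdjoint.val_smul, map_sub, map_add, map_smul,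
          smul_eq_mul, RingHom.id_apply]
        push_cast
        conv_rhs => rw [← Complex.re_add_im c]
        linear_combination (-(c.im : ℂ) * (g (imaginaryPart a : A) : ℂ)) * Complex.I_mul_I }
  have hL : ∀ a : A, 0 ≤ a → L a = (g a : ℂ) := by
    intro a ha
    have hsa : IsSelfAdjoint a := .of_nonneg ha
    simp [L, hsa.coe_realPart, hsa.imaginaryPart]
  refine ⟨PositiveLinearMap.mk₀ L fun a ha => ?_, ?_⟩
  · rw [hL a ha]; exact_mod_cast hpos a ha
  · change L x ≠ 0
    rw [hL x hx]
    have : g x ≠ 0 := by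
      have : -g x < u := by simpa using hu
      intro h; rw [h] at this; simp at this; linarith
    exact_mod_cast this

/-- The universal representation is faithful. -/
theorem univRep_injective : Function.Injective (univRep A) := by
  classical
  rw [injective_iff_map_eq_zero]
  intro a ha
  change univRepAux A a = 0 at ha
  by_contra hne
  obtain ⟨f, hf⟩ := exists_positive_functional (star_mul_self_nonneg a)
    (by simpa using hne)
  have hfa : f.gnsNonUnitalStarAlgHom a = 0 := by
    ext y
    have h1 := congrArg (fun T : Op (lp (fun f : A →ₚ[ℂ] ℂ => f.GNS) 2) => (T (lp.single 2 f y) : ∀ f, f.GNS) f) ha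
    simpa [univRepAux] using h1
  have key : ∀ b : A, f (star b * (star a * a) * b) = 0 := by
    intro b
    have h2 : f.leftMulMapPreGNS a (f.toPreGNS b) = f.toPreGNS (a * b) := rfl
    have h1 := PositiveLinearMap.gnsNonUnitalStarAlgHom_apply_coe (f := f) (a := a)
      (b := f.toPreGNS b)
    rw [hfa, h2] at h1
    have h3 : ‖f.toPreGNS (a * b)‖ = 0 := by
      rw [← UniformSpace.Completion.norm_coe, ← h1]; simp
    have h4 := f.preGNS_norm_sq (f.toPreGNS (a * b))
    rw [h3] at h4
    simpa [mul_assoc] using h4.symm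
  have hcont : Continuous f := by
    obtain ⟨C, hC⟩ := f.exists_norm_apply_le
    exact AddMonoidHomClass.continuous_of_bound f C hC
  have hau := CStarAlgebra.increasingApproximateUnit A
  have hlim : Tendsto (fun b : A => star b * (star a * a) * b)
      (CStarAlgebra.approximateUnit A) (𝓝 (star a * a)) := by
    have e1 : Tendsto (fun b : A => a * b) (CStarAlgebra.approximateUnit A) (𝓝 a) :=
      hau.tendsto_mul_left a
    have e2 := (e1.star).mul e1
    refine e2.congr fun b => ?_
    simp [mul_assoc]
  have hlim' := (hcont.tendsto _).comp hlim
  have : Tendsto (fun _ : A => (0 : ℂ)) (CStarAlgebra.approximateUnit A)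
      (𝓝 (f (star a * a))) := hlim'.congr fun b => by simpa using key b
  exact hf (tendsto_nhds_unique this tendsto_const_nhds)
end Universal

/-! ### Slices -/

section Slices

variable {B : Type u} [NonUnitalCStarAlgebra B] [PartialOrder B] [StarOrderedRing B]
variable {K : Type v} [NormedAddCommGroup K] [InnerProductSpace ℂ K] [CompleteSpace K]
variable {H : Type w} [NormedAddCommGroup H] [InnerProductSpace ℂ H]

/-- Let `ρ` be a faithful non-degenerate representation of `B`. This is the value at a multiplier
`m ∈ M(ρ(B))` of the strictly continuous extension of `φ ∈ B^*` to the multiplier algebra,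
i.e. the limit of `φ(m e)` along the approximate unit of `B`. -/
noncomputable def strictEval (ρ : B →⋆ₙₐ[ℂ] Op K) (φ : B →L[ℂ] ℂ) (m : Op K) : ℂ :=
  limUnder (CStarAlgebra.approximateUnit B) fun e => φ (Function.invFun ρ (m * ρ e))

/-- `S` is the slice `(id ⊗ φ)(T)`: one has `ω_{x,y}(S) = φ((ω_{x,y} ⊗ id)(T))` for all `x, y`. -/
def IsSlice (ρ : B →⋆ₙₐ[ℂ] Op K) (φ : B →L[ℂ] ℂ) (T : Op (HTensor H K)) (S : Op H) : Prop :=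
  ∀ x y : H, ⟪x, S y⟫_ℂ = strictEval ρ φ (vecSlice x y T)

open Classical in
/-- The slice `(id ⊗ φ)(T)`, for `T` in the multiplier algebra of `C ⊗ ρ(B)` with `C` a C⋆-algebra
acting non-degenerately on `H` (for such `T` it exists). -/
noncomputable def slice (ρ : B →⋆ₙₐ[ℂ] Op K) (φ : B →L[ℂ] ℂ) (T : Op (HTensor H K)) : Op H :=
  if h : ∃ S, IsSlice ρ φ T S then h.choose else 0

theorem IsSlice.slice_eq {ρ : B →⋆ₙₐ[ℂ] Op K} {φ : B →L[ℂ] ℂ} {T : Op (HTensor H K)} {S : Op H}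
    (hS : IsSlice ρ φ T S) : slice ρ φ T = S := by
  have hex : ∃ S, IsSlice ρ φ T S := ⟨S, hS⟩
  rw [slice, dif_pos hex]
  ext y
  refine ext_inner_left ℂ fun x => ?_
  rw [hex.choose_spec x y, hS x y]

end Slices

/-! ### C⋆-bialgebras -/

section Bialgebra

variable (A : Type u) [NonUnitalCStarAlgebra A] [PartialOrder A] [StarOrderedRing A]

/-- The Hilbert space on which `A ⊗ A` acts. -/
noncomputable abbrev UnivSpace₂ := HTensor (UnivSpace A) (UnivSpace A)

/-- The Hilbert space on which `A ⊗ A ⊗ A` acts. -/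
noncomputable abbrev UnivSpace₃ := HTensor (UnivSpace₂ A) (UnivSpace A)

/-- The minimal tensor product `A ⊗ A`. -/
noncomputable def minTensor : Submodule ℂ (Op (UnivSpace₂ A)) :=
  spatialTensor (Set.range (univRep A)) (Set.range (univRep A))

variable {A}

/-- `X = S ⊗ T`, where `S` acts on the first leg and `T` on the second and third legs. -/
def IsTensorOneTwoThree (S : Op (UnivSpace A)) (T : Op (UnivSpace₂ A)) (X : Op (UnivSpace₃ A)) :
    Prop :=
  ∀ x₁ x₂ x₃ y₁ y₂ y₃ : UnivSpace A,
    ⟪tvec (tvec x₁ x₂) x₃, X (tvec (tvec y₁ y₂) y₃)⟫_ℂ =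
      ⟪x₁, S y₁⟫_ℂ * ⟪tvec x₂ x₃, T (tvec y₂ y₃)⟫_ℂ

/-- `X` is the value at the multiplier `m ∈ M(A ⊗ A)` of the extension of the morphism `Φ` from
`A ⊗ A` to its multiplier algebra: `X Φ(d) = Φ(m d)` for all `d ∈ A ⊗ A`. -/
def IsExtValue (Φ : minTensor A →L[ℂ] Op (UnivSpace₃ A)) (m : Op (UnivSpace₂ A))
    (X : Op (UnivSpace₃ A)) : Prop :=
  ∀ d d' : minTensor A, (d' : Op (UnivSpace₂ A)) = m * d → X * Φ d = Φ d'

/-- The coassociativity condition `(δ ⊗ id) ∘ δ = (id ⊗ δ) ∘ δ`. Here `Φ` is the morphism `δ ⊗ id`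
and `Ψ` is the morphism `id ⊗ δ`; they are determined by their values on elementary tensors. -/
def Coassociative (δ : A →⋆ₙₐ[ℂ] Op (UnivSpace₂ A)) : Prop :=
  ∃ Φ Ψ : minTensor A →L[ℂ] Op (UnivSpace₃ A),
    (∀ (a b : A) (d : minTensor A), (d : Op (UnivSpace₂ A)) = opTensor (univRep A a) (univRep A b) →
      Φ d = opTensor (δ a) (univRep A b) ∧
      IsTensorOneTwoThree (univRep A a) (δ b) (Ψ d)) ∧
    ∀ a : A, ∃ X : Op (UnivSpace₃ A), IsExtValue Φ (δ a) X ∧ IsExtValue Ψ (δ a) X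

variable (A) in
/-- A comultiplication on `A`: a coassociative morphism `δ ∈ Mor(A, A ⊗ A)`. The pair `(A, δ)` is
then a C⋆-bialgebra. -/
structure Comultiplication where
  /-- The underlying ⋆-homomorphism. -/
  toHom : A →⋆ₙₐ[ℂ] Op (UnivSpace₂ A)
  mem_multipliers : ∀ a, toHom a ∈ multipliers (minTensor A)
  nondegenerate : (Submodule.span ℂ
    {T | ∃ a : A, ∃ d ∈ minTensor A, T = toHom a * d}).topologicalClosure = minTensor A
  coassoc : Coassociative toHom

namespace Comultiplication

variable (δ : Comultiplication A)

/-- `(A, δ)` is proper: `δ(a)(1 ⊗ b)` and `(b ⊗ 1)δ(a)` belong to `A ⊗ A`. -/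
def IsProper : Prop :=
  ∀ a b : A, δ.toHom a * opTensor 1 (univRep A b) ∈ minTensor A ∧
    opTensor (univRep A b) 1 * δ.toHom a ∈ minTensor A

/-- The cancellation property: the linear spans of the elements `δ(a)(1 ⊗ b)` and of the elements
`(b ⊗ 1)δ(a)` are dense in `A ⊗ A`. -/
def HasCancellation : Prop :=
  (Submodule.span ℂ {T | ∃ a b : A, T = δ.toHom a * opTensor 1 (univRep A b)}).topologicalClosure
      = minTensor A ∧
    (Submodule.span ℂ {T | ∃ a b : A, T = opTensor (univRep A b) 1 * δ.toHom a}).topologicalClosure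
      = minTensor A

/-- The convolution product `φ * a = (id ⊗ φ)δ(a)`, for a proper C⋆-bialgebra. -/
noncomputable def conv (φ : A →L[ℂ] ℂ) (a : A) : A :=
  Function.invFun (univRep A) (slice (univRep A) φ (δ.toHom a))

end Comultiplication

end Bialgebra

/-! ### Weights -/

section Weights

variable (A : Type u) [NonUnitalCStarAlgebra A] [PartialOrder A] [StarOrderedRing A]

/-- A weight on `A`. Only the values on the positive cone are relevant. -/
structure Weight where
  /-- The underlying function. -/
  toFun : A → ℝ≥0∞
  map_add : ∀ a b : A, 0 ≤ a → 0 ≤ b → toFun (a + b) = toFun a + toFun b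
  map_smul : ∀ (r : ℝ) (a : A), 0 ≤ r → 0 ≤ a → toFun ((r : ℂ) • a) = ENNReal.ofReal r * toFun a

variable {A}

namespace Weight

instance : CoeFun (Weight A) fun _ => A → ℝ≥0∞ := ⟨Weight.toFun⟩

variable (h : Weight A)

theorem map_zero : h 0 = 0 := by
  simpa using h.map_smul 0 0 le_rfl le_rfl

theorem mono {a b : A} (ha : 0 ≤ a) (hab : a ≤ b) : h a ≤ h b := by
  have := h.map_add a (b - a) ha (sub_nonneg.2 hab)
  rw [add_sub_cancel] at this
  rw [this]
  exact le_self_add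

/-- The set `𝔑_h` of the elements `a` with `h(a⋆a) < ∞`. -/
def leftIdeal : Submodule ℂ A where
  carrier := {a | h (star a * a) < ∞}
  zero_mem' := by simp [h.map_zero]
  add_mem' := by
    intro a b ha hb
    have h2 : ∀ x : A, 0 ≤ x → h (x + x) = h x + h x := fun x hx => h.map_add x x hx hx
    have key : star (a + b) * (a + b) ≤
        (star a * a + star a * a) + (star b * b + star b * b) := by
      rw [← sub_nonneg]
      have : (star a * a + star a * a) + (star b * b + star b * b) - star (a + b) * (a + b) =
          star (a - b) * (a - b) := by
        simp only [star_add, star_sub, add_mul, mul_add, sub_mul, mul_sub]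
        abel
      rw [this]
      exact star_mul_self_nonneg _
    refine lt_of_le_of_lt (h.mono (star_mul_self_nonneg _) key) ?_
    have pa := star_mul_self_nonneg a
    have pb := star_mul_self_nonneg b
    rw [h.map_add _ _ (add_nonneg pa pa) (add_nonneg pb pb), h2 _ pa, h2 _ pb]
    have ha' : h (star a * a) < ∞ := ha
    have hb' : h (star b * b) < ∞ := hb
    simp [ha', hb']
  smul_mem' := by
    intro c a ha
    have ha' : h (star a * a) < ∞ := ha
    have : star (c • a) * (c • a) = ((Complex.normSq c : ℝ) : ℂ) • (star a * a) := by
      rw [star_smul, smul_mul_smul_comm, Complex.normSq_eq_conj_mul_self]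
      rfl
    change h (star (c • a) * (c • a)) < ∞
    rw [this, h.map_smul _ _ (Complex.normSq_nonneg c) (star_mul_self_nonneg a)]
    exact ENNReal.mul_lt_top ENNReal.ofReal_lt_top ha'

/-- The linear span `𝔐_h` of the positive elements `a` with `h(a) < ∞`. -/
def finitePart : Submodule ℂ A := Submodule.span ℂ {a | 0 ≤ a ∧ h a < ∞}

theorem exists_linearExt :
    ∃ f : A →ₗ[ℂ] ℂ, ∀ a : A, 0 ≤ a → h a < ∞ → f a = ((h a).toReal : ℂ) := by
  classical
  let P := {a : A // 0 ≤ a ∧ h a < ∞}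
  let T : (P →₀ ℂ) →ₗ[ℂ] A := Finsupp.linearCombination ℂ (fun a : P => a.1)
  let g : (P →₀ ℂ) →ₗ[ℂ] ℂ := Finsupp.linearCombination ℂ (fun a : P => ((h a.1).toReal : ℂ))
  have hsum : ∀ (s : Finset P) (r : P → ℝ), (∀ p, 0 ≤ r p) →
      0 ≤ ∑ p ∈ s, (r p : ℂ) • p.1 ∧ h (∑ p ∈ s, (r p : ℂ) • p.1) < ∞ ∧
      (h (∑ p ∈ s, (r p : ℂ) • p.1)).toReal = ∑ p ∈ s, r p * (h p.1).toReal := by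
    intro s r hr
    induction s using Finset.induction_on with
    | empty => simp [h.map_zero]
    | insert q s hq ih =>
      obtain ⟨i1, i2, i3⟩ := ih
      have hq0 : 0 ≤ (r q : ℂ) • q.1 :=
        smul_nonneg (by exact_mod_cast hr q) q.2.1
      have hq1 : h ((r q : ℂ) • q.1) = ENNReal.ofReal (r q) * h q.1 :=
        h.map_smul _ _ (hr q) q.2.1
      have hq2 : h ((r q : ℂ) • q.1) < ∞ := by
        rw [hq1]; exact ENNReal.mul_lt_top ENNReal.ofReal_lt_top q.2.2
      rw [Finset.sum_insert hq, Finset.sum_insert hq, h.map_add _ _ hq0 i1]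
      refine ⟨add_nonneg hq0 i1, ENNReal.add_lt_top.2 ⟨hq2, i2⟩, ?_⟩
      rw [ENNReal.toReal_add hq2.ne i2.ne, i3, hq1, ENNReal.toReal_mul,
        ENNReal.toReal_ofReal (hr q)]
  have hreal : ∀ (s : Finset P) (r : P → ℝ), ∑ p ∈ s, (r p : ℂ) • p.1 = 0 →
      ∑ p ∈ s, r p * (h p.1).toReal = 0 := by
    intro s r h0
    obtain ⟨-, -, e1⟩ := hsum s (fun p => max (r p) 0) (fun p => le_max_right _ _)
    obtain ⟨-, -, e2⟩ := hsum s (fun p => max (-r p) 0) (fun p => le_max_right _ _)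
    have hr : ∀ p, r p = max (r p) 0 - max (-r p) 0 := fun p => by
      rcases le_total 0 (r p) with hp | hp
      · simp [hp]
      · simp [hp]
    have heq : ∑ p ∈ s, ((max (r p) 0 : ℝ) : ℂ) • p.1 =
        ∑ p ∈ s, ((max (-r p) 0 : ℝ) : ℂ) • p.1 := by
      rw [← sub_eq_zero, ← Finset.sum_sub_distrib]
      refine Eq.trans ?_ h0
      refine Finset.sum_congr rfl fun p _ => ?_
      rw [← sub_smul, ← Complex.ofReal_sub, ← hr p]
    have : ∑ p ∈ s, r p * (h p.1).toReal = ∑ p ∈ s, max (r p) 0 * (h p.1).toReal -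
        ∑ p ∈ s, max (-r p) 0 * (h p.1).toReal := by
      rw [← Finset.sum_sub_distrib]
      refine Finset.sum_congr rfl fun p _ => ?_
      rw [← sub_mul, ← hr p]
    rw [this, ← e1, ← e2, heq, sub_self]
  have hker : g ∈ T.ker.dualAnnihilator := by
    rw [Submodule.mem_dualAnnihilator]
    intro c hc
    have hc0 : ∑ p ∈ c.support, c p • p.1 = 0 := by
      simpa [T, Finsupp.linearCombination_apply, Finsupp.sum] using hc
    have hc1 : ∑ p ∈ c.support, (starRingEnd ℂ (c p)) • p.1 = 0 := by
      have := congrArg star hc0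
      rw [star_sum, star_zero] at this
      refine Eq.trans ?_ this
      refine Finset.sum_congr rfl fun p _ => ?_
      rw [star_smul, (IsSelfAdjoint.of_nonneg p.2.1).star_eq]
      rfl
    have hre : ∑ p ∈ c.support, ((c p).re : ℂ) • p.1 = 0 := by
      have : ∑ p ∈ c.support, ((c p).re : ℂ) • p.1 = (1 / 2 : ℂ) •
          (∑ p ∈ c.support, c p • p.1 + ∑ p ∈ c.support, (starRingEnd ℂ (c p)) • p.1) := by
        rw [← Finset.sum_add_distrib, Finset.smul_sum]
        refine Finset.sum_congr rfl fun p _ => ?_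
        rw [← add_smul, smul_smul, Complex.re_eq_add_conj]
        congr 1; ring
      rw [this, hc0, hc1]; simp
    have him : ∑ p ∈ c.support, ((c p).im : ℂ) • p.1 = 0 := by
      have : ∑ p ∈ c.support, ((c p).im : ℂ) • p.1 = (1 / (2 * Complex.I) : ℂ) •
          (∑ p ∈ c.support, c p • p.1 - ∑ p ∈ c.support, (starRingEnd ℂ (c p)) • p.1) := by
        rw [← Finset.sum_sub_distrib, Finset.smul_sum]
        refine Finset.sum_congr rfl fun p _ => ?_
        rw [← sub_smul, smul_smul, Complex.im_eq_sub_conj]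
        congr 1; ring
      rw [this, hc0, hc1]; simp
    have r1 := hreal _ _ hre
    have r2 := hreal _ _ him
    have : g c = ((∑ p ∈ c.support, (c p).re * (h p.1).toReal : ℝ) : ℂ) +
        ((∑ p ∈ c.support, (c p).im * (h p.1).toReal : ℝ) : ℂ) * Complex.I := by
      simp only [g, Finsupp.linearCombination_apply, Finsupp.sum, smul_eq_mul]
      push_cast
      rw [Finset.sum_mul, ← Finset.sum_add_distrib]
      refine Finset.sum_congr rfl fun p _ => ?_
      conv_lhs => rw [← Complex.re_add_im (c p)]
      ring
    rw [this, r1, r2]; simp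
  rw [← LinearMap.range_dualMap_eq_dualAnnihilator_ker] at hker
  obtain ⟨f, hf⟩ := hker
  refine ⟨f, fun a ha hfin => ?_⟩
  have := congrArg (fun k : Module.Dual ℂ (P →₀ ℂ) => k (Finsupp.single ⟨a, ha, hfin⟩ 1)) hf
  simpa [T, g] using this

/-- The extension of the weight `h` to a linear functional on `𝔐_h` (it is unique). -/
noncomputable def linearExt : h.finitePart →ₗ[ℂ] ℂ :=
  h.exists_linearExt.choose.domRestrict h.finitePart

theorem linearExt_apply {a : A} (ha : 0 ≤ a) (hfin : h a < ∞) :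
    h.linearExt ⟨a, Submodule.subset_span ⟨ha, hfin⟩⟩ = ((h a).toReal : ℂ) :=
  h.exists_linearExt.choose_spec a ha hfin

/-- `h` is locally finite: `𝔑_h` is dense in `A`. -/
def IsLocallyFinite : Prop := Dense (h.leftIdeal : Set A)

/-- `h` is lower semicontinuous. -/
def IsLowerSemicontinuous : Prop :=
  ∀ t : NNReal, IsClosed {a : A | 0 ≤ a ∧ h a ≤ t}

/-- `h` is strictly faithful. -/
def IsStrictlyFaithful : Prop :=
  ∀ a : ℕ → A, (∃ C : NNReal, ∀ n, h (star (a n) * a n) ≤ C) →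
    Tendsto (fun n => h (a n * star (a n))) atTop (𝓝 0) →
    ∀ b : A, (∀ n, h (star (b - a n) * (b - a n)) ≤ h (star (a n) * a n)) → b = 0

/-- `h` is right invariant: `h(φ * a) = φ(1) h(a)` for every positive `a` with `h(a) < ∞` and every
positive functional `φ`, where `φ(1)` refers to the extension of `φ` to `M(A)`. -/
def IsRightInvariant (δ : Comultiplication A) : Prop :=
  ∀ a : A, 0 ≤ a → h a < ∞ → ∀ φ : A →L[ℂ] ℂ, (∀ b : A, 0 ≤ b → 0 ≤ φ b) →
    h (δ.conv φ a) = ENNReal.ofReal (strictEval (univRep A) φ 1).re * h a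

/-- Strong right invariance: `h((φ * a⋆)b) = h(a⋆((φ ∘ κ) * b))` for `a, b ∈ 𝔑_h` and every
`φ ∈ A^*` such that `φ ∘ κ` is given by some `ψ ∈ A^*`. -/
def IsStronglyRightInvariant (δ : Comultiplication A) (κ : A →ₗ.[ℂ] A) : Prop :=
  ∀ φ ψ : A →L[ℂ] ℂ, (∀ a : κ.domain, ψ a = φ (κ a)) →
    ∀ a b : h.leftIdeal,
      ∃ (h₁ : δ.conv φ (star (a : A)) * b ∈ h.finitePart)
        (h₂ : star (a : A) * δ.conv ψ b ∈ h.finitePart),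
        h.linearExt ⟨_, h₁⟩ = h.linearExt ⟨_, h₂⟩

/-- `(H, π, η)` is a GNS triple associated with the weight `h`. -/
structure IsGNSTriple {H : Type v} [NormedAddCommGroup H] [InnerProductSpace ℂ H] [CompleteSpace H]
    (π : A →⋆ₙₐ[ℂ] Op H) (η : h.leftIdeal →ₗ[ℂ] H) : Prop where
  map_mul : ∀ (a : A) (b c : h.leftIdeal), (c : A) = a * b → η c = π a (η b)
  denseRange : DenseRange η
  norm_sq : ∀ a : h.leftIdeal, ‖η a‖ ^ 2 = (h (star (a : A) * a)).toReal

end Weight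

end Weights

/-! ### One parameter groups and the antipode -/

section Antipode

variable (A : Type u) [NonUnitalCStarAlgebra A] [PartialOrder A] [StarOrderedRing A]

/-- A pointwise norm continuous one parameter group of automorphisms of `A`. -/
structure OneParamGroup where
  /-- The automorphisms of the group. -/
  toFun : ℝ → (A ≃⋆ₐ[ℂ] A)
  map_add : ∀ s t a, toFun (s + t) a = toFun s (toFun t a)
  continuous : ∀ a, Continuous fun t => toFun t a

variable {A}

instance : CoeFun (OneParamGroup A) fun _ => ℝ → (A ≃⋆ₐ[ℂ] A) := ⟨OneParamGroup.toFun⟩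

/-- The graph of `τ_{i/2}`: `a` is in the domain of `τ_{i/2}` and `b = τ_{i/2}(a)`. -/
def OneParamGroup.IsHalfGenerator (τ : OneParamGroup A) (a b : A) : Prop :=
  ∃ F : ℂ → A, ContinuousOn F {z | 0 ≤ z.im ∧ z.im ≤ 1 / 2} ∧
    DifferentiableOn ℂ F {z | 0 < z.im ∧ z.im < 1 / 2} ∧
    (∀ t : ℝ, F t = τ t a) ∧ F (Complex.I / 2) = b

/-- `R` is an involutive antiautomorphism of the C⋆-algebra `A`. -/
structure IsInvolutiveAntiAut (R : A →ₗ[ℂ] A) : Prop where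
  map_mul : ∀ a b, R (a * b) = R b * R a
  map_star : ∀ a, R (star a) = star (R a)
  involutive : ∀ a, R (R a) = a

/-- The polar decomposition `κ = R ∘ τ_{i/2}`, where the involutive antiautomorphism `R` commutes
with all `τ_t`. -/
structure IsPolarDecomposition (κ : A →ₗ.[ℂ] A) (R : A →ₗ[ℂ] A) (τ : OneParamGroup A) : Prop where
  antiAut : IsInvolutiveAntiAut R
  commute : ∀ t a, R (τ t a) = τ t (R a)
  graph : ∀ a c : A, (a, c) ∈ κ.graph ↔ ∃ b, τ.IsHalfGenerator a b ∧ c = R b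

/-- `h ∘ τ_t = c^t h` for all `t`. -/
def Weight.IsRelativelyInvariant (h : Weight A) (τ : OneParamGroup A) (c : ℝ) : Prop :=
  ∀ (t : ℝ) (a : A), 0 ≤ a → h (τ t a) = ENNReal.ofReal (c ^ t) * h a

/-! ### Weighted Hopf C⋆-algebras -/

/-- `(A, δ)` is a weighted Hopf C⋆-algebra with antipode `κ`, unitary antipode `R`, scaling group
`τ` and right Haar weight `h`. -/
structure IsWeightedHopfWith (δ : Comultiplication A) (κ : A →ₗ.[ℂ] A) (R : A →ₗ[ℂ] A)
    (τ : OneParamGroup A) (h : Weight A) : Prop where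
  separable : TopologicalSpace.SeparableSpace A
  proper : δ.IsProper
  cancellation : δ.HasCancellation
  antipode_closed : κ.IsClosed
  antipode_dense : Dense (κ.domain : Set A)
  locallyFinite : h.IsLocallyFinite
  strictlyFaithful : h.IsStrictlyFaithful
  lowerSemicontinuous : h.IsLowerSemicontinuous
  rightInvariant : h.IsRightInvariant δ
  polar : IsPolarDecomposition κ R τ
  relativelyInvariant : ∃ c : ℝ, 0 < c ∧ h.IsRelativelyInvariant τ c
  stronglyRightInvariant : h.IsStronglyRightInvariant δ κ

/-- `(A, δ)` is a weighted Hopf C⋆-algebra. -/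
def IsWeightedHopf (δ : Comultiplication A) : Prop :=
  ∃ κ R τ h, IsWeightedHopfWith δ κ R τ h

/-- `W` is a unitary element of `M(𝒦(H) ⊗ A)`, with `A` identified with `π(A)`. -/
def IsUnitaryMultiplier {H : Type v} [NormedAddCommGroup H] [InnerProductSpace ℂ H]
    [CompleteSpace H] (π : A →⋆ₙₐ[ℂ] Op H) (W : Op (HTensor H H)) : Prop :=
  W ∈ multipliers (spatialTensor {S : Op H | IsCompactOperator S} (Set.range π)) ∧
    star W * W = 1 ∧ W * star W = 1

/-- `W` is the Kac–Takesaki operator of `(A, δ)` with right Haar weight `h` and GNS triple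
`(H, π, η)`. Here `Wφ` are the bounded operators with `Wφ φ (η a) = η(φ * a)`, and `Wm x y ∈ A` are
the matrix elements, determined by `φ(Wm x y) = ⟪x, Wφ φ y⟫` for all `φ ∈ A^*`. -/
def IsKacTakesaki (δ : Comultiplication A) (h : Weight A) {H : Type v} [NormedAddCommGroup H]
    [InnerProductSpace ℂ H] [CompleteSpace H] (π : A →⋆ₙₐ[ℂ] Op H) (η : h.leftIdeal →ₗ[ℂ] H)
    (W : Op (HTensor H H)) : Prop :=
  (star W * W = 1 ∧ W * star W = 1) ∧
  ∃ (Wφ : (A →L[ℂ] ℂ) → Op H) (Wm : H → H → A),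
    (∀ (φ : A →L[ℂ] ℂ) (a : h.leftIdeal),
      ∃ hm : δ.conv φ a ∈ h.leftIdeal, Wφ φ (η a) = η ⟨δ.conv φ a, hm⟩) ∧
    (∀ (φ : A →L[ℂ] ℂ) (x y : H), φ (Wm x y) = ⟪x, Wφ φ y⟫_ℂ) ∧
    (∀ x y z u : H, ⟪tvec x z, W (tvec y u)⟫_ℂ = ⟪z, π (Wm x y) u⟫_ℂ) ∧
    (∀ x y : H, vecSlice x y W = π (Wm x y)) ∧
    (∀ φ : A →L[ℂ] ℂ, slice π φ W = Wφ φ)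

end Antipode

end WeightedHopf

set_option linter.unusedSectionVars false

namespace WeightedHopf

/-! ### Functionals on a C⋆-algebra and their strict extensions -/

section Functionals

variable {B : Type*} [NonUnitalCStarAlgebra B]

/-! Four points have content: the matrix elements of `W` lie in `A`, `h` is strongly right
invariant, `h` is right invariant, and the domain of `κ` is dense. The other requirements are
carried over from the data.

Matrix elements. That `W` is a multiplier of `𝒦(H) ⊗ A` puts the slices `(ω_{x,y} ⊗ id)W` only in
`M(A)`. Condition 1 expresses, in weak form, the covariance `W(a ⊗ 1) = δ(a)W`. Hence the slice of
`W` at the vectors `π(d)⋆x` and `π(a)η(c)` is the slice of `(d ⊗ 1)δ(a)W` at `x` and `η(c)`.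
Properness puts `(d ⊗ 1)δ(a)` in `A ⊗ A`, and slicing an element of `A ⊗ A` times `W` gives an
element of `A`. Letting `d` and `a` run through the approximate unit yields
`exists_map_eq_vecSlice`. The two ingredients are `exists_leftIdeal_eq_slice_mul`, which uses that
the GNS map is closed, and the extension `sliceMul` from algebraic tensors to the minimal tensor
product.

Strong right invariance. With `φ̄` the functional `dualStar φ`, one has `(φ * a⋆)b = (φ̄ * a)⋆b`.
The weight of this product is the inner product of `(id ⊗ φ̄)(W)η(a)` with `η(b)`, and moving the
adjoint across turns the operator into `(id ⊗ φ)(W⋆)`, which condition 2 identifies.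

Right invariance. A positive functional is a vector functional `ω_ξ` of the universal
representation. Write the positive element as `b⋆b`. Then `(id ⊗ ω_ξ)δ(b⋆b)` is a norm convergent
sum of `cᵢ⋆cᵢ` with `cᵢ = (id ⊗ ω_{xᵢ,ξ})δ(b)`, so lower semicontinuity lets `h` pass through the
sum. By Parseval, `h(cᵢ⋆cᵢ)` is the sum over `j` of `|⟪xᵢ, mⱼξ⟫|²`, where `mⱼ` are matrix elements
of `W` at `η(b)`. Exchanging the sums leaves the sum of `‖mⱼξ‖²`, which is `‖η(b)‖²‖ξ‖²` because
`W⋆W = 1`. This is `apply_conv_star_mul_self`.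

Density. Gaussian averages of `t ↦ τ_t(a)` are entire for `τ` and approximate `a`; see
`IsPolarDecomposition.dense_domain`. -/

/-- The functional `x ↦ conj (φ (star x))`. -/
noncomputable def dualStar (φ : B →L[ℂ] ℂ) : B →L[ℂ] ℂ :=
  LinearMap.mkContinuous
    { toFun := fun x => starRingEnd ℂ (φ (star x))
      map_add' := fun x y => by simp
      map_smul' := fun c x => by simp } ‖φ‖ fun x => by
    simpa using φ.le_opNorm (star x)

@[simp] theorem dualStar_apply (φ : B →L[ℂ] ℂ) (x : B) :
    dualStar φ x = starRingEnd ℂ (φ (star x)) := rfl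

/-- The functional `φ(f ·)`. -/
noncomputable def leftMulDual (f : B) (φ : B →L[ℂ] ℂ) : B →L[ℂ] ℂ :=
  φ ∘L ContinuousLinearMap.mul ℂ B f

@[simp] theorem leftMulDual_apply (f : B) (φ : B →L[ℂ] ℂ) (x : B) :
    leftMulDual f φ x = φ (f * x) := rfl

variable [PartialOrder B] [StarOrderedRing B]

/-- An approximate form of Cohen factorisation in the dual. If no `g` worked, one could add up
almost orthogonal elements on each of which `φ` has real part at least `ε`. After `n` steps `φ`
would be at least `nε` on an element of norm at most `√(6n)`, against boundedness of `φ`. -/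
theorem exists_norm_sub_mul_right_le (φ : B →L[ℂ] ℂ) {ε : ℝ} (hε : 0 < ε) :
    ∃ g : B, ∀ x, ‖φ x - φ (x * g)‖ ≤ ε * ‖x‖ := by
  by_contra! hcon
  have hnorm : ∀ g : B, ∃ x : B, ‖x‖ ≤ 1 ∧ ε ≤ (φ (x - x * g)).re := by
    intro g
    obtain ⟨x, hx⟩ := hcon g
    have hx0 : 0 < ‖x‖ := by
      rcases (norm_nonneg x).eq_or_lt with h | h
      · rw [norm_eq_zero.1 h.symm] at hx; simp at hx
      · exact h
    set w := φ (x - x * g) with hw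
    rw [← map_sub, ← hw] at hx
    have hw0 : 0 < ‖w‖ := lt_trans (mul_pos hε hx0) hx
    -- Normalise `x` and rotate its phase so that the value of `φ` becomes the positive number `‖w‖
    -- / ‖x‖`.
    refine ⟨((‖x‖ * ‖w‖ : ℝ) : ℂ)⁻¹ • (starRingEnd ℂ w) • x, ?_, ?_⟩
    · rw [norm_smul, norm_smul, norm_inv, Complex.norm_real, Real.norm_of_nonneg (by positivity),
        RCLike.norm_conj]
      exact le_of_eq (by field_simp)
    · rw [smul_mul_assoc, smul_mul_assoc, ← smul_sub, ← smul_sub, map_smul, map_smul, ← hw,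
        smul_eq_mul, smul_eq_mul, ← Complex.normSq_eq_conj_mul_self, Complex.normSq_eq_norm_sq,
        ← Complex.ofReal_inv, ← Complex.ofReal_mul, Complex.ofReal_re, mul_inv, sq]
      rw [show ‖x‖⁻¹ * ‖w‖⁻¹ * (‖w‖ * ‖w‖) = ‖w‖ / ‖x‖ by field_simp, le_div_iff₀ hx0]
      exact hx.le
  have hau := CStarAlgebra.increasingApproximateUnit B
  -- The next summand is `z = x - xg` with `g` almost a unit for `star y`, so the cross term `z *
  -- star y` has norm at most 1. The norm square grows by at most `4 + 1 + 1 = 6`.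
  have key : ∀ n : ℕ, ∃ y : B, ‖y‖ ^ 2 ≤ 6 * n ∧ n * ε ≤ (φ y).re := by
    intro n
    induction n with
    | zero => exact ⟨0, by simp⟩
    | succ n ih =>
      obtain ⟨y, hy1, hy2⟩ := ih
      have hlim : Tendsto (fun g : B => ‖star y - g * star y‖) (CStarAlgebra.approximateUnit B)
          (𝓝 0) := by
        have := (tendsto_const_nhds (x := star y)).sub (hau.tendsto_mul_right (star y))
        simpa using this.norm
      obtain ⟨g, hg1, hg2⟩ := ((hlim.eventually (ge_mem_nhds one_pos)).and
        hau.eventually_norm).exists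
      obtain ⟨x, hx1, hx2⟩ := hnorm g
      set z := x - x * g with hz
      have hz1 : ‖z‖ ≤ 2 := by
        calc ‖z‖ ≤ ‖x‖ + ‖x‖ * ‖g‖ := (norm_sub_le _ _).trans (by gcongr; exact norm_mul_le _ _)
          _ ≤ 1 + 1 * 1 := by gcongr
          _ = 2 := by norm_num
      have hz2 : ‖z * star y‖ ≤ 1 := by
        rw [hz, sub_mul, mul_assoc, ← mul_sub]
        calc _ ≤ ‖x‖ * ‖star y - g * star y‖ := norm_mul_le _ _
          _ ≤ 1 * 1 := by gcongr
          _ = 1 := by norm_num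
      refine ⟨y + z, ?_, ?_⟩
      · have e1 : (y + z) * star (y + z) =
            y * star y + z * star z + (z * star y + star (z * star y)) := by
          simp only [star_add, star_mul, star_star, add_mul, mul_add]; abel
        have e2 : ‖y + z‖ ^ 2 = ‖(y + z) * star (y + z)‖ := by
          rw [CStarRing.norm_self_mul_star, sq]
        rw [e2, e1]
        calc _ ≤ ‖y * star y‖ + ‖z * star z‖ + (‖z * star y‖ + ‖star (z * star y)‖) :=
              (norm_add_le _ _).trans (add_le_add (norm_add_le _ _) (norm_add_le _ _))
          _ = ‖y‖ ^ 2 + ‖z‖ ^ 2 + (‖z * star y‖ + ‖z * star y‖) := by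
              rw [CStarRing.norm_self_mul_star, CStarRing.norm_self_mul_star, norm_star, sq, sq]
          _ ≤ 6 * n + 2 ^ 2 + (1 + 1) := by gcongr
          _ = 6 * (n + 1 : ℕ) := by push_cast; ring
      · rw [map_add, Complex.add_re]; push_cast; linarith
  obtain ⟨n, hn⟩ := exists_nat_gt (6 * ‖φ‖ ^ 2 / ε ^ 2)
  obtain ⟨y, hy1, hy2⟩ := key n
  rw [div_lt_iff₀ (by positivity)] at hn
  have hn0 : (0 : ℝ) < n := by
    rcases (Nat.cast_nonneg n : (0 : ℝ) ≤ n).eq_or_lt with h0 | h0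
    · rw [← h0] at hn; nlinarith [sq_nonneg ‖φ‖]
    · exact h0
  have h3 : n * ε ≤ ‖φ‖ * ‖y‖ :=
    hy2.trans ((Complex.re_le_norm _).trans (φ.le_opNorm y))
  have h4 : (n * ε) ^ 2 ≤ ‖φ‖ ^ 2 * (6 * n) := by
    calc (n * ε) ^ 2 ≤ (‖φ‖ * ‖y‖) ^ 2 := by gcongr
      _ = ‖φ‖ ^ 2 * ‖y‖ ^ 2 := by ring
      _ ≤ _ := by gcongr
  nlinarith

theorem exists_norm_sub_mul_left_le (φ : B →L[ℂ] ℂ) {ε : ℝ} (hε : 0 < ε) :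
    ∃ g : B, ∀ x, ‖φ x - φ (g * x)‖ ≤ ε * ‖x‖ := by
  obtain ⟨g, hg⟩ := exists_norm_sub_mul_right_le (dualStar φ) hε
  refine ⟨star g, fun x => ?_⟩
  have := hg (star x)
  rw [norm_star] at this
  simpa [← map_sub] using this

end Functionals

/-! ### Strict extension of functionals to multipliers -/

section StrictEval

variable {B : Type*} [NonUnitalCStarAlgebra B]
variable {K : Type*} [NormedAddCommGroup K] [InnerProductSpace ℂ K] [CompleteSpace K]

/-- The operators which multiply the range of `ρ` into itself from both sides. -/
def multRep (ρ : B →⋆ₙₐ[ℂ] Op K) : Submodule ℂ (Op K) where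
  carrier := {m | ∀ b, (∃ c, ρ c = m * ρ b) ∧ ∃ c, ρ c = ρ b * m}
  zero_mem' := fun b => ⟨⟨0, by simp⟩, ⟨0, by simp⟩⟩
  add_mem' := by
    intro m n hm hn b
    obtain ⟨⟨c, hc⟩, c', hc'⟩ := hm b
    obtain ⟨⟨d, hd⟩, d', hd'⟩ := hn b
    exact ⟨⟨c + d, by rw [map_add, hc, hd, add_mul]⟩, c' + d', by rw [map_add, hc', hd', mul_add]⟩
  smul_mem' := by
    intro k m hm b
    obtain ⟨⟨c, hc⟩, c', hc'⟩ := hm b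
    exact ⟨⟨k • c, by rw [map_smul, hc, smul_mul_assoc]⟩,
      k • c', by rw [map_smul, hc', mul_smul_comm]⟩

variable {ρ : B →⋆ₙₐ[ℂ] Op K}

theorem map_mem_multRep (a : B) : ρ a ∈ multRep ρ :=
  fun b => ⟨⟨a * b, map_mul _ _ _⟩, b * a, map_mul _ _ _⟩

theorem one_mem_multRep : (1 : Op K) ∈ multRep ρ :=
  fun b => ⟨⟨b, by simp⟩, b, by simp⟩

theorem star_mem_multRep {m : Op K} (hm : m ∈ multRep ρ) : star m ∈ multRep ρ := by
  intro b
  obtain ⟨⟨c, hc⟩, c', hc'⟩ := hm (star b)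
  refine ⟨⟨star c', ?_⟩, star c, ?_⟩
  · rw [map_star, hc', star_mul, map_star, star_star]
  · rw [map_star, hc, star_mul, map_star, star_star]

variable (hρ : Function.Injective ρ)

include hρ in
theorem isClosed_range_rep : IsClosed (Set.range ρ) :=
  (NonUnitalStarAlgHom.isometry ρ hρ).isClosedEmbedding.isClosed_range

variable [PartialOrder B] [StarOrderedRing B]

include hρ in
/-- The strict extension of a functional to multipliers exists. -/
theorem tendsto_strictEval (φ : B →L[ℂ] ℂ) {m : Op K} (hm : m ∈ multRep ρ) :
    Tendsto (fun e => φ (Function.invFun ρ (m * ρ e))) (CStarAlgebra.approximateUnit B)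
      (𝓝 (strictEval ρ φ m)) := by
  have hinv : ∀ c, Function.invFun ρ (ρ c) = c := Function.leftInverse_invFun hρ
  have hau := CStarAlgebra.increasingApproximateUnit B
  have := hau.neBot
  refine tendsto_nhds_limUnder ?_
  rw [← cauchy_map_iff_exists_tendsto, Metric.cauchy_iff]
  refine ⟨inferInstance, fun ε hε => ?_⟩
  -- Replacing `φ` by `φ(g ·)` costs little uniformly in `e`, and `gm` is an element `c` of the
  -- algebra, so `φ(g m e) = φ(c e)` does converge.
  obtain ⟨g, hg⟩ := exists_norm_sub_mul_left_le φ (ε := ε / (4 * (‖m‖ + 1))) (by positivity)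
  obtain ⟨-, c, hc⟩ := hm g
  have hlim : Tendsto (fun e => ‖φ (c * e) - φ c‖) (CStarAlgebra.approximateUnit B) (𝓝 0) := by
    have := ((φ.continuous.tendsto c).comp (hau.tendsto_mul_left c)).sub
      (tendsto_const_nhds (x := φ c))
    simpa using this.norm
  have hev := (hlim.eventually (gt_mem_nhds (show (0 : ℝ) < ε / 4 by positivity))).and
    hau.eventually_norm
  refine ⟨Metric.ball (φ c) (ε / 2), ?_, ?_⟩
  · rw [mem_map]
    filter_upwards [hev] with e he
    obtain ⟨⟨d, hd⟩, -⟩ := hm e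
    have hd1 : g * d = c * e := hρ (by rw [map_mul, map_mul, hd, hc, mul_assoc])
    have hd2 : ‖d‖ ≤ ‖m‖ := by
      rw [← NonUnitalStarAlgHom.norm_map ρ hρ, hd]
      calc _ ≤ ‖m‖ * ‖ρ e‖ := norm_mul_le _ _
        _ ≤ ‖m‖ * 1 := by
          gcongr; rw [NonUnitalStarAlgHom.norm_map ρ hρ]; exact he.2
        _ = ‖m‖ := mul_one _
    rw [Set.mem_preimage, mem_ball_iff_norm, ← hd, hinv]
    have h1 := hg d
    rw [hd1] at h1
    calc ‖φ d - φ c‖ = ‖(φ d - φ (c * e)) + (φ (c * e) - φ c)‖ := by congr 1; ring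
      _ ≤ ‖φ d - φ (c * e)‖ + ‖φ (c * e) - φ c‖ := norm_add_le _ _
      _ < ε / (4 * (‖m‖ + 1)) * ‖d‖ + ε / 4 := by linarith [he.1]
      _ ≤ ε / (4 * (‖m‖ + 1)) * (‖m‖ + 1) + ε / 4 := by gcongr; linarith
      _ = ε / 2 := by field_simp; ring
  · intro x hx y hy
    rw [Metric.mem_ball] at hx hy
    calc dist x y ≤ dist x (φ c) + dist y (φ c) := dist_triangle_right _ _ _
      _ < ε := by linarith

include hρ in
theorem strictEval_map (φ : B →L[ℂ] ℂ) (a : B) : strictEval ρ φ (ρ a) = φ a := by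
  have hau := CStarAlgebra.increasingApproximateUnit B
  refine tendsto_nhds_unique (tendsto_strictEval hρ φ (map_mem_multRep a)) ?_
  refine ((φ.continuous.tendsto a).comp (hau.tendsto_mul_left a)).congr fun e => ?_
  rw [← map_mul, Function.leftInverse_invFun hρ, Function.comp]

include hρ in
theorem strictEval_add (φ : B →L[ℂ] ℂ) {m n : Op K} (hm : m ∈ multRep ρ) (hn : n ∈ multRep ρ) :
    strictEval ρ φ (m + n) = strictEval ρ φ m + strictEval ρ φ n := by
  refine tendsto_nhds_unique (tendsto_strictEval hρ φ (add_mem hm hn)) ?_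
  refine ((tendsto_strictEval hρ φ hm).add (tendsto_strictEval hρ φ hn)).congr fun e => ?_
  obtain ⟨⟨c, hc⟩, -⟩ := hm e
  obtain ⟨⟨d, hd⟩, -⟩ := hn e
  rw [add_mul, ← hc, ← hd, ← map_add ρ, Function.leftInverse_invFun hρ,
    Function.leftInverse_invFun hρ, Function.leftInverse_invFun hρ, map_add]

include hρ in
theorem strictEval_smul (φ : B →L[ℂ] ℂ) (k : ℂ) {m : Op K} (hm : m ∈ multRep ρ) :
    strictEval ρ φ (k • m) = k * strictEval ρ φ m := by
  refine tendsto_nhds_unique (tendsto_strictEval hρ φ (Submodule.smul_mem _ k hm)) ?_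
  refine ((tendsto_strictEval hρ φ hm).const_mul k).congr fun e => ?_
  obtain ⟨⟨c, hc⟩, -⟩ := hm e
  rw [smul_mul_assoc, ← hc, ← map_smul ρ, Function.leftInverse_invFun hρ,
    Function.leftInverse_invFun hρ, map_smul, smul_eq_mul]

include hρ in
theorem norm_strictEval_le (φ : B →L[ℂ] ℂ) {m : Op K} (hm : m ∈ multRep ρ) :
    ‖strictEval ρ φ m‖ ≤ ‖φ‖ * ‖m‖ := by
  have hau := CStarAlgebra.increasingApproximateUnit B
  have := hau.neBot
  refine le_of_tendsto (tendsto_strictEval hρ φ hm).norm ?_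
  filter_upwards [hau.eventually_norm] with e he
  obtain ⟨⟨c, hc⟩, -⟩ := hm e
  rw [← hc, Function.leftInverse_invFun hρ]
  refine (φ.le_opNorm c).trans ?_
  gcongr
  rw [← NonUnitalStarAlgHom.norm_map ρ hρ, hc]
  calc _ ≤ ‖m‖ * ‖ρ e‖ := norm_mul_le _ _
    _ ≤ ‖m‖ * 1 := by gcongr; rw [NonUnitalStarAlgHom.norm_map ρ hρ]; exact he
    _ = ‖m‖ := mul_one _

include hρ in
theorem strictEval_leftMulDual (φ : B →L[ℂ] ℂ) {f c : B} {m : Op K} (hm : m ∈ multRep ρ)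
    (hc : ρ c = ρ f * m) : strictEval ρ (leftMulDual f φ) m = φ c := by
  have hau := CStarAlgebra.increasingApproximateUnit B
  refine tendsto_nhds_unique (tendsto_strictEval hρ (leftMulDual f φ) hm) ?_
  refine ((φ.continuous.tendsto c).comp (hau.tendsto_mul_left c)).congr fun e => ?_
  obtain ⟨⟨d, hd⟩, -⟩ := hm e
  have : f * d = c * e := hρ (by rw [map_mul, map_mul, hd, hc, mul_assoc])
  rw [← hd, Function.leftInverse_invFun hρ, leftMulDual_apply, this, Function.comp]

include hρ in
theorem strictEval_sub_dual (φ ψ : B →L[ℂ] ℂ) {m : Op K} (hm : m ∈ multRep ρ) :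
    strictEval ρ (φ - ψ) m = strictEval ρ φ m - strictEval ρ ψ m := by
  refine tendsto_nhds_unique (tendsto_strictEval hρ (φ - ψ) hm) ?_
  exact ((tendsto_strictEval hρ φ hm).sub (tendsto_strictEval hρ ψ hm)).congr fun e => by simp

include hρ in
-- The limit defining the extension multiplies by `e` on the right, and the adjoint moves `e` to the
-- left, so the two sides are limits of different nets. Both are within `ε / 2` of `φ(c)`, where `c`
-- represents `g m⋆` and `φ` is close to `φ(g ·)`.
theorem strictEval_star (φ : B →L[ℂ] ℂ) {m : Op K} (hm : m ∈ multRep ρ) :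
    strictEval ρ φ (star m) = starRingEnd ℂ (strictEval ρ (dualStar φ) m) := by
  have hinv : ∀ c, Function.invFun ρ (ρ c) = c := Function.leftInverse_invFun hρ
  have hau := CStarAlgebra.increasingApproximateUnit B
  have := hau.neBot
  rw [← sub_eq_zero, ← norm_eq_zero]
  refine le_antisymm (le_of_forall_pos_le_add fun ε hε => ?_) (norm_nonneg _)
  rw [zero_add]
  obtain ⟨g, hg⟩ := exists_norm_sub_mul_left_le φ (ε := ε / (2 * (‖m‖ + 1))) (by positivity)
  have hms := star_mem_multRep hm
  obtain ⟨-, c, hc⟩ := hms g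
  have h0 : ∀ r : ℝ, r ≤ ε / (2 * (‖m‖ + 1)) * ‖m‖ → r ≤ ε / 2 := fun r hr => hr.trans <| by
    calc ε / (2 * (‖m‖ + 1)) * ‖m‖ ≤ ε / (2 * (‖m‖ + 1)) * (‖m‖ + 1) := by gcongr; linarith
      _ = ε / 2 := by field_simp
  have h1 : ‖strictEval ρ φ (star m) - φ c‖ ≤ ε / 2 := by
    refine h0 _ ?_
    rw [← strictEval_leftMulDual hρ φ hms hc, ← strictEval_sub_dual hρ _ _ hms]
    refine (norm_strictEval_le hρ _ hms).trans ?_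
    rw [norm_star]
    gcongr
    exact ContinuousLinearMap.opNorm_le_bound _ (by positivity) fun x => by simpa using hg x
  have h2 : ‖starRingEnd ℂ (strictEval ρ (dualStar φ) m) - φ c‖ ≤ ε / 2 := by
    refine h0 _ ?_
    have e1 : Tendsto (fun e => starRingEnd ℂ (dualStar φ (Function.invFun ρ (m * ρ e))))
        (CStarAlgebra.approximateUnit B) (𝓝 (starRingEnd ℂ (strictEval ρ (dualStar φ) m))) :=
      (RCLike.continuous_conj.tendsto _).comp (tendsto_strictEval hρ _ hm)
    -- For self-adjoint `e` the argument is `(g e) m⋆`, which tends in norm to `g m⋆`.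
    have e2 : Tendsto (fun e => φ (g * star (Function.invFun ρ (m * ρ e))))
        (CStarAlgebra.approximateUnit B) (𝓝 (φ c)) := by
      rw [← tendsto_sub_nhds_zero_iff]
      have hlim : Tendsto (fun e => ‖φ‖ * (‖g * e - g‖ * ‖m‖)) (CStarAlgebra.approximateUnit B)
          (𝓝 0) := by
        have := ((hau.tendsto_mul_left g).sub (tendsto_const_nhds (x := g))).norm
        simpa using (this.mul_const ‖m‖).const_mul ‖φ‖
      refine squeeze_zero_norm' ?_ hlim
      filter_upwards [hau.eventually_star_eq] with e he
      obtain ⟨⟨d, hd⟩, -⟩ := hm e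
      rw [← hd, hinv, ← map_sub]
      refine (φ.le_opNorm _).trans ?_
      gcongr
      rw [← NonUnitalStarAlgHom.norm_map ρ hρ, map_sub, map_mul, map_star, hd, hc, star_mul,
        ← map_star, he, ← mul_assoc, ← map_mul, ← sub_mul, ← map_sub]
      refine (norm_mul_le _ _).trans ?_
      rw [NonUnitalStarAlgHom.norm_map ρ hρ, norm_star]
    refine le_of_tendsto (e1.sub e2).norm ?_
    filter_upwards [hau.eventually_norm] with e he
    obtain ⟨⟨d, hd⟩, -⟩ := hm e
    rw [← hd, hinv]
    have := hg (star d)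
    simp only [dualStar_apply, RCLike.conj_conj]
    refine this.trans ?_
    gcongr
    rw [norm_star, ← NonUnitalStarAlgHom.norm_map ρ hρ, hd]
    calc _ ≤ ‖m‖ * ‖ρ e‖ := norm_mul_le _ _
      _ ≤ ‖m‖ * 1 := by gcongr; rw [NonUnitalStarAlgHom.norm_map ρ hρ]; exact he
      _ = ‖m‖ := mul_one _
  calc _ = ‖(strictEval ρ φ (star m) - φ c) -
        (starRingEnd ℂ (strictEval ρ (dualStar φ) m) - φ c)‖ := by congr 1; ring
    _ ≤ ε / 2 + ε / 2 := (norm_sub_le _ _).trans (add_le_add h1 h2)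
    _ = ε := by ring

end StrictEval

/-- Uniformly bounded operators which converge pointwise on a set converge pointwise on the closed
linear span of the set. -/
theorem tendsto_of_mem_topologicalClosure_span {X Y ι : Type*} [NormedAddCommGroup X]
    [NormedSpace ℂ X] [NormedAddCommGroup Y] [NormedSpace ℂ Y] {l : Filter ι} {F : ι → X →L[ℂ] Y}
    {G : X →L[ℂ] Y} {C : ℝ} (hC : ∀ᶠ i in l, ‖F i‖ ≤ C) {S : Set X}
    (hS : ∀ v ∈ S, Tendsto (fun i => F i v) l (𝓝 (G v))) {v : X}
    (hv : v ∈ (Submodule.span ℂ S).topologicalClosure) :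
    Tendsto (fun i => F i v) l (𝓝 (G v)) := by
  let N : Submodule ℂ X :=
    { carrier := {v | Tendsto (fun i => F i v) l (𝓝 (G v))}
      zero_mem' := by simp [tendsto_const_nhds]
      add_mem' := fun {a b} ha hb => by simpa using Tendsto.add ha hb
      smul_mem' := fun c a ha => by simpa using Tendsto.const_smul ha c }
  have hN : Submodule.span ℂ S ≤ N := Submodule.span_le.2 hS
  have hv' : v ∈ closure (N : Set X) := closure_mono hN hv
  rw [Metric.tendsto_nhds]
  intro ε hε
  have hC' : 0 < |C| + ‖G‖ + 1 := by positivity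
  obtain ⟨w, hw, hvw⟩ := Metric.mem_closure_iff.1 hv' (ε / 2 / (|C| + ‖G‖ + 1)) (by positivity)
  have hw' : Tendsto (fun i => F i w) l (𝓝 (G w)) := hw
  filter_upwards [hC, (Metric.tendsto_nhds.1 hw') (ε / 2) (by positivity)] with i hi1 hi2
  rw [dist_eq_norm] at hvw hi2 ⊢
  rw [lt_div_iff₀ hC'] at hvw
  calc ‖F i v - G v‖ = ‖F i (v - w) - G (v - w) + (F i w - G w)‖ := by
        rw [map_sub, map_sub]; congr 1; abel
    _ ≤ ‖F i (v - w)‖ + ‖G (v - w)‖ + ‖F i w - G w‖ :=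
        (norm_add_le _ _).trans (by gcongr; exact norm_sub_le _ _)
    _ ≤ |C| * ‖v - w‖ + ‖G‖ * ‖v - w‖ + ‖F i w - G w‖ := by
        gcongr
        · exact ContinuousLinearMap.le_of_opNorm_le _ (hi1.trans (le_abs_self C)) _
        · exact ContinuousLinearMap.le_opNorm _ _
    _ < ε := by nlinarith [norm_nonneg (v - w)]

/-! ### Elementary tensors, legs and slices of operators -/

section Tensor

variable {H : Type*} [NormedAddCommGroup H] [InnerProductSpace ℂ H]
variable {K : Type*} [NormedAddCommGroup K] [InnerProductSpace ℂ K]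

@[simp] theorem inner_tvec (x x' : H) (y y' : K) :
    ⟪tvec x y, tvec x' y'⟫_ℂ = ⟪x, x'⟫_ℂ * ⟪y, y'⟫_ℂ := by
  simp [tvec]

@[simp] theorem norm_tvec (x : H) (y : K) : ‖tvec x y‖ = ‖x‖ * ‖y‖ := by
  simp [tvec]

theorem dense_span_tvec :
    Dense (Submodule.span ℂ {v : HTensor H K | ∃ x y, v = tvec x y} : Set (HTensor H K)) := by
  intro v
  induction v using UniformSpace.Completion.induction_on with
  | hp => exact isClosed_closure
  | ih t =>
    refine subset_closure ?_
    induction t using TensorProduct.induction_on with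
    | zero => exact zero_mem _
    | tmul x y => exact Submodule.subset_span ⟨x, y, rfl⟩
    | add s t hs ht =>
      rw [SetLike.mem_coe, UniformSpace.Completion.coe_add]
      exact add_mem hs ht

theorem HTensor.clm_ext {F : Type*} [NormedAddCommGroup F] [NormedSpace ℂ F]
    {S T : HTensor H K →L[ℂ] F} (h : ∀ x y, S (tvec x y) = T (tvec x y)) : S = T :=
  ContinuousLinearMap.ext_on dense_span_tvec (by rintro _ ⟨x, y, rfl⟩; exact h x y)

theorem HTensor.vec_ext {v w : HTensor H K} (h : ∀ x y, ⟪tvec x y, v⟫_ℂ = ⟪tvec x y, w⟫_ℂ) :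
    v = w := by
  have : innerSL ℂ v = innerSL ℂ w := HTensor.clm_ext fun x y => by
    rw [innerSL_apply_apply, innerSL_apply_apply, ← inner_conj_symm, h, inner_conj_symm]
  refine ext_inner_right ℂ fun u => ?_
  simpa using congrArg (fun f : HTensor H K →L[ℂ] ℂ => f u) this

theorem HTensor.op_ext {S T : Op (HTensor H K)}
    (h : ∀ x y x' y', ⟪tvec x y, S (tvec x' y')⟫_ℂ = ⟪tvec x y, T (tvec x' y')⟫_ℂ) : S = T :=
  HTensor.clm_ext fun x' y' => HTensor.vec_ext fun x y => h x y x' y'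

theorem opTensor_mul (S S' : Op H) (T T' : Op K) :
    opTensor S T * opTensor S' T' = opTensor (S * S') (T * T') :=
  HTensor.clm_ext fun x y => by simp [opTensor_tvec]

theorem opTensor_add_left (S S' : Op H) (T : Op K) :
    opTensor (S + S') T = opTensor S T + opTensor S' T :=
  HTensor.op_ext fun x y x' y' => by simp [opTensor_tvec, inner_add_right, add_mul]

theorem opTensor_add_right (S : Op H) (T T' : Op K) :
    opTensor S (T + T') = opTensor S T + opTensor S T' :=
  HTensor.op_ext fun x y x' y' => by simp [opTensor_tvec, inner_add_right, mul_add]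

theorem opTensor_smul_left (c : ℂ) (S : Op H) (T : Op K) :
    opTensor (c • S) T = c • opTensor S T :=
  HTensor.op_ext fun x y x' y' => by simp [opTensor_tvec, inner_smul_right, mul_assoc]

theorem opTensor_smul_right (c : ℂ) (S : Op H) (T : Op K) :
    opTensor S (c • T) = c • opTensor S T :=
  HTensor.op_ext fun x y x' y' => by simp [opTensor_tvec, inner_smul_right, mul_left_comm]

theorem norm_opTensor_le (S : Op H) (T : Op K) : ‖opTensor S T‖ ≤ ‖S‖ * ‖T‖ := by
  refine ContinuousLinearMap.opNorm_le_bound _ (by positivity) fun v => ?_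
  induction v using UniformSpace.Completion.induction_on with
  | hp => exact isClosed_le (by fun_prop) (by fun_prop)
  | ih t =>
    simp only [opTensor, ContinuousLinearMap.completion_apply_coe,
      UniformSpace.Completion.norm_coe]
    exact ContinuousLinearMap.le_of_opNorm_le _ (TensorProduct.norm_mapL_le S T) t

theorem star_opTensor [CompleteSpace H] [CompleteSpace K] (S : Op H) (T : Op K) :
    star (opTensor S T) = opTensor (star S) (star T) :=
  HTensor.op_ext fun x y x' y' => by
    simp [opTensor_tvec, ContinuousLinearMap.star_eq_adjoint,
      ContinuousLinearMap.adjoint_inner_right]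

/-- The bounded linear map `x ↦ (k ↦ x ⊗ k)`. -/
noncomputable def leftLegL : H →L[ℂ] K →L[ℂ] HTensor H K :=
  (ContinuousLinearMap.compL ℂ K (H ⊗[ℂ] K) (HTensor H K) UniformSpace.Completion.toComplL) ∘L
    TensorProduct.mkL ℂ H K

/-- The bounded linear map `k ↦ (x ↦ x ⊗ k)`. -/
noncomputable def rightLegL : K →L[ℂ] H →L[ℂ] HTensor H K := leftLegL.flip

@[simp] theorem leftLeg_apply (x : H) (y : K) : leftLeg x y = tvec x y := rfl

@[simp] theorem leftLegL_apply_apply (x : H) (y : K) : leftLegL x y = tvec x y := rfl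

@[simp] theorem rightLegL_apply_apply (x : H) (y : K) : rightLegL y x = tvec x y := rfl

theorem norm_leftLeg_le (x : H) : ‖(leftLeg x : K →L[ℂ] HTensor H K)‖ ≤ ‖x‖ :=
  ContinuousLinearMap.opNorm_le_bound _ (norm_nonneg _) fun y => by simp

theorem tvec_add_left (x x' : H) (y : K) : tvec (x + x') y = tvec x y + tvec x' y := by
  simp [← leftLegL_apply_apply]

theorem tvec_smul_left (c : ℂ) (x : H) (y : K) : tvec (c • x) y = c • tvec x y := by
  simp [← leftLegL_apply_apply]

section VecSlice

variable [CompleteSpace K]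

theorem vecSlice_ext {x y : H} {T : Op (HTensor H K)} {S : Op K}
    (h : ∀ z u, ⟪tvec x z, T (tvec y u)⟫_ℂ = ⟪z, S u⟫_ℂ) : vecSlice x y T = S :=
  ContinuousLinearMap.ext fun u => ext_inner_left ℂ fun z => by rw [inner_vecSlice, h]

theorem vecSlice_add (x y : H) (S T : Op (HTensor H K)) :
    vecSlice x y (S + T) = vecSlice x y S + vecSlice x y T :=
  vecSlice_ext fun z u => by simp [inner_add_right, inner_vecSlice]

theorem vecSlice_smul (x y : H) (c : ℂ) (T : Op (HTensor H K)) :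
    vecSlice x y (c • T) = c • vecSlice x y T :=
  vecSlice_ext fun z u => by simp [inner_smul_right, inner_vecSlice]

theorem norm_vecSlice_le (x y : H) (T : Op (HTensor H K)) :
    ‖vecSlice x y T‖ ≤ ‖x‖ * ‖y‖ * ‖T‖ := by
  rw [vecSlice]
  calc _ ≤ ‖(leftLeg x : K →L[ℂ] HTensor H K).adjoint‖ * (‖T‖ * ‖leftLeg y‖) :=
        (ContinuousLinearMap.opNorm_comp_le _ _).trans
          (by gcongr; exact ContinuousLinearMap.opNorm_comp_le _ _)
    _ ≤ ‖x‖ * (‖T‖ * ‖y‖) := by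
        rw [LinearIsometryEquiv.norm_map]
        gcongr
        · exact norm_leftLeg_le x
        · exact norm_leftLeg_le y
    _ = _ := by ring

/-- The slice map as a bounded linear map. -/
noncomputable def vecSliceL (x y : H) : Op (HTensor H K) →L[ℂ] Op K :=
  LinearMap.mkContinuous
    { toFun := vecSlice x y
      map_add' := vecSlice_add x y
      map_smul' := vecSlice_smul x y } (‖x‖ * ‖y‖) (norm_vecSlice_le x y)

@[simp] theorem vecSliceL_apply (x y : H) (T : Op (HTensor H K)) :
    vecSliceL x y T = vecSlice x y T := rfl

theorem vecSlice_add_left (x x' y : H) (T : Op (HTensor H K)) :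
    vecSlice (x + x') y T = vecSlice x y T + vecSlice x' y T :=
  vecSlice_ext fun z u => by simp [inner_vecSlice, tvec_add_left, inner_add_left]

theorem vecSlice_smul_left (c : ℂ) (x y : H) (T : Op (HTensor H K)) :
    vecSlice (c • x) y T = starRingEnd ℂ c • vecSlice x y T :=
  vecSlice_ext fun z u => by simp [inner_vecSlice, tvec_smul_left, inner_smul_left]

theorem vecSlice_add_right (x y y' : H) (T : Op (HTensor H K)) :
    vecSlice x (y + y') T = vecSlice x y T + vecSlice x y' T :=
  vecSlice_ext fun z u => by simp [inner_add_right, inner_vecSlice, tvec_add_left]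

theorem vecSlice_smul_right (c : ℂ) (x y : H) (T : Op (HTensor H K)) :
    vecSlice x (c • y) T = c • vecSlice x y T :=
  vecSlice_ext fun z u => by simp [inner_smul_right, inner_vecSlice, tvec_smul_left]

theorem vecSlice_opTensor (x y : H) (S : Op H) (T : Op K) :
    vecSlice x y (opTensor S T) = ⟪x, S y⟫_ℂ • T :=
  vecSlice_ext fun z u => by simp [opTensor_tvec]

theorem vecSlice_mul_opTensor (x y : H) (T : Op (HTensor H K)) (S : Op H) (S' : Op K) :
    vecSlice x y (T * opTensor S S') = vecSlice x (S y) T * S' :=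
  vecSlice_ext fun z u => by simp [opTensor_tvec, inner_vecSlice]

variable [CompleteSpace H]

theorem vecSlice_star (x y : H) (T : Op (HTensor H K)) :
    vecSlice x y (star T) = star (vecSlice y x T) :=
  vecSlice_ext fun z u => by
    rw [ContinuousLinearMap.star_eq_adjoint, ContinuousLinearMap.star_eq_adjoint,
      ContinuousLinearMap.adjoint_inner_right, ContinuousLinearMap.adjoint_inner_right,
      ← inner_conj_symm, ← inner_vecSlice, inner_conj_symm]

theorem vecSlice_opTensor_mul (x y : H) (T : Op (HTensor H K)) (S : Op H) (S' : Op K) :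
    vecSlice x y (opTensor S S' * T) = S' * vecSlice (star S x) y T := by
  rw [← star_star (opTensor S S' * T), vecSlice_star, star_mul, star_opTensor,
    vecSlice_mul_opTensor, star_mul, star_star, ← vecSlice_star, star_star]

end VecSlice

end Tensor

/-! ### Slices by functionals -/

section Slices

variable {B : Type*} [NonUnitalCStarAlgebra B] [PartialOrder B] [StarOrderedRing B]
variable {K : Type*} [NormedAddCommGroup K] [InnerProductSpace ℂ K] [CompleteSpace K]
variable {H : Type*} [NormedAddCommGroup H] [InnerProductSpace ℂ H]

omit [PartialOrder B] [StarOrderedRing B] in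
theorem vecSlice_mem_range_of_mem_spatialTensor {ρ : B →⋆ₙₐ[ℂ] Op K} (hρ : Function.Injective ρ)
    {X : Set (Op H)} {T : Op (HTensor H K)} (hT : T ∈ spatialTensor X (Set.range ρ)) (x y : H) :
    ∃ b, ρ b = vecSlice x y T := by
  let N : Submodule ℂ (Op (HTensor H K)) :=
    (LinearMap.range (ρ : B →ₗ[ℂ] Op K)).comap (vecSliceL x y).toLinearMap
  have hN : IsClosed (N : Set (Op (HTensor H K))) :=
    (isClosed_range_rep hρ).preimage (vecSliceL x y).continuous
  have : spatialTensor X (Set.range ρ) ≤ N := by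
    refine Submodule.topologicalClosure_minimal _ (Submodule.span_le.2 ?_) hN
    rintro _ ⟨S, -, _, ⟨b, rfl⟩, rfl⟩
    refine ⟨⟪x, S y⟫_ℂ • b, ?_⟩
    change ρ (⟪x, S y⟫_ℂ • b) = vecSlice x y _
    rw [vecSlice_opTensor, map_smul]
  exact this hT

/-- The operators all of whose slices multiply the range of `ρ` into itself. -/
def sliceMult (H : Type*) [NormedAddCommGroup H] [InnerProductSpace ℂ H]
    (ρ : B →⋆ₙₐ[ℂ] Op K) : Submodule ℂ (Op (HTensor H K)) where
  carrier := {T | ∀ x y, vecSlice x y T ∈ multRep ρ}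
  zero_mem' x y := by
    rw [← vecSliceL_apply, map_zero]; exact zero_mem _
  add_mem' hS hT x y := by
    rw [vecSlice_add]; exact add_mem (hS x y) (hT x y)
  smul_mem' c T hT x y := by
    rw [vecSlice_smul]; exact Submodule.smul_mem _ c (hT x y)

variable {ρ : B →⋆ₙₐ[ℂ] Op K} (hρ : Function.Injective ρ)

theorem IsSlice.norm_le (hρ : Function.Injective ρ) {φ : B →L[ℂ] ℂ} {T : Op (HTensor H K)}
    {S : Op H} (hS : IsSlice ρ φ T S) (hT : T ∈ sliceMult H ρ) : ‖S‖ ≤ ‖φ‖ * ‖T‖ := by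
  refine ContinuousLinearMap.opNorm_le_bound _ (by positivity) fun y => ?_
  rcases (norm_nonneg (S y)).eq_or_lt with h0 | h0
  · rw [← h0]; positivity
  refine le_of_mul_le_mul_left ?_ h0
  calc ‖S y‖ * ‖S y‖ = ‖⟪S y, S y⟫_ℂ‖ := by
        rw [inner_self_eq_norm_sq_to_K]; simp [sq]
    _ ≤ ‖φ‖ * (‖S y‖ * ‖y‖ * ‖T‖) := by
        rw [hS]
        refine (norm_strictEval_le hρ φ (hT _ _)).trans ?_
        gcongr
        exact norm_vecSlice_le _ _ _
    _ = _ := by ring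

variable [CompleteSpace H]

theorem IsSlice.star_of_dualStar (hρ : Function.Injective ρ) {φ : B →L[ℂ] ℂ}
    {T : Op (HTensor H K)} {S : Op H} (hS : IsSlice ρ (dualStar φ) T S) (hT : T ∈ sliceMult H ρ) :
    IsSlice ρ φ (star T) (star S) := by
  intro x y
  rw [vecSlice_star, strictEval_star hρ φ (hT y x), ← hS, ContinuousLinearMap.star_eq_adjoint,
    ContinuousLinearMap.adjoint_inner_right, inner_conj_symm]

include hρ in
-- The prescribed matrix coefficients form a bounded sesquilinear form in `x` and `y`, so the Riesz
-- theorem supplies the operator. Only the weak condition that all slices of `T` are multipliers is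
-- needed.
theorem isSlice_slice (φ : B →L[ℂ] ℂ) {T : Op (HTensor H K)} (hT : T ∈ sliceMult H ρ) :
    IsSlice ρ φ T (slice ρ φ T) := by
  let F : H →L⋆[ℂ] H →L[ℂ] ℂ := LinearMap.mkContinuous₂
    (LinearMap.mk₂'ₛₗ (starRingEnd ℂ) (RingHom.id ℂ) (fun x y => strictEval ρ φ (vecSlice x y T))
      (fun x x' y => by rw [vecSlice_add_left, strictEval_add hρ φ (hT _ _) (hT _ _)])
      (fun c x y => by rw [vecSlice_smul_left, strictEval_smul hρ φ _ (hT _ _), smul_eq_mul])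
      (fun x y y' => by rw [vecSlice_add_right, strictEval_add hρ φ (hT _ _) (hT _ _)])
      (fun c x y => by
        rw [vecSlice_smul_right, strictEval_smul hρ φ _ (hT _ _), RingHom.id_apply, smul_eq_mul]))
    (‖φ‖ * ‖T‖) (fun x y => by
      refine (norm_strictEval_le hρ φ (hT _ _)).trans ?_
      calc _ ≤ ‖φ‖ * (‖x‖ * ‖y‖ * ‖T‖) := by gcongr; exact norm_vecSlice_le _ _ _
        _ = _ := by ring)
  have hS : IsSlice ρ φ T (ContinuousLinearMap.adjoint
      (InnerProductSpace.continuousLinearMapOfBilin F)) := fun x y => by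
    rw [ContinuousLinearMap.adjoint_inner_right,
      InnerProductSpace.continuousLinearMapOfBilin_apply]
    rfl
  rwa [hS.slice_eq]

include hρ in
theorem norm_slice_le (φ : B →L[ℂ] ℂ) {T : Op (HTensor H K)} (hT : T ∈ sliceMult H ρ) :
    ‖slice ρ φ T‖ ≤ ‖φ‖ * ‖T‖ :=
  (isSlice_slice hρ φ hT).norm_le hρ hT

include hρ in
theorem slice_add (φ : B →L[ℂ] ℂ) {S T : Op (HTensor H K)} (hS : S ∈ sliceMult H ρ)
    (hT : T ∈ sliceMult H ρ) : slice ρ φ (S + T) = slice ρ φ S + slice ρ φ T :=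
  IsSlice.slice_eq fun x y => by
    rw [add_apply, inner_add_right, isSlice_slice hρ φ hS,
      isSlice_slice hρ φ hT, vecSlice_add, strictEval_add hρ φ (hS _ _) (hT _ _)]

include hρ in
theorem slice_smul (φ : B →L[ℂ] ℂ) (c : ℂ) {T : Op (HTensor H K)} (hT : T ∈ sliceMult H ρ) :
    slice ρ φ (c • T) = c • slice ρ φ T :=
  IsSlice.slice_eq fun x y => by
    rw [smul_apply, inner_smul_right, isSlice_slice hρ φ hT, vecSlice_smul,
      strictEval_smul hρ φ c (hT _ _)]

include hρ in
theorem slice_sub (φ : B →L[ℂ] ℂ) {S T : Op (HTensor H K)} (hS : S ∈ sliceMult H ρ)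
    (hT : T ∈ sliceMult H ρ) : slice ρ φ (S - T) = slice ρ φ S - slice ρ φ T := by
  rw [sub_eq_add_neg, sub_eq_add_neg, ← neg_one_smul ℂ T, ← neg_one_smul ℂ (slice ρ φ T),
    slice_add hρ φ hS (Submodule.smul_mem _ _ hT), slice_smul hρ φ _ hT]

include hρ in
theorem slice_sub_dual (φ ψ : B →L[ℂ] ℂ) {T : Op (HTensor H K)} (hT : T ∈ sliceMult H ρ) :
    slice ρ (φ - ψ) T = slice ρ φ T - slice ρ ψ T :=
  IsSlice.slice_eq fun x y => by
    rw [sub_apply, inner_sub_right, isSlice_slice hρ φ hT,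
      isSlice_slice hρ ψ hT, strictEval_sub_dual hρ φ ψ (hT _ _)]

include hρ in
theorem slice_star (φ : B →L[ℂ] ℂ) {T : Op (HTensor H K)} (hT : T ∈ sliceMult H ρ) :
    slice ρ φ (star T) = star (slice ρ (dualStar φ) T) :=
  ((isSlice_slice hρ (dualStar φ) hT).star_of_dualStar hρ hT).slice_eq

include hρ in
theorem spatialTensor_le_sliceMult (X : Set (Op H)) :
    spatialTensor X (Set.range ρ) ≤ sliceMult H ρ := fun T hT x y => by
  obtain ⟨b, hb⟩ := vecSlice_mem_range_of_mem_spatialTensor hρ hT x y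
  rw [← hb]; exact map_mem_multRep b

include hρ in
theorem slice_opTensor (φ : B →L[ℂ] ℂ) (S : Op H) (b : B) :
    slice ρ φ (opTensor S (ρ b)) = φ b • S :=
  IsSlice.slice_eq fun x y => by
    rw [vecSlice_opTensor, strictEval_smul hρ φ _ (map_mem_multRep b), strictEval_map hρ,
      smul_apply, inner_smul_right, mul_comm]

include hρ in
/-- `(id ⊗ φ(f ·))(T) = (id ⊗ φ)((1 ⊗ f)T)`. -/
theorem slice_leftMulDual (φ : B →L[ℂ] ℂ) (f : B) {T : Op (HTensor H K)}
    (hT : T ∈ sliceMult H ρ) :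
    opTensor 1 (ρ f) * T ∈ sliceMult H ρ ∧
      slice ρ (leftMulDual f φ) T = slice ρ φ (opTensor 1 (ρ f) * T) := by
  have key : ∀ x y : H, ∃ c, ρ c = ρ f * vecSlice x y T ∧
      vecSlice x y (opTensor 1 (ρ f) * T) = ρ c := fun x y => by
    obtain ⟨-, c, hc⟩ := hT x y f
    exact ⟨c, hc, by rw [vecSlice_opTensor_mul, star_one, one_apply_eq_self, hc]⟩
  have hmem : opTensor 1 (ρ f) * T ∈ sliceMult H ρ := fun x y => by
    obtain ⟨c, -, hc⟩ := key x y
    rw [hc]; exact map_mem_multRep c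
  refine ⟨hmem, IsSlice.slice_eq fun x y => ?_⟩
  obtain ⟨c, hc, hc'⟩ := key x y
  rw [isSlice_slice hρ φ hmem, hc', strictEval_map hρ, strictEval_leftMulDual hρ φ (hT x y) hc]

include hρ in
theorem slice_opTensor_mul (φ : B →L[ℂ] ℂ) (S : Op H) (f : B) {T : Op (HTensor H K)}
    (hT : T ∈ sliceMult H ρ) :
    opTensor S (ρ f) * T ∈ sliceMult H ρ ∧
      slice ρ φ (opTensor S (ρ f) * T) = S * slice ρ (leftMulDual f φ) T := by
  obtain ⟨h1, h2⟩ := slice_leftMulDual hρ φ f hT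
  have hv : ∀ x y : H, vecSlice x y (opTensor S (ρ f) * T) =
      vecSlice (star S x) y (opTensor 1 (ρ f) * T) := fun x y => by
    rw [vecSlice_opTensor_mul, vecSlice_opTensor_mul, star_one, one_apply_eq_self]
  refine ⟨fun x y => ?_, IsSlice.slice_eq fun x y => ?_⟩
  · rw [hv]; exact h1 _ _
  · rw [hv, ← isSlice_slice hρ φ h1, ← h2, ContinuousLinearMap.star_eq_adjoint,
      ContinuousLinearMap.adjoint_inner_left, mul_apply_eq_comp]

/-- `(1 ⊗ e)T → T` along the approximate unit, for `T` in a spatial tensor product. -/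
theorem tendsto_opTensor_one_mul {X : Set (Op H)} {T : Op (HTensor H K)}
    (hT : T ∈ spatialTensor X (Set.range ρ)) :
    Tendsto (fun e => opTensor 1 (ρ e) * T) (CStarAlgebra.approximateUnit B) (𝓝 T) := by
  refine tendsto_of_mem_topologicalClosure_span (C := 1)
    (F := fun e => ContinuousLinearMap.mul ℂ (Op (HTensor H K)) (opTensor 1 (ρ e)))
    (G := ContinuousLinearMap.id ℂ _) ?_ ?_ hT
  · filter_upwards [(CStarAlgebra.increasingApproximateUnit B).eventually_norm] with e he
    refine (ContinuousLinearMap.opNorm_mul_apply_le ℂ (Op (HTensor H K)) _).trans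
      ((norm_opTensor_le _ _).trans ?_)
    refine mul_le_one₀ (ContinuousLinearMap.norm_id_le (𝕜 := ℂ) (E := H)) (norm_nonneg _) ?_
    exact (NonUnitalStarAlgHom.norm_apply_le ρ e).trans he
  · rintro _ ⟨S, -, _, ⟨b, rfl⟩, rfl⟩
    have hb : Tendsto (fun e => ρ (e * b)) (CStarAlgebra.approximateUnit B) (𝓝 (ρ b)) :=
      ((AddMonoidHomClass.continuous_of_bound ρ 1
        fun a => by simpa using NonUnitalStarAlgHom.norm_apply_le ρ a).tendsto b).comp
        ((CStarAlgebra.increasingApproximateUnit B).tendsto_mul_right b)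
    rw [tendsto_iff_norm_sub_tendsto_zero] at hb ⊢
    refine squeeze_zero (fun _ => norm_nonneg _) (fun e => ?_)
      (by simpa using hb.const_mul ‖S‖)
    have : opTensor (1 : Op H) (ρ e) * opTensor S (ρ b) - opTensor S (ρ b) =
        opTensor S (ρ (e * b) - ρ b) := by
      rw [opTensor_mul, one_mul, map_mul, sub_eq_add_neg, sub_eq_add_neg, opTensor_add_right,
        ← neg_one_smul ℂ (ρ b), opTensor_smul_right, neg_one_smul]
    change ‖opTensor (1 : Op H) (ρ e) * opTensor S (ρ b) - opTensor S (ρ b)‖ ≤ _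
    rw [this]
    simpa using norm_opTensor_le S (ρ (e * b) - ρ b)

end Slices

/-! ### The GNS triple of a weight -/

section GNS

variable {A : Type*} [NonUnitalCStarAlgebra A] [PartialOrder A] [StarOrderedRing A]
variable {h : Weight A}
variable {H : Type*} [NormedAddCommGroup H] [InnerProductSpace ℂ H] [CompleteSpace H]
variable {π : A →⋆ₙₐ[ℂ] Op H} {η : h.leftIdeal →ₗ[ℂ] H} (hgns : h.IsGNSTriple π η)

theorem Weight.mul_mem_leftIdeal (h : Weight A) (a : A) {b : A} (hb : b ∈ h.leftIdeal) :
    a * b ∈ h.leftIdeal := by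
  change h (star (a * b) * (a * b)) < ∞
  have h1 : star (a * b) * (a * b) ≤ ((‖a‖ ^ 2 : ℝ) : ℂ) • (star b * b) := by
    have := CStarAlgebra.star_left_conjugate_le_norm_smul (a := b) (b := star a * a)
      (IsSelfAdjoint.star_mul_self a)
    rw [CStarRing.norm_star_mul_self, ← sq] at this
    rw [star_mul, mul_assoc, ← mul_assoc (star a), ← mul_assoc]
    exact this
  refine (h.mono (star_mul_self_nonneg _) h1).trans_lt ?_
  rw [h.map_smul _ _ (by positivity) (star_mul_self_nonneg b)]
  exact ENNReal.mul_lt_top ENNReal.ofReal_lt_top hb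

include hgns in
theorem Weight.IsGNSTriple.ofReal_norm_sq (a : h.leftIdeal) :
    ENNReal.ofReal (‖η a‖ ^ 2) = h (star (a : A) * a) := by
  rw [hgns.norm_sq, ENNReal.ofReal_toReal a.2.ne]

include hgns in
theorem Weight.IsGNSTriple.apply_mul (a : A) (b : h.leftIdeal) :
    η ⟨a * b, h.mul_mem_leftIdeal a b.2⟩ = π a (η b) :=
  hgns.map_mul a b _ rfl

include hgns in
-- Polarisation: `a⋆b` is a combination of four elements `c⋆c` with `c` in the left ideal, and on
-- those both sides are `‖η(c)‖²`.
theorem Weight.IsGNSTriple.linearExt_star_mul (a b : h.leftIdeal) :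
    ∃ hm : star (a : A) * b ∈ h.finitePart, h.linearExt ⟨_, hm⟩ = ⟪η a, η b⟫_ℂ := by
  have hself : ∀ c : h.leftIdeal, ∃ hm : star (c : A) * c ∈ h.finitePart,
      h.linearExt ⟨_, hm⟩ = ⟪η c, η c⟫_ℂ := fun c => by
    refine ⟨Submodule.subset_span ⟨star_mul_self_nonneg _, c.2⟩, ?_⟩
    rw [h.linearExt_apply (star_mul_self_nonneg _) c.2, ← hgns.norm_sq,
      inner_self_eq_norm_sq_to_K]
    norm_cast
  obtain ⟨m1, e1⟩ := hself (b + a)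
  obtain ⟨m2, e2⟩ := hself (b - a)
  obtain ⟨m3, e3⟩ := hself (b + Complex.I • a)
  obtain ⟨m4, e4⟩ := hself (b - Complex.I • a)
  have hsum : star (a : A) * b = (1 / 4 : ℂ) • (star ((b + a : h.leftIdeal) : A) * (b + a : h.leftIdeal)
      - star ((b - a : h.leftIdeal) : A) * (b - a : h.leftIdeal)
      + Complex.I • (star ((b + Complex.I • a : h.leftIdeal) : A) * (b + Complex.I • a : h.leftIdeal)
      - star ((b - Complex.I • a : h.leftIdeal) : A) * (b - Complex.I • a : h.leftIdeal))) := by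
    simp only [Submodule.coe_add, Submodule.coe_sub, Submodule.coe_smul, star_add, star_sub,
      star_smul, add_mul, mul_add, sub_mul, mul_sub, smul_mul_assoc, mul_smul_comm,
      Complex.star_def, Complex.conj_I, smul_add, smul_sub, smul_smul, neg_smul, neg_mul,
      smul_neg, Complex.I_mul_I]
    module
  have hm : star (a : A) * b ∈ h.finitePart := by
    rw [hsum]
    exact Submodule.smul_mem _ _ (add_mem (sub_mem m1 m2) (Submodule.smul_mem _ _ (sub_mem m3 m4)))
  refine ⟨hm, ?_⟩
  have hsub : (⟨_, hm⟩ : h.finitePart) = (1 / 4 : ℂ) • ((⟨_, m1⟩ : h.finitePart) - ⟨_, m2⟩ +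
      Complex.I • ((⟨_, m3⟩ : h.finitePart) - ⟨_, m4⟩)) := Subtype.ext hsum
  rw [hsub, _root_.map_smul, _root_.map_add, map_sub, _root_.map_smul, map_sub, e1, e2, e3, e4]
  simp only [_root_.map_add, map_sub, _root_.map_smul, inner_add_left, inner_add_right, inner_sub_left,
    inner_sub_right, inner_smul_left, inner_smul_right, Complex.conj_I, smul_eq_mul]
  linear_combination ((1 / 2 : ℂ) * ⟪η b, η a⟫_ℂ - (1 / 2) * ⟪η a, η b⟫_ℂ) * Complex.I_mul_I

include hgns in
/-- The GNS map of a lower semicontinuous weight is closed. -/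
theorem Weight.IsGNSTriple.closed (hlsc : h.IsLowerSemicontinuous) {a : ℕ → h.leftIdeal} {b : A}
    {ξ : H} (ha : Tendsto (fun n => (a n : A)) atTop (𝓝 b))
    (hξ : Tendsto (fun n => η (a n)) atTop (𝓝 ξ)) :
    ∃ hb : b ∈ h.leftIdeal, η ⟨b, hb⟩ = ξ := by
  -- The Cauchy estimate bounds `h` on `(aₘ - aₙ)⋆(aₘ - aₙ)`. Lower semicontinuity carries the bound
  -- to the limit in `m`.
  have hbound : ∀ ε : ℝ, 0 < ε → ∃ N, ∀ n, N ≤ n →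
      h (star (b - a n) * (b - a n)) ≤ ENNReal.ofReal (ε ^ 2) := by
    intro ε hε
    obtain ⟨N, hN⟩ := Metric.cauchySeq_iff.1 hξ.cauchySeq ε hε
    refine ⟨N, fun n hn => ?_⟩
    have hcl := hlsc (Real.toNNReal (ε ^ 2))
    have hlim : Tendsto (fun m => star ((a m : A) - a n) * ((a m : A) - a n)) atTop
        (𝓝 (star (b - a n) * (b - a n))) :=
      (ha.sub tendsto_const_nhds).star.mul (ha.sub tendsto_const_nhds)
    refine (hcl.mem_of_tendsto hlim ?_).2
    filter_upwards [eventually_ge_atTop N] with m hm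
    refine ⟨star_mul_self_nonneg _, ?_⟩
    have h1 := hgns.ofReal_norm_sq (a m - a n)
    rw [Submodule.coe_sub] at h1
    rw [← h1, map_sub]
    refine ENNReal.ofReal_le_ofReal ?_
    have := (hN m hm n hn).le
    rw [dist_eq_norm] at this
    gcongr
  obtain ⟨N, hN⟩ := hbound 1 one_pos
  have hb : b ∈ h.leftIdeal := by
    have : b - a N ∈ h.leftIdeal := (hN N le_rfl).trans_lt ENNReal.ofReal_lt_top
    simpa using add_mem this (a N).2
  refine ⟨hb, tendsto_nhds_unique ?_ hξ⟩
  rw [Metric.tendsto_atTop]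
  intro ε hε
  obtain ⟨N, hN⟩ := hbound (ε / 2) (by positivity)
  refine ⟨N, fun n hn => ?_⟩
  have h1 := hN n hn
  have h2 := hgns.ofReal_norm_sq (⟨b, hb⟩ - a n)
  rw [Submodule.coe_sub] at h2
  rw [← h2, ENNReal.ofReal_le_ofReal_iff (by positivity), map_sub,
    sq_le_sq₀ (norm_nonneg _) (by positivity)] at h1
  rw [dist_eq_norm, norm_sub_rev]
  linarith

include hgns in
/-- The GNS representation of a lower semicontinuous weight is non-degenerate. -/
theorem Weight.IsGNSTriple.tendsto_apply (hlsc : h.IsLowerSemicontinuous) (v : H) :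
    Tendsto (fun e => π e v) (CStarAlgebra.approximateUnit A) (𝓝 v) := by
  have hau := CStarAlgebra.increasingApproximateUnit A
  have hcontr : ∀ᶠ e in CStarAlgebra.approximateUnit A, ‖π e‖ ≤ 1 := by
    filter_upwards [hau.eventually_norm] with e he
    exact (NonUnitalStarAlgHom.norm_apply_le π e).trans he
  refine tendsto_of_mem_topologicalClosure_span (G := ContinuousLinearMap.id ℂ H)
    (S := Set.range η) hcontr ?_ (closure_mono Submodule.subset_span (hgns.denseRange v))
  rintro _ ⟨b, rfl⟩
  change Tendsto (fun e => π e (η b)) _ (𝓝 (η b))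
  rw [Metric.tendsto_nhds]
  intro ε hε
  -- The vector `η(b) + π(e)η(b)` is the image of `b + eb`, which tends to `2b`, so lower
  -- semicontinuity keeps its norm square from dropping much below `4‖η(b)‖²`. As `π(e)` is a
  -- contraction, the parallelogram law then makes `η(b) - π(e)η(b)` small.
  have hev : ∀ᶠ e in CStarAlgebra.approximateUnit A,
      4 * ‖η b‖ ^ 2 - ε ^ 2 < ‖η b + π e (η b)‖ ^ 2 := by
    by_contra hcon
    rw [not_eventually] at hcon
    have hcl := hlsc (Real.toNNReal (4 * ‖η b‖ ^ 2 - ε ^ 2))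
    have hlim : Tendsto (fun e : A => star ((b : A) + e * b) * ((b : A) + e * b))
        (CStarAlgebra.approximateUnit A) (𝓝 (star ((b : A) + b) * ((b : A) + b))) :=
      (tendsto_const_nhds.add (hau.tendsto_mul_right _)).star.mul
        (tendsto_const_nhds.add (hau.tendsto_mul_right _))
    have hfreq : ∃ᶠ e in CStarAlgebra.approximateUnit A,
        star ((b : A) + e * b) * ((b : A) + e * b) ∈
          {a : A | 0 ≤ a ∧ h a ≤ Real.toNNReal (4 * ‖η b‖ ^ 2 - ε ^ 2)} := by
      refine hcon.mono fun e he => ⟨star_mul_self_nonneg _, ?_⟩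
      have h1 := hgns.ofReal_norm_sq (b + ⟨e * b, h.mul_mem_leftIdeal e b.2⟩)
      rw [Submodule.coe_add, _root_.map_add, hgns.apply_mul] at h1
      rw [← h1]
      exact ENNReal.ofReal_le_ofReal (not_lt.1 he)
    have h2 := (hcl.mem_of_frequently_of_tendsto hfreq hlim).2
    have h3 := hgns.ofReal_norm_sq (b + b)
    rw [Submodule.coe_add, _root_.map_add, ← two_smul ℝ, norm_smul, mul_pow] at h3
    rw [← h3] at h2
    change ENNReal.ofReal _ ≤ ENNReal.ofReal _ at h2
    obtain ⟨e, he⟩ := hcon.exists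
    rw [ENNReal.ofReal_le_ofReal_iff ((sq_nonneg _).trans (not_lt.1 he))] at h2
    norm_num at h2
    nlinarith
  filter_upwards [hev, hcontr] with e he1 he2
  have h1 := parallelogram_law_with_norm ℂ (η b) (π e (η b))
  have h2 : ‖π e (η b)‖ ≤ ‖η b‖ := by
    simpa using ContinuousLinearMap.le_of_opNorm_le _ he2 (η b)
  rw [dist_eq_norm, norm_sub_rev]
  refine lt_of_pow_lt_pow_left₀ 2 hε.le ?_
  nlinarith [norm_nonneg (π e (η b)), norm_nonneg (η b)]

/-- A strictly faithful weight is faithful. -/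
theorem Weight.IsStrictlyFaithful.eq_zero (hsf : h.IsStrictlyFaithful) {a : A} (ha : 0 ≤ a)
    (h0 : h a = 0) : a = 0 := by
  set b := CFC.sqrt a with hb
  have hbs : star b = b := (IsSelfAdjoint.of_nonneg (CFC.sqrt_nonneg a)).star_eq
  have hbb : b * b = a := CFC.sqrt_mul_sqrt_self a ha
  have : b = 0 := by
    -- Test strict faithfulness on the constant sequence at the square root.
    refine hsf (fun _ => b) ⟨0, fun _ => ?_⟩ ?_ b fun _ => ?_
    · rw [hbs, hbb, h0]; simp
    · simp [hbs, hbb, h0]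
    · simp [h.map_zero]
  rw [← hbb, this, zero_mul]

include hgns in
-- If `π(a) = 0`, then `h((ab)⋆(ab)) = 0` and hence `ab = 0` for every `b` in the dense left ideal,
-- so `aa⋆ = 0`.
theorem Weight.IsGNSTriple.injective (hsf : h.IsStrictlyFaithful) (hlf : h.IsLocallyFinite) :
    Function.Injective π := by
  rw [injective_iff_map_eq_zero]
  intro a ha
  have hzero : ∀ b ∈ h.leftIdeal, a * b = 0 := fun b hb => by
    have h1 := hgns.ofReal_norm_sq ⟨a * b, h.mul_mem_leftIdeal a hb⟩
    rw [hgns.apply_mul a ⟨b, hb⟩, ha] at h1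
    simp only [zero_apply, norm_zero] at h1
    have h2 := hsf.eq_zero (star_mul_self_nonneg (a * b)) (by rw [← h1]; simp)
    exact CStarRing.star_mul_self_eq_zero_iff _ |>.1 h2
  have hall : ∀ b : A, a * b = 0 := fun b =>
    (isClosed_eq (continuous_const.mul continuous_id) continuous_const).closure_subset_iff.2
      (fun b hb => hzero b hb) (hlf b)
  simpa using hall (star a)

end GNS

/-! ### Vector functionals of the universal representation -/

section UniversalVector

/-- The inclusion of a summand into a Hilbert direct sum. -/
noncomputable def lpSingleIsometry {ι : Type*} [DecidableEq ι] (E : ι → Type*)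
    [∀ i, NormedAddCommGroup (E i)] [∀ i, InnerProductSpace ℂ (E i)] (i : ι) :
    E i →ₗᵢ[ℂ] lp E 2 where
  toLinearMap := lp.lsingle 2 i
  norm_map' v := lp.norm_single (by norm_num) i v

@[simp] theorem lpSingleIsometry_apply {ι : Type*} [DecidableEq ι] (E : ι → Type*)
    [∀ i, NormedAddCommGroup (E i)] [∀ i, InnerProductSpace ℂ (E i)] (i : ι) (v : E i) :
    lpSingleIsometry E i v = lp.single 2 i v := rfl

variable {A : Type*} [NonUnitalCStarAlgebra A] [PartialOrder A] [StarOrderedRing A]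

open Classical in
/-- The inclusion of the GNS space of a positive functional into the direct sum of all of them. -/
noncomputable def univInclAux (f : A →ₚ[ℂ] ℂ) :
    f.GNS →ₗᵢ[ℂ] lp (fun f : A →ₚ[ℂ] ℂ => f.GNS) 2 :=
  lpSingleIsometry (fun f : A →ₚ[ℂ] ℂ => f.GNS) f

theorem univRepAux_univInclAux (f : A →ₚ[ℂ] ℂ) (a : A) (v : f.GNS) :
    univRepAux A a (univInclAux f v) = univInclAux f (f.gnsNonUnitalStarAlgHom a v) := by
  classical
  ext g
  by_cases hg : g = f
  · subst hg; simp [univRepAux, univInclAux]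
  · simp [univRepAux, univInclAux, hg]

/-- The inclusion of the GNS space of a positive functional into the universal representation. -/
noncomputable def univIncl (f : A →ₚ[ℂ] ℂ) : f.GNS →ₗᵢ[ℂ] UnivSpace A := univInclAux f

theorem univRep_univIncl (f : A →ₚ[ℂ] ℂ) (a : A) (v : f.GNS) :
    univRep A a (univIncl f v) = univIncl f (f.gnsNonUnitalStarAlgHom a v) :=
  univRepAux_univInclAux f a v

theorem tendsto_gns_apply (f : A →ₚ[ℂ] ℂ) (v : f.GNS) :
    Tendsto (fun e => f.gnsNonUnitalStarAlgHom e v) (CStarAlgebra.approximateUnit A) (𝓝 v) := by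
  have hau := CStarAlgebra.increasingApproximateUnit A
  refine tendsto_of_mem_topologicalClosure_span (G := ContinuousLinearMap.id ℂ _)
    (F := fun e => f.gnsNonUnitalStarAlgHom e) (C := 1)
    (S := Set.range ((↑) : f.PreGNS → f.GNS)) ?_ ?_
    (closure_mono Submodule.subset_span (UniformSpace.Completion.denseRange_coe v))
  · filter_upwards [hau.eventually_norm] with e he
    exact (NonUnitalStarAlgHom.norm_apply_le _ e).trans he
  · rintro _ ⟨b, rfl⟩
    have hcont : Continuous f.toPreGNS := by
      obtain ⟨C, hC⟩ := f.exists_norm_apply_le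
      refine AddMonoidHomClass.continuous_of_bound f.toPreGNS √(C : ℝ) fun a => ?_
      rw [PositiveLinearMap.preGNS_norm_def, PositiveLinearMap.ofPreGNS_toPreGNS,
        ← Real.sqrt_sq (norm_nonneg a), ← Real.sqrt_mul C.coe_nonneg]
      refine Real.sqrt_le_sqrt ?_
      rw [sq, ← CStarRing.norm_star_mul_self]
      exact (Complex.re_le_norm _).trans (hC _)
    have h1 : Tendsto (fun e : A => f.toPreGNS (e * f.ofPreGNS b))
        (CStarAlgebra.approximateUnit A) (𝓝 b) :=
      (hcont.tendsto _).comp (hau.tendsto_mul_right (f.ofPreGNS b))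
    have h2 := ((UniformSpace.Completion.continuous_coe f.PreGNS).tendsto _).comp h1
    refine h2.congr fun e => ?_
    rw [PositiveLinearMap.gnsNonUnitalStarAlgHom_apply_coe]
    rfl

/-- A positive functional satisfying a Cauchy–Schwarz inequality is a vector functional of the
universal representation. -/
theorem exists_univRep_vector (f : A →ₚ[ℂ] ℂ) {C : ℝ} (hC0 : 0 ≤ C)
    (hC : ∀ a, ‖f a‖ ≤ C * √(f (star a * a)).re) :
    ∃ ξ : UnivSpace A, ‖ξ‖ ≤ C ∧ (∀ a, ⟪ξ, univRep A a ξ⟫_ℂ = f a) ∧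
      Tendsto (fun e => univRep A e ξ) (CStarAlgebra.approximateUnit A) (𝓝 ξ) := by
  let e : A →ₗ[ℂ] f.GNS :=
    (UniformSpace.Completion.toComplL : f.PreGNS →L[ℂ] f.GNS).toLinearMap ∘ₗ
      f.toPreGNS.toLinearMap
  have he : ∀ a, e a = ((f.toPreGNS a : f.PreGNS) : f.GNS) := fun a => rfl
  have hdense : DenseRange e :=
    UniformSpace.Completion.denseRange_coe.comp f.toPreGNS.surjective.denseRange
      (UniformSpace.Completion.continuous_coe _)
  have hbound : ∀ a, ‖f.toLinearMap a‖ ≤ C * ‖e a‖ := fun a => by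
    rw [he, UniformSpace.Completion.norm_coe, PositiveLinearMap.preGNS_norm_def]
    exact hC a
  let L : f.GNS →L[ℂ] ℂ := f.toLinearMap.extendOfNorm e
  have hL : ∀ a, L (e a) = f a := LinearMap.extendOfNorm_eq hdense ⟨C, hbound⟩
  have hLn : ‖L‖ ≤ C := LinearMap.opNorm_extendOfNorm_le hdense hC0 hbound
  -- The assumed inequality makes `[a] ↦ f(a)` bounded on the GNS space. Its Riesz vector plays the
  -- role of the class of the missing unit: the representation sends it to `[a]`.
  set v : f.GNS := (InnerProductSpace.toDual ℂ f.GNS).symm L with hv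
  have hvL : ∀ x, ⟪v, x⟫_ℂ = L x := fun x => InnerProductSpace.toDual_symm_apply
  have hvn : ‖v‖ ≤ C := by rwa [hv, LinearIsometryEquiv.norm_map]
  have hact : ∀ a b, f.gnsNonUnitalStarAlgHom a (e b) = e (a * b) := fun a b => by
    rw [he, PositiveLinearMap.gnsNonUnitalStarAlgHom_apply_coe]; rfl
  have hav : ∀ a, f.gnsNonUnitalStarAlgHom a v = e a := by
    intro a
    have hclm : innerSL ℂ (f.gnsNonUnitalStarAlgHom a v) = innerSL ℂ (e a) := by
      refine ContinuousLinearMap.ext fun x => hdense.induction ?_ (isClosed_eq ?_ ?_) x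
      · rintro _ ⟨b, rfl⟩
        rw [innerSL_apply_apply, innerSL_apply_apply, ← ContinuousLinearMap.adjoint_inner_right,
          ← ContinuousLinearMap.star_eq_adjoint, ← map_star, hact, hvL, hL, he, he,
          UniformSpace.Completion.inner_coe, PositiveLinearMap.preGNS_inner_def]
        rfl
      · fun_prop
      · fun_prop
    refine ext_inner_right ℂ fun u => ?_
    simpa using congrArg (fun k : f.GNS →L[ℂ] ℂ => k u) hclm
  refine ⟨univIncl f v, by rwa [LinearIsometry.norm_map], fun a => ?_, ?_⟩
  · rw [univRep_univIncl, LinearIsometry.inner_map_map, hav, hvL, hL]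
  · simp only [univRep_univIncl]
    exact ((univIncl f).continuous.tendsto v).comp (tendsto_gns_apply f v)

end UniversalVector

/-! ### Vector functionals and multipliers of spatial tensor products -/

section VecFunctional

variable {B : Type*} [NonUnitalCStarAlgebra B]
variable {K : Type*} [NormedAddCommGroup K] [InnerProductSpace ℂ K] [CompleteSpace K]

/-- The vector functional `a ↦ ⟪ζ, ρ(a)ξ⟫`. -/
noncomputable def vecFunctional (ρ : B →⋆ₙₐ[ℂ] Op K) (ζ ξ : K) : B →L[ℂ] ℂ :=
  LinearMap.mkContinuous
    { toFun := fun a => ⟪ζ, ρ a ξ⟫_ℂ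
      map_add' := fun a b => by simp
      map_smul' := fun c a => by simp } (‖ζ‖ * ‖ξ‖) fun a => by
    calc ‖⟪ζ, ρ a ξ⟫_ℂ‖ ≤ ‖ζ‖ * ‖ρ a ξ‖ := norm_inner_le_norm _ _
      _ ≤ ‖ζ‖ * (‖a‖ * ‖ξ‖) := by
          gcongr
          exact ContinuousLinearMap.le_of_opNorm_le _ (NonUnitalStarAlgHom.norm_apply_le ρ a) _
      _ = _ := by ring

@[simp] theorem vecFunctional_apply (ρ : B →⋆ₙₐ[ℂ] Op K) (ζ ξ : K) (a : B) :
    vecFunctional ρ ζ ξ a = ⟪ζ, ρ a ξ⟫_ℂ := rfl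

variable [PartialOrder B] [StarOrderedRing B]

/-- The condition on `ξ` says that it lies in the essential subspace of `ρ`. It replaces
non-degeneracy of `ρ` and is checked for the particular vectors in use. -/
theorem strictEval_vecFunctional {ρ : B →⋆ₙₐ[ℂ] Op K} (hρ : Function.Injective ρ) (ζ : K) {ξ : K}
    (hξ : Tendsto (fun e => ρ e ξ) (CStarAlgebra.approximateUnit B) (𝓝 ξ)) {m : Op K}
    (hm : m ∈ multRep ρ) : strictEval ρ (vecFunctional ρ ζ ξ) m = ⟪ζ, m ξ⟫_ℂ := by
  refine tendsto_nhds_unique (tendsto_strictEval hρ _ hm) ?_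
  have h1 : Tendsto (fun e => ⟪ζ, m (ρ e ξ)⟫_ℂ) (CStarAlgebra.approximateUnit B)
      (𝓝 ⟪ζ, m ξ⟫_ℂ) := tendsto_const_nhds.inner ((m.continuous.tendsto _).comp hξ)
  refine h1.congr fun e => ?_
  obtain ⟨⟨c, hc⟩, -⟩ := hm e
  rw [← hc, Function.leftInverse_invFun hρ, vecFunctional_apply, hc, mul_apply_eq_comp]

end VecFunctional

section Multipliers

variable {B : Type*} [NonUnitalCStarAlgebra B]
variable {K : Type*} [NormedAddCommGroup K] [InnerProductSpace ℂ K] [CompleteSpace K]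
variable {H : Type*} [NormedAddCommGroup H] [InnerProductSpace ℂ H] [CompleteSpace H]
variable {ρ : B →⋆ₙₐ[ℂ] Op K}

theorem opTensor_mem_spatialTensor {X : Set (Op H)} {S : Op H} (hS : S ∈ X) (b : B) :
    opTensor S (ρ b) ∈ spatialTensor X (Set.range ρ) :=
  subset_closure (Submodule.subset_span ⟨S, hS, _, ⟨b, rfl⟩, rfl⟩)

theorem star_mem_spatialTensor {X : Set (Op H)} (hX : ∀ S ∈ X, star S ∈ X)
    {T : Op (HTensor H K)} (hT : T ∈ spatialTensor X (Set.range ρ)) :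
    star T ∈ spatialTensor X (Set.range ρ) := by
  let N : Submodule ℂ (Op (HTensor H K)) :=
    { carrier := {T | star T ∈ spatialTensor X (Set.range ρ)}
      zero_mem' := by simp
      add_mem' := fun {a b} ha hb => by
        rw [Set.mem_ofPred_eq, star_add]; exact add_mem ha hb
      smul_mem' := fun c a ha => by
        rw [Set.mem_ofPred_eq, star_smul]; exact Submodule.smul_mem _ _ ha }
  have hN : IsClosed (N : Set (Op (HTensor H K))) :=
    (Submodule.isClosed_topologicalClosure _).preimage continuous_star
  have : spatialTensor X (Set.range ρ) ≤ N := by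
    refine Submodule.topologicalClosure_minimal _ (Submodule.span_le.2 ?_) hN
    rintro _ ⟨S, hS, _, ⟨b, rfl⟩, rfl⟩
    change star (opTensor S (ρ b)) ∈ spatialTensor X (Set.range ρ)
    rw [star_opTensor, ← map_star]
    exact opTensor_mem_spatialTensor (hX S hS) _
  exact this hT

theorem exists_compact_selfAdjoint_fixing (y : H) :
    ∃ θ : Op H, IsCompactOperator θ ∧ star θ = θ ∧ θ y = y := by
  -- The projection onto the line of `y`. For `y = 0` the inverse is `0` by convention, and the zero
  -- operator still fixes `y`.
  refine ⟨(((‖y‖ ^ 2 : ℝ) : ℂ)⁻¹) • InnerProductSpace.rankOne ℂ y y, ?_, ?_, ?_⟩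
  · refine IsCompactOperator.smul (f := InnerProductSpace.rankOne ℂ y y) ?_ _
    rw [InnerProductSpace.rankOne_def']
    exact (isCompactOperator_of_locallyCompactSpace_rng
      (ContinuousLinearMap.toSpanSingleton ℂ y)).comp_clm _
  · rw [star_smul, ContinuousLinearMap.star_eq_adjoint, InnerProductSpace.adjoint_rankOne]
    congr 1
    simp
  · rw [smul_apply, InnerProductSpace.rankOne_apply, inner_self_eq_norm_sq_to_K, smul_smul]
    rcases eq_or_ne y 0 with rfl | hy
    · simp
    · have : ((‖y‖ : ℝ) : ℂ) ≠ 0 := by simpa using hy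
      convert one_smul ℂ y using 2
      rw [RCLike.ofReal_eq_complex_ofReal]
      push_cast
      field_simp

/-- A compact `θ` fixing `y` can be inserted for free: the slice of `W` times `ρ(b)` is the slice of
`W(θ ⊗ ρ(b))`, which lies in the spatial tensor product. The other side uses a self-adjoint `θ`
fixing `x`. -/
theorem mem_sliceMult_of_mem_multipliers (hρ : Function.Injective ρ) {W : Op (HTensor H K)}
    (hW : W ∈ multipliers (spatialTensor {S : Op H | IsCompactOperator S} (Set.range ρ))) :
    W ∈ sliceMult H ρ := by
  intro x y b
  constructor
  · obtain ⟨θ, hθ, -, hy⟩ := exists_compact_selfAdjoint_fixing y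
    obtain ⟨c, hc⟩ := vecSlice_mem_range_of_mem_spatialTensor hρ
      (hW _ (opTensor_mem_spatialTensor (ρ := ρ) hθ b)).1 x y
    exact ⟨c, by rw [hc, vecSlice_mul_opTensor, hy]⟩
  · obtain ⟨θ, hθ, hs, hx⟩ := exists_compact_selfAdjoint_fixing x
    obtain ⟨c, hc⟩ := vecSlice_mem_range_of_mem_spatialTensor hρ
      (hW _ (opTensor_mem_spatialTensor (ρ := ρ) hθ b)).2 x y
    exact ⟨c, by rw [hc, vecSlice_opTensor_mul, hs, hx]⟩

end Multipliers

/-! ### Convolution products -/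

section Convolution

variable {A : Type*} [NonUnitalCStarAlgebra A] [PartialOrder A] [StarOrderedRing A]

theorem star_mem_minTensor {T : Op (UnivSpace₂ A)} (hT : T ∈ minTensor A) :
    star T ∈ minTensor A :=
  star_mem_spatialTensor (by rintro _ ⟨a, rfl⟩; exact ⟨star a, map_star _ _⟩) hT

theorem opTensor_mem_minTensor (a b : A) :
    opTensor (univRep A a) (univRep A b) ∈ minTensor A :=
  opTensor_mem_spatialTensor (X := Set.range (univRep A)) ⟨a, rfl⟩ b

theorem minTensor_le_sliceMult : minTensor A ≤ sliceMult (UnivSpace A) (univRep A) :=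
  spatialTensor_le_sliceMult (univRep_injective A) _

/-- On elementary tensors the slice is a scalar multiple of the first leg. Norm continuity of
slicing and closedness of the range do the rest. -/
theorem exists_map_eq_slice_of_mem_minTensor (φ : A →L[ℂ] ℂ) {T : Op (UnivSpace₂ A)}
    (hT : T ∈ minTensor A) : ∃ c, univRep A c = slice (univRep A) φ T := by
  have hinj := univRep_injective A
  have hspan : ∀ S ∈ Submodule.span ℂ {T | ∃ S ∈ Set.range (univRep A),
      ∃ S' ∈ Set.range (univRep A), T = opTensor S S'},
      S ∈ minTensor A ∧ ∃ c, univRep A c = slice (univRep A) φ S := by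
    intro S hS
    induction hS using Submodule.span_induction with
    | mem S h =>
      obtain ⟨_, ⟨a, rfl⟩, _, ⟨b, rfl⟩, rfl⟩ := h
      exact ⟨opTensor_mem_minTensor a b, φ b • a, by rw [slice_opTensor hinj, map_smul]⟩
    | zero =>
      refine ⟨zero_mem _, 0, ?_⟩
      have := slice_smul hinj φ 0 (zero_mem (sliceMult (UnivSpace A) (univRep A)))
      rw [zero_smul, zero_smul] at this
      rw [this, map_zero]
    | add S T _ _ hS hT =>
      obtain ⟨hS, c, hc⟩ := hS
      obtain ⟨hT, d, hd⟩ := hT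
      exact ⟨add_mem hS hT, c + d, by
        rw [map_add, hc, hd,
          slice_add hinj φ (minTensor_le_sliceMult hS) (minTensor_le_sliceMult hT)]⟩
    | smul k S _ hS =>
      obtain ⟨hS, c, hc⟩ := hS
      exact ⟨Submodule.smul_mem _ k hS, k • c, by
        rw [map_smul, hc, slice_smul hinj φ k (minTensor_le_sliceMult hS)]⟩
  have hcl : slice (univRep A) φ T ∈ closure (Set.range (univRep A)) := by
    rw [Metric.mem_closure_iff]
    intro ε hε
    obtain ⟨S, hS, hTS⟩ := Metric.mem_closure_iff.1 hT (ε / (‖φ‖ + 1)) (by positivity)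
    obtain ⟨hSm, c, hc⟩ := hspan S hS
    refine ⟨_, ⟨c, rfl⟩, ?_⟩
    rw [hc, dist_eq_norm, ← slice_sub hinj φ (minTensor_le_sliceMult hT)
      (minTensor_le_sliceMult hSm)]
    refine (norm_slice_le hinj φ (minTensor_le_sliceMult (sub_mem hT hSm))).trans_lt ?_
    rw [dist_eq_norm, lt_div_iff₀ (by positivity)] at hTS
    nlinarith [norm_nonneg (T - S)]
  rw [(isClosed_range_rep hinj).closure_eq] at hcl
  exact hcl

variable {δ : Comultiplication A} (hδ : δ.IsProper)

include hδ in
-- This is the adjoint of the first half of properness at `star a` and `star f`.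
theorem Comultiplication.IsProper.one_opTensor_mul_mem (f a : A) :
    opTensor 1 (univRep A f) * δ.toHom a ∈ minTensor A := by
  have := star_mem_minTensor (hδ (star a) (star f)).1
  rwa [star_mul, star_opTensor, star_one, ← map_star, ← map_star, star_star, star_star] at this

include hδ in
theorem Comultiplication.IsProper.mem_sliceMult (a : A) :
    δ.toHom a ∈ sliceMult (UnivSpace A) (univRep A) := by
  intro x y b
  constructor
  · obtain ⟨c, hc⟩ := vecSlice_mem_range_of_mem_spatialTensor (univRep_injective A)
      (hδ a b).1 x y
    exact ⟨c, by rw [hc, vecSlice_mul_opTensor, one_apply_eq_self]⟩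
  · obtain ⟨c, hc⟩ := vecSlice_mem_range_of_mem_spatialTensor (univRep_injective A)
      (hδ.one_opTensor_mul_mem b a) x y
    exact ⟨c, by rw [hc, vecSlice_opTensor_mul, star_one, one_apply_eq_self]⟩

include hδ in
-- The content is that the slice lies in the range of the representation, so that the inverse
-- function in `conv` does not return a default value. Approximating `φ` by `φ(g ·)` turns the slice
-- of `δ(a)` into a slice of `(1 ⊗ g)δ(a)`, an element of `A ⊗ A`.
theorem Comultiplication.IsProper.map_conv (φ : A →L[ℂ] ℂ) (a : A) :
    univRep A (δ.conv φ a) = slice (univRep A) φ (δ.toHom a) := by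
  have hinj := univRep_injective A
  have hcl : slice (univRep A) φ (δ.toHom a) ∈ closure (Set.range (univRep A)) := by
    rw [Metric.mem_closure_iff]
    intro ε hε
    obtain ⟨g, hg⟩ := exists_norm_sub_mul_left_le φ
      (ε := ε / (‖δ.toHom a‖ + 1)) (by positivity)
    obtain ⟨c, hc⟩ := exists_map_eq_slice_of_mem_minTensor φ (hδ.one_opTensor_mul_mem g a)
    refine ⟨_, ⟨c, rfl⟩, ?_⟩
    rw [hc, ← (slice_leftMulDual hinj φ g (hδ.mem_sliceMult a)).2, dist_eq_norm,
      ← slice_sub_dual hinj _ _ (hδ.mem_sliceMult a)]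
    refine (norm_slice_le hinj _ (hδ.mem_sliceMult a)).trans_lt ?_
    have h1 : ‖φ - leftMulDual g φ‖ ≤ ε / (‖δ.toHom a‖ + 1) :=
      ContinuousLinearMap.opNorm_le_bound _ (by positivity) fun x => by simpa using hg x
    calc _ ≤ ε / (‖δ.toHom a‖ + 1) * ‖δ.toHom a‖ := by gcongr
      _ < ε / (‖δ.toHom a‖ + 1) * (‖δ.toHom a‖ + 1) := by gcongr; linarith
      _ = ε := by field_simp
  rw [(isClosed_range_rep hinj).closure_eq] at hcl
  obtain ⟨c, hc⟩ := hcl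
  rw [Comultiplication.conv, ← hc, Function.leftInverse_invFun hinj]

include hδ in
theorem Comultiplication.IsProper.conv_star (φ : A →L[ℂ] ℂ) (a : A) :
    δ.conv φ (star a) = star (δ.conv (dualStar φ) a) := by
  apply univRep_injective A
  rw [map_star, hδ.map_conv, hδ.map_conv, map_star,
    slice_star (univRep_injective A) φ (hδ.mem_sliceMult a)]

include hδ in
theorem Comultiplication.IsProper.inner_conv_vecFunctional (ζ : UnivSpace A) {ξ : UnivSpace A}
    (hξ : Tendsto (fun e => univRep A e ξ) (CStarAlgebra.approximateUnit A) (𝓝 ξ)) (a : A)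
    (x y : UnivSpace A) :
    ⟪x, univRep A (δ.conv (vecFunctional (univRep A) ζ ξ) a) y⟫_ℂ =
      ⟪tvec x ζ, δ.toHom a (tvec y ξ)⟫_ℂ := by
  have hinj := univRep_injective A
  rw [hδ.map_conv, isSlice_slice hinj _ (hδ.mem_sliceMult a),
    strictEval_vecFunctional hinj ζ hξ (hδ.mem_sliceMult a x y), inner_vecSlice]

end Convolution

/-! ### Comparison of spatial tensor products -/

section RepTensor

variable {A : Type*} [NonUnitalCStarAlgebra A] [PartialOrder A] [StarOrderedRing A]
variable {H : Type*} [NormedAddCommGroup H] [InnerProductSpace ℂ H] [CompleteSpace H]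

/-- The tensor product of a representation with itself on the algebraic tensor product. -/
noncomputable def repTensor (π : A →⋆ₙₐ[ℂ] Op H) : A ⊗[ℂ] A →ₗ[ℂ] Op (HTensor H H) :=
  TensorProduct.lift (LinearMap.mk₂ ℂ (fun a b => opTensor (π a) (π b))
    (fun a a' b => by rw [map_add, opTensor_add_left])
    (fun c a b => by rw [map_smul, opTensor_smul_left])
    (fun a b b' => by rw [map_add, opTensor_add_right])
    (fun c a b => by rw [map_smul, opTensor_smul_right]))

@[simp] theorem repTensor_tmul (π : A →⋆ₙₐ[ℂ] Op H) (a b : A) :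
    repTensor π (a ⊗ₜ b) = opTensor (π a) (π b) := rfl

/-- Cauchy–Schwarz in `H` bounds the vector functional of `x` with constant `‖x‖`, as
`exists_univRep_vector` requires. No non-degeneracy of `π` enters, and this is why the norms are
only compared by an inequality. -/
theorem exists_univRep_vector_of_rep (π : A →⋆ₙₐ[ℂ] Op H) (x : H) :
    ∃ ξ : UnivSpace A, ‖ξ‖ ≤ ‖x‖ ∧ ∀ a, ⟪ξ, univRep A a ξ⟫_ℂ = ⟪x, π a x⟫_ℂ := by
  have hstar : ∀ a, ⟪x, π (star a * a) x⟫_ℂ = ⟪π a x, π a x⟫_ℂ := fun a => by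
    rw [map_mul, map_star, mul_apply_eq_comp, ContinuousLinearMap.star_eq_adjoint,
      ContinuousLinearMap.adjoint_inner_right]
  let f : A →ₚ[ℂ] ℂ := PositiveLinearMap.mk₀ (vecFunctional π x x).toLinearMap fun a ha => by
    obtain ⟨b, rfl⟩ := CStarAlgebra.nonneg_iff_eq_star_mul_self.1 ha
    change 0 ≤ ⟪x, π (star b * b) x⟫_ℂ
    rw [hstar, inner_self_eq_norm_sq_to_K]
    rw [RCLike.ofReal_eq_complex_ofReal, ← Complex.ofReal_pow]
    exact Complex.zero_le_real.2 (sq_nonneg _)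
  have hf : ∀ a, f a = ⟪x, π a x⟫_ℂ := fun a => rfl
  obtain ⟨ξ, h1, h2, -⟩ := exists_univRep_vector f (norm_nonneg x) fun a => by
    rw [hf, hf, hstar, inner_self_eq_norm_sq_to_K]
    refine (norm_inner_le_norm _ _).trans (le_of_eq ?_)
    congr 1
    rw [RCLike.ofReal_eq_complex_ofReal, ← Complex.ofReal_pow, Complex.ofReal_re,
      Real.sqrt_sq (norm_nonneg _)]
  exact ⟨ξ, h1, h2⟩

/-- The vector states of `x` and `z` are vector states of `ξ` and `ζ` in the universal
representation, so both algebraic tensor actions have equal inner products on `x ⊗ z` and on `ξ ⊗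
ζ`. A bound on product vectors is all that is needed later; the operator norm of `π ⊗ π` is never
estimated. -/
theorem norm_repTensor_tvec_le (π : A →⋆ₙₐ[ℂ] Op H) (t : A ⊗[ℂ] A) (x z : H) :
    ‖repTensor π t (tvec x z)‖ ≤ ‖x‖ * ‖z‖ * ‖repTensor (univRep A) t‖ := by
  obtain ⟨ξ, hξ, hξ'⟩ := exists_univRep_vector_of_rep π x
  obtain ⟨ζ, hζ, hζ'⟩ := exists_univRep_vector_of_rep π z
  have hstar : ∀ {K : Type _} [NormedAddCommGroup K] [InnerProductSpace ℂ K] [CompleteSpace K]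
      (ρ : A →⋆ₙₐ[ℂ] Op K) (v : K) (a b : A), ⟪ρ a v, ρ b v⟫_ℂ = ⟪v, ρ (star a * b) v⟫_ℂ :=
    fun ρ v a b => by
      rw [map_mul, map_star, mul_apply_eq_comp, ContinuousLinearMap.star_eq_adjoint,
        ContinuousLinearMap.adjoint_inner_right]
  have key : ∀ s t : A ⊗[ℂ] A, ⟪repTensor π s (tvec x z), repTensor π t (tvec x z)⟫_ℂ =
      ⟪repTensor (univRep A) s (tvec ξ ζ), repTensor (univRep A) t (tvec ξ ζ)⟫_ℂ := by
    intro s t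
    induction s using TensorProduct.induction_on with
    | zero => simp
    | add s s' hs hs' => simp only [map_add, add_apply, inner_add_left, hs, hs']
    | tmul a b =>
      induction t using TensorProduct.induction_on with
      | zero => simp
      | add t t' ht ht' => simp only [map_add, add_apply, inner_add_right, ht, ht']
      | tmul a' b' =>
        simp only [repTensor_tmul, opTensor_tvec, inner_tvec]
        have e1 : ⟪π a x, π a' x⟫_ℂ = ⟪univRep A a ξ, univRep A a' ξ⟫_ℂ := by
          have h1 : ⟪univRep A a ξ, univRep A a' ξ⟫_ℂ = ⟪ξ, univRep A (star a * a') ξ⟫_ℂ := by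
            rw [map_mul, map_star, mul_apply_eq_comp, ContinuousLinearMap.star_eq_adjoint,
              ContinuousLinearMap.adjoint_inner_right]
          rw [h1, hξ', hstar]
        have e2 : ⟪π b z, π b' z⟫_ℂ = ⟪univRep A b ζ, univRep A b' ζ⟫_ℂ := by
          have h1 : ⟪univRep A b ζ, univRep A b' ζ⟫_ℂ = ⟪ζ, univRep A (star b * b') ζ⟫_ℂ := by
            rw [map_mul, map_star, mul_apply_eq_comp, ContinuousLinearMap.star_eq_adjoint,
              ContinuousLinearMap.adjoint_inner_right]
          rw [h1, hζ', hstar]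
        rw [e1, e2]
  have hnorm : ‖repTensor π t (tvec x z)‖ = ‖repTensor (univRep A) t (tvec ξ ζ)‖ := by
    rw [@norm_eq_sqrt_re_inner ℂ, @norm_eq_sqrt_re_inner ℂ, key]
  rw [hnorm]
  calc _ ≤ ‖repTensor (univRep A) t‖ * (‖ξ‖ * ‖ζ‖) := by
        rw [← norm_tvec]; exact ContinuousLinearMap.le_opNorm _ _
    _ ≤ ‖repTensor (univRep A) t‖ * (‖x‖ * ‖z‖) := by gcongr
    _ = _ := by ring

/-- The same `t'` must serve both representations, so that the norm bound can be applied to the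
adjoint. -/
theorem exists_star_repTensor (π : A →⋆ₙₐ[ℂ] Op H) (t : A ⊗[ℂ] A) :
    ∃ t', repTensor π t' = star (repTensor π t) ∧
      repTensor (univRep A) t' = star (repTensor (univRep A) t) := by
  induction t using TensorProduct.induction_on with
  | zero => exact ⟨0, by simp⟩
  | tmul a b => exact ⟨star a ⊗ₜ star b,
      by rw [repTensor_tmul, repTensor_tmul, star_opTensor, map_star, map_star],
      by rw [repTensor_tmul, repTensor_tmul, star_opTensor, map_star, map_star]⟩
  | add s t hs ht =>
    obtain ⟨s', h1, h2⟩ := hs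
    obtain ⟨t', h3, h4⟩ := ht
    exact ⟨s' + t', by simp [h1, h3], by simp [h2, h4]⟩

/-- The vector `W(y ⊗ u)` is not a product vector, so the tensor is moved by its adjoint to the
other side of the inner product, where it meets `x ⊗ Su`. This bound is what allows `sliceMul` to be
extended by continuity. -/
theorem norm_vecSlice_repTensor_mul_le (π : A →⋆ₙₐ[ℂ] Op H) (W : Op (HTensor H H)) (x y : H)
    (t : A ⊗[ℂ] A) : ‖vecSlice x y (repTensor π t * W)‖ ≤
      ‖x‖ * ‖y‖ * ‖W‖ * ‖repTensor (univRep A) t‖ := by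
  obtain ⟨t', h1, h2⟩ := exists_star_repTensor π t
  refine ContinuousLinearMap.opNorm_le_bound _ (by positivity) fun u => ?_
  set S := vecSlice x y (repTensor π t * W) with hS
  rcases (norm_nonneg (S u)).eq_or_lt with h0 | h0
  · rw [← h0]; positivity
  refine le_of_mul_le_mul_left ?_ h0
  calc ‖S u‖ * ‖S u‖ = ‖⟪S u, S u⟫_ℂ‖ := by rw [inner_self_eq_norm_sq_to_K]; simp [sq]
    _ = ‖⟪repTensor π t' (tvec x (S u)), W (tvec y u)⟫_ℂ‖ := by
        conv_lhs => rw [hS, inner_vecSlice]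
        rw [h1, ContinuousLinearMap.star_eq_adjoint, ContinuousLinearMap.adjoint_inner_left,
          mul_apply_eq_comp]
    _ ≤ (‖x‖ * ‖S u‖ * ‖repTensor (univRep A) t'‖) * (‖W‖ * (‖y‖ * ‖u‖)) := by
        refine (norm_inner_le_norm _ _).trans ?_
        gcongr
        · exact norm_repTensor_tvec_le π t' x _
        · rw [← norm_tvec]; exact ContinuousLinearMap.le_opNorm _ _
    _ = _ := by rw [h2, norm_star]; ring

/-- The algebraic tensor product inside the minimal one. -/
noncomputable def toMinTensor : A ⊗[ℂ] A →ₗ[ℂ] minTensor A :=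
  (repTensor (univRep A)).codRestrict (minTensor A) fun t => by
    induction t using TensorProduct.induction_on with
    | zero => simp
    | tmul a b => exact opTensor_mem_minTensor a b
    | add s t hs ht => rw [map_add]; exact add_mem hs ht

theorem coe_toMinTensor (t : A ⊗[ℂ] A) :
    (toMinTensor t : Op (UnivSpace₂ A)) = repTensor (univRep A) t := rfl

theorem denseRange_toMinTensor : DenseRange (toMinTensor : A ⊗[ℂ] A → minTensor A) := by
  intro T
  rw [Metric.mem_closure_iff]
  intro ε hε
  obtain ⟨S, hS, hTS⟩ := Metric.mem_closure_iff.1 T.2 ε hε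
  have hle : Submodule.span ℂ {T | ∃ S ∈ Set.range (univRep A),
      ∃ S' ∈ Set.range (univRep A), T = opTensor S S'} ≤
      LinearMap.range (repTensor (univRep A)) := by
    rw [Submodule.span_le]
    rintro _ ⟨_, ⟨a, rfl⟩, _, ⟨b, rfl⟩, rfl⟩
    exact ⟨a ⊗ₜ b, rfl⟩
  obtain ⟨t, rfl⟩ := hle hS
  exact ⟨_, ⟨t, rfl⟩, hTS⟩

/-- The slice `(ω_{x,y} ⊗ id)((π ⊗ π)(T) W)` for `T` in the minimal tensor product. -/
noncomputable def sliceMul (π : A →⋆ₙₐ[ℂ] Op H) (W : Op (HTensor H H)) (x y : H) :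
    minTensor A →L[ℂ] Op H :=
  LinearMap.extendOfNorm ((vecSliceL x y).toLinearMap ∘ₗ
    (LinearMap.mulRight ℂ W) ∘ₗ repTensor π) toMinTensor

theorem sliceMul_toMinTensor (π : A →⋆ₙₐ[ℂ] Op H) (W : Op (HTensor H H)) (x y : H)
    (t : A ⊗[ℂ] A) : sliceMul π W x y (toMinTensor t) = vecSlice x y (repTensor π t * W) :=
  LinearMap.extendOfNorm_eq denseRange_toMinTensor
    ⟨_, norm_vecSlice_repTensor_mul_le π W x y⟩ t

theorem sliceMul_add (π : A →⋆ₙₐ[ℂ] Op H) (W : Op (HTensor H H)) (x y : H) (S T : minTensor A) :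
    sliceMul π W x y (S + T) = sliceMul π W x y S + sliceMul π W x y T :=
  (sliceMul π W x y).toLinearMap.map_add' S T

theorem sliceMul_sub (π : A →⋆ₙₐ[ℂ] Op H) (W : Op (HTensor H H)) (x y : H) (S T : minTensor A) :
    sliceMul π W x y (S - T) = sliceMul π W x y S - sliceMul π W x y T := by
  rw [eq_sub_iff_add_eq, ← sliceMul_add, sub_add_cancel]

theorem norm_sliceMul_le (π : A →⋆ₙₐ[ℂ] Op H) (W : Op (HTensor H H)) (x y : H)
    (T : minTensor A) : ‖sliceMul π W x y T‖ ≤ ‖x‖ * ‖y‖ * ‖W‖ * ‖T‖ :=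
  LinearMap.norm_extendOfNorm_apply_le denseRange_toMinTensor _
    (norm_vecSlice_repTensor_mul_le π W x y) T

/-- For `a ⊗ b` the result is `π(b)` times a slice of `W`, hence an element of the algebra times a
multiplier. The range is closed, so this passes to all of `A ⊗ A`. -/
theorem sliceMul_mem_range {π : A →⋆ₙₐ[ℂ] Op H} (hπ : Function.Injective π)
    {W : Op (HTensor H H)} (hW : W ∈ sliceMult H π) (x y : H) (T : minTensor A) :
    ∃ c, π c = sliceMul π W x y T := by
  refine denseRange_toMinTensor.induction_on (p := fun T => ∃ c, π c = sliceMul π W x y T) T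
    ((isClosed_range_rep hπ).preimage (sliceMul π W x y).continuous) fun t => ?_
  rw [sliceMul_toMinTensor]
  induction t using TensorProduct.induction_on with
  | zero => exact ⟨0, by rw [map_zero, map_zero, zero_mul, ← vecSliceL_apply, map_zero]⟩
  | tmul a b =>
    obtain ⟨-, c, hc⟩ := hW (star (π a) x) y b
    exact ⟨c, by rw [hc, repTensor_tmul, vecSlice_opTensor_mul]⟩
  | add s t hs ht =>
    obtain ⟨c, hc⟩ := hs
    obtain ⟨d, hd⟩ := ht
    exact ⟨c + d, by rw [map_add, hc, hd, map_add, add_mul, vecSlice_add]⟩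

end RepTensor

/-! ### The matrix elements of `W` -/

section MatrixElements

variable {A : Type*} [NonUnitalCStarAlgebra A] [PartialOrder A] [StarOrderedRing A]
variable {h : Weight A}
variable {H : Type*} [NormedAddCommGroup H] [InnerProductSpace ℂ H] [CompleteSpace H]
variable {π : A →⋆ₙₐ[ℂ] Op H} {η : h.leftIdeal →ₗ[ℂ] H} {W : Op (HTensor H H)}
variable {δ : Comultiplication A}

theorem strictEval_sub {π : A →⋆ₙₐ[ℂ] Op H} (hπ : Function.Injective π) (φ : A →L[ℂ] ℂ)
    {m n : Op H} (hm : m ∈ multRep π) (hn : n ∈ multRep π) :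
    strictEval π φ (m - n) = strictEval π φ m - strictEval π φ n := by
  rw [sub_eq_add_neg, ← neg_one_smul ℂ n, strictEval_add hπ φ hm (Submodule.smul_mem _ _ hn),
    strictEval_smul hπ φ _ hn]
  ring

variable (hπ : Function.Injective π) (hW : W ∈ sliceMult H π) (hδ : δ.IsProper)
  (hgns : h.IsGNSTriple π η) (hlsc : h.IsLowerSemicontinuous)
  (hconv : ∀ (a : h.leftIdeal) (φ : A →L[ℂ] ℂ), ∃ hm : δ.conv φ a ∈ h.leftIdeal,
    η ⟨δ.conv φ a, hm⟩ = slice π φ W (η a))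

include hπ hW in
theorem sliceMul_mem_multRep (x y : H) (T : minTensor A) : sliceMul π W x y T ∈ multRep π := by
  obtain ⟨d, hd⟩ := sliceMul_mem_range hπ hW x y T
  rw [← hd]
  exact map_mem_multRep d

include hδ in
theorem Comultiplication.IsProper.mul_mem_sliceMult (T : minTensor A) (c : A) :
    (T : Op (UnivSpace₂ A)) * δ.toHom c ∈ sliceMult (UnivSpace A) (univRep A) :=
  minTensor_le_sliceMult (δ.mem_multipliers c T T.2).2

include hδ in
theorem Comultiplication.IsProper.norm_slice_mul_sub_le (ψ : A →L[ℂ] ℂ) (S T : minTensor A)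
    (c : A) : ‖slice (univRep A) ψ ((S : Op (UnivSpace₂ A)) * δ.toHom c) -
      slice (univRep A) ψ ((T : Op (UnivSpace₂ A)) * δ.toHom c)‖ ≤
      ‖ψ‖ * (‖S - T‖ * ‖δ.toHom c‖) := by
  have hinj := univRep_injective A
  have hS := hδ.mul_mem_sliceMult S c
  have hT := hδ.mul_mem_sliceMult T c
  rw [← slice_sub hinj ψ hS hT]
  refine (norm_slice_le hinj ψ (sub_mem hS hT)).trans ?_
  refine mul_le_mul_of_nonneg_left ?_ (norm_nonneg ψ)
  rw [← sub_mul]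
  exact norm_mul_le ((S : Op (UnivSpace₂ A)) - T) (δ.toHom c)

include hπ hW hδ hgns hconv in
-- By linearity it suffices to treat `a ⊗ b`, where the slice of `(a ⊗ b)δ(c)` is `a(ψ(b ·) * c)`
-- and the hypothesis on convolution applies to the functional `ψ(b ·)`.
theorem exists_leftIdeal_eq_slice_toMinTensor_mul (ψ : A →L[ℂ] ℂ) (c : h.leftIdeal)
    (t : A ⊗[ℂ] A) : ∃ q : h.leftIdeal,
      univRep A q = slice (univRep A) ψ ((toMinTensor t : Op (UnivSpace₂ A)) * δ.toHom c) ∧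
      ∀ x, ⟪x, η q⟫_ℂ = strictEval π ψ (sliceMul π W x (η c) (toMinTensor t)) := by
  have hinj := univRep_injective A
  induction t using TensorProduct.induction_on with
  | zero =>
    refine ⟨0, ?_, fun x => ?_⟩
    · have := slice_smul hinj ψ 0 (hδ.mul_mem_sliceMult 0 (c : A))
      simp only [zero_smul] at this
      simp [this]
    · have := strictEval_smul hπ ψ 0 (zero_mem (multRep π))
      simp only [zero_smul, zero_mul] at this
      simp [this]
  | tmul a b =>
    obtain ⟨hm, he⟩ := hconv c (leftMulDual b ψ)
    refine ⟨⟨a * δ.conv (leftMulDual b ψ) c, h.mul_mem_leftIdeal a hm⟩, ?_, fun x => ?_⟩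
    · rw [coe_toMinTensor, repTensor_tmul,
        (slice_opTensor_mul hinj ψ _ b (hδ.mem_sliceMult c)).2, map_mul, hδ.map_conv]
    · obtain ⟨h1, h2⟩ := slice_opTensor_mul hπ ψ (π a) b hW
      rw [hgns.apply_mul a ⟨_, hm⟩, he, sliceMul_toMinTensor, repTensor_tmul,
        ← isSlice_slice hπ ψ h1, h2, mul_apply_eq_comp]
  | add s t hs ht =>
    obtain ⟨p, h1, h2⟩ := hs
    obtain ⟨q, h3, h4⟩ := ht
    have e : toMinTensor (s + t) = toMinTensor s + toMinTensor t := toMinTensor.map_add s t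
    refine ⟨p + q, ?_, fun x => ?_⟩
    · have e1 : univRep A ((p + q : h.leftIdeal) : A) = univRep A p + univRep A q :=
        (univRep A).map_add' _ _
      rw [e1, e, h1, h3, Submodule.coe_add, add_mul]
      exact (slice_add hinj ψ (hδ.mul_mem_sliceMult _ _) (hδ.mul_mem_sliceMult _ _)).symm
    · have e1 : η (p + q) = η p + η q := η.map_add _ _
      calc ⟪x, η (p + q)⟫_ℂ = ⟪x, η p⟫_ℂ + ⟪x, η q⟫_ℂ := by rw [e1, inner_add_right]
        _ = strictEval π ψ (sliceMul π W x (η c) (toMinTensor s)) +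
            strictEval π ψ (sliceMul π W x (η c) (toMinTensor t)) := congrArg₂ _ (h2 x) (h4 x)
        _ = strictEval π ψ (sliceMul π W x (η c) (toMinTensor s) +
              sliceMul π W x (η c) (toMinTensor t)) :=
          (strictEval_add hπ ψ (sliceMul_mem_multRep hπ hW x (η c) _)
            (sliceMul_mem_multRep hπ hW x (η c) _)).symm
        _ = _ := by rw [← sliceMul_add, ← e]

include hπ hW in
theorem norm_strictEval_sliceMul_sub_le (ψ : A →L[ℂ] ℂ) (x y : H) (S T : minTensor A) :
    ‖strictEval π ψ (sliceMul π W x y S) - strictEval π ψ (sliceMul π W x y T)‖ ≤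
      ‖ψ‖ * (‖x‖ * ‖y‖ * ‖W‖ * ‖S - T‖) := by
  rw [← strictEval_sub hπ ψ (sliceMul_mem_multRep hπ hW _ _ _)
    (sliceMul_mem_multRep hπ hW _ _ _), ← sliceMul_sub]
  refine (norm_strictEval_le hπ ψ (sliceMul_mem_multRep hπ hW _ _ _)).trans ?_
  gcongr
  exact norm_sliceMul_le _ _ _ _ _

set_option maxHeartbeats 1000000 in
include hπ hW hδ hgns hlsc hconv in
/-- The slice `(id ⊗ ψ)(T δ(c))` belongs to the domain of the GNS map for `T ∈ A ⊗ A`. -/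
theorem exists_leftIdeal_eq_slice_mul (ψ : A →L[ℂ] ℂ) (c : h.leftIdeal) (T : minTensor A) :
    ∃ q : h.leftIdeal, univRep A q = slice (univRep A) ψ ((T : Op (UnivSpace₂ A)) * δ.toHom c) ∧
      ∀ x, ⟪x, η q⟫_ℂ = strictEval π ψ (sliceMul π W x (η c) T) := by
  have hinj := univRep_injective A
  have hmem : ∀ T : minTensor A, (T : Op (UnivSpace₂ A)) * δ.toHom c ∈ minTensor A :=
    fun T => (δ.mem_multipliers c T T.2).2
  have halg := exists_leftIdeal_eq_slice_toMinTensor_mul hπ hW hδ hgns hconv ψ c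
  obtain ⟨t, ht⟩ : ∃ t : ℕ → A ⊗[ℂ] A, Tendsto (fun n => toMinTensor (t n)) atTop (𝓝 T) := by
    obtain ⟨s, hs, hs'⟩ := mem_closure_iff_seq_limit.1 (denseRange_toMinTensor T)
    choose t ht using hs
    exact ⟨t, by simpa only [ht] using hs'⟩
  choose q hq1 hq2 using fun n => halg (t n)
  -- The coefficients of `η(qₙ)` are bounded in terms of the approximating tensors uniformly over
  -- unit vectors. Thus `qₙ` and `η(qₙ)` both converge, and closedness of the GNS map identifies the
  -- limit.
  have hcauchy : CauchySeq fun n => η (q n) := by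
    have hC : CauchySeq fun n => toMinTensor (t n) := ht.cauchySeq
    rw [Metric.cauchySeq_iff] at hC ⊢
    intro ε hε
    obtain ⟨N, hN⟩ := hC (ε / (‖ψ‖ * ‖η c‖ * ‖W‖ + 1)) (by positivity)
    refine ⟨N, fun m hm n hn => ?_⟩
    have h1 := hN m hm n hn
    rw [dist_eq_norm] at h1 ⊢
    rw [lt_div_iff₀ (by positivity)] at h1
    set v := η (q m) - η (q n) with hv
    rcases (norm_nonneg v).eq_or_lt with h0 | h0
    · rw [← h0]; exact hε
    refine lt_of_mul_lt_mul_left ?_ h0.le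
    calc ‖v‖ * ‖v‖ = ‖⟪v, v⟫_ℂ‖ := by rw [inner_self_eq_norm_sq_to_K]; simp [sq]
      _ = ‖strictEval π ψ (sliceMul π W v (η c) (toMinTensor (t m))) -
            strictEval π ψ (sliceMul π W v (η c) (toMinTensor (t n)))‖ := by
          rw [← hq2, ← hq2, ← inner_sub_right]
      _ ≤ ‖ψ‖ * (‖v‖ * ‖η c‖ * ‖W‖ * ‖toMinTensor (t m) - toMinTensor (t n)‖) :=
          norm_strictEval_sliceMul_sub_le hπ hW _ _ _ _ _
      _ = ‖v‖ * (‖toMinTensor (t m) - toMinTensor (t n)‖ * (‖ψ‖ * ‖η c‖ * ‖W‖)) := by ring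
      _ < ‖v‖ * ε := by
          gcongr
          nlinarith [norm_nonneg (toMinTensor (t m) - toMinTensor (t n))]
  obtain ⟨ξ, hξ⟩ := cauchySeq_tendsto_of_complete hcauchy
  obtain ⟨d, hd⟩ := exists_map_eq_slice_of_mem_minTensor ψ (hmem T)
  have hqd : Tendsto (fun n => (q n : A)) atTop (𝓝 d) := by
    rw [(NonUnitalStarAlgHom.isometry _ hinj).isEmbedding.tendsto_nhds_iff, hd,
      tendsto_iff_norm_sub_tendsto_zero]
    have hlim : Tendsto (fun n => ‖ψ‖ * (‖(toMinTensor (t n) - T)‖ * ‖δ.toHom c‖)) atTop (𝓝 0) := by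
      have := (tendsto_iff_norm_sub_tendsto_zero.1 ht)
      simpa using (this.mul_const ‖δ.toHom c‖).const_mul ‖ψ‖
    refine squeeze_zero (fun _ => norm_nonneg _) (fun n => ?_) hlim
    exact (congrArg (fun S => ‖S - slice (univRep A) ψ ((T : Op (UnivSpace₂ A)) * δ.toHom c)‖)
      (hq1 n)).trans_le (hδ.norm_slice_mul_sub_le ψ _ _ _)
  obtain ⟨hdm, hde⟩ := hgns.closed hlsc hqd hξ
  refine ⟨⟨d, hdm⟩, hd, fun x => ?_⟩
  rw [hde]
  have h1 : Tendsto (fun n => ⟪x, η (q n)⟫_ℂ) atTop (𝓝 ⟪x, ξ⟫_ℂ) := tendsto_const_nhds.inner hξ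
  refine tendsto_nhds_unique h1 ?_
  simp only [hq2]
  rw [tendsto_iff_norm_sub_tendsto_zero]
  have hlim : Tendsto (fun n => ‖ψ‖ * (‖x‖ * ‖η c‖ * ‖W‖ * ‖(toMinTensor (t n) - T)‖))
      atTop (𝓝 0) := by
    have := (tendsto_iff_norm_sub_tendsto_zero.1 ht)
    simpa using (this.const_mul (‖x‖ * ‖η c‖ * ‖W‖)).const_mul ‖ψ‖
  refine squeeze_zero (fun _ => norm_nonneg _) (fun n => ?_) hlim
  exact norm_strictEval_sliceMul_sub_le hπ hW _ _ _ _ _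

include hπ hW hδ hgns hlsc hconv in
-- This is the covariance `W(a ⊗ 1) = δ(a)W`, multiplied by `d ⊗ f` on the left and tested on
-- `η(c)`. Each functional `ψ` sees the same number on both sides, because the slice of `(d ⊗
-- f)δ(a)δ(c)` by `ψ` has one GNS image computed in two ways.
theorem map_mul_vecSlice_eq_sliceMul (d f a : A) (c : h.leftIdeal) (x : H) (T : minTensor A)
    (hT : (T : Op (UnivSpace₂ A)) = opTensor (univRep A d) (univRep A f) * δ.toHom a) :
    π f * vecSlice (star (π d) x) (π a (η c)) W = sliceMul π W x (η c) T := by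
  have hinj := univRep_injective A
  obtain ⟨-, m, hm⟩ := hW (star (π d) x) (π a (η c)) f
  obtain ⟨m', hm'⟩ := sliceMul_mem_range hπ hW x (η c) T
  rw [← hm, ← hm']
  congr 1
  refine (SeparatingDual.eq_iff_forall_dual_eq (R := ℂ)).2 fun ψ => ?_
  obtain ⟨q, hq1, hq2⟩ := exists_leftIdeal_eq_slice_mul hπ hW hδ hgns hlsc hconv ψ c T
  obtain ⟨hac, hac'⟩ := hconv ⟨a * c, h.mul_mem_leftIdeal a c.2⟩ (leftMulDual f ψ)
  -- Multiplicativity of `δ` merges `δ(a)δ(c)` into `δ(ac)`, so `q` is also an ordinary convolution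
  -- product with `ac`.
  have hq3 : q = ⟨d * δ.conv (leftMulDual f ψ) (a * c), h.mul_mem_leftIdeal d hac⟩ := by
    refine Subtype.ext (hinj ?_)
    rw [hq1, hT, mul_assoc, ← map_mul δ.toHom,
      (slice_opTensor_mul hinj ψ _ f (hδ.mem_sliceMult _)).2, ← hδ.map_conv]
    exact (map_mul (univRep A) _ _).symm
  have hq4 := hq2 x
  rw [hq3, hgns.apply_mul d ⟨_, hac⟩, hac', hgns.apply_mul a c, ← hm', strictEval_map hπ,
    ← ContinuousLinearMap.adjoint_inner_left, ← ContinuousLinearMap.star_eq_adjoint,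
    isSlice_slice hπ _ hW, strictEval_leftMulDual hπ ψ (hW _ _) hm] at hq4
  exact hq4

include hπ hW hδ hgns hlsc hconv in
/-- The matrix elements of `W` belong to `A`. -/
theorem exists_map_eq_vecSlice (x y : H) : ∃ m, π m = vecSlice x y W := by
  have hau := CStarAlgebra.increasingApproximateUnit A
  have hnd := hgns.tendsto_apply hlsc
  have hcl := isClosed_range_rep hπ
  have step1 : ∀ (d a : A) (c : h.leftIdeal) (x : H),
      ∃ m, π m = vecSlice (star (π d) x) (π a (η c)) W := by
    intro d a c x
    -- Here `T = (d ⊗ 1)δ(a)`, in `A ⊗ A` by properness. The covariance identity is available for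
    -- `(1 ⊗ f)T`; as `f` runs through the approximate unit, the left side tends strongly to the
    -- slice of `W` and the right side tends in norm.
    let T : minTensor A := ⟨_, (hδ a d).2⟩
    have hT : ∀ f : A, opTensor (univRep A d) (univRep A f) * δ.toHom a =
        opTensor 1 (univRep A f) * (T : Op (UnivSpace₂ A)) := fun f => by
      rw [← mul_assoc, opTensor_mul, one_mul, mul_one]
    have hTm : ∀ f : A, opTensor 1 (univRep A f) * (T : Op (UnivSpace₂ A)) ∈ minTensor A :=
      fun f => by
        rw [← hT]; exact (δ.mem_multipliers a _ (opTensor_mem_minTensor d f)).2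
    have hlim : Tendsto (fun f => (⟨_, hTm f⟩ : minTensor A)) (CStarAlgebra.approximateUnit A)
        (𝓝 T) := tendsto_subtype_rng.2 (tendsto_opTensor_one_mul T.2)
    obtain ⟨m, hm⟩ := sliceMul_mem_range hπ hW x (η c) T
    refine ⟨m, ContinuousLinearMap.ext fun u => ?_⟩
    have h1 : Tendsto (fun f => (sliceMul π W x (η c) ⟨_, hTm f⟩) u)
        (CStarAlgebra.approximateUnit A) (𝓝 (π m u)) := by
      rw [hm]
      exact ((ContinuousLinearMap.apply ℂ H u).continuous.tendsto _).comp
        (((sliceMul π W x (η c)).continuous.tendsto T).comp hlim)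
    refine tendsto_nhds_unique h1 ((hnd _).congr fun f => ?_)
    rw [← map_mul_vecSlice_eq_sliceMul hπ hW hδ hgns hlsc hconv d f a c x _ (hT f).symm,
      mul_apply_eq_comp]
  have hcontl : ∀ y : H, Continuous fun x : H => vecSlice x y W := fun y => by
    refine continuous_iff_continuousAt.2 fun x => ?_
    rw [ContinuousAt, tendsto_iff_norm_sub_tendsto_zero]
    have h0 : Tendsto (fun x' : H => ‖x' - x‖ * ‖y‖ * ‖W‖) (𝓝 x) (𝓝 0) := by
      have := (tendsto_iff_norm_sub_tendsto_zero.1 (tendsto_id (x := 𝓝 x)))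
      simpa using (this.mul_const ‖y‖).mul_const ‖W‖
    refine squeeze_zero (fun _ => norm_nonneg _) (fun x' => ?_) h0
    have : vecSlice x' y W - vecSlice x y W = vecSlice (x' - x) y W := by
      rw [sub_eq_add_neg x', vecSlice_add_left, ← neg_one_smul ℂ x, vecSlice_smul_left]
      simp [sub_eq_add_neg]
    rw [this]
    exact norm_vecSlice_le _ _ _
  have hcontr : ∀ x : H, Continuous fun y : H => vecSlice x y W := fun x => by
    refine continuous_iff_continuousAt.2 fun y => ?_
    rw [ContinuousAt, tendsto_iff_norm_sub_tendsto_zero]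
    have h0 : Tendsto (fun y' : H => ‖x‖ * ‖y' - y‖ * ‖W‖) (𝓝 y) (𝓝 0) := by
      have := (tendsto_iff_norm_sub_tendsto_zero.1 (tendsto_id (x := 𝓝 y)))
      simpa using (this.const_mul ‖x‖).mul_const ‖W‖
    refine squeeze_zero (fun _ => norm_nonneg _) (fun y' => ?_) h0
    have : vecSlice x y' W - vecSlice x y W = vecSlice x (y' - y) W := by
      rw [sub_eq_add_neg y', vecSlice_add_right, ← neg_one_smul ℂ y, vecSlice_smul_right]
      simp [sub_eq_add_neg]
    rw [this]
    exact norm_vecSlice_le _ _ _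
  have step2 : ∀ (a : A) (c : h.leftIdeal) (x : H), ∃ m, π m = vecSlice x (π a (η c)) W := by
    intro a c x
    refine hcl.mem_of_tendsto (((hcontl (π a (η c))).tendsto x).comp (hnd x)) ?_
    filter_upwards [hau.eventually_star_eq] with d hd
    have := step1 d a c x
    rwa [← map_star, hd] at this
  have step3 : ∀ (c : h.leftIdeal), ∃ m, π m = vecSlice x (η c) W := fun c =>
    hcl.mem_of_tendsto (((hcontr x).tendsto _).comp (hnd (η c)))
      (Eventually.of_forall fun a => step2 a c x)
  exact hgns.denseRange.induction_on (p := fun y => ∃ m, π m = vecSlice x y W) y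
    (hcl.preimage (hcontr x)) step3

end MatrixElements

/-! ### The Kac–Takesaki operator and strong right invariance -/

section KacTakesaki

variable {A : Type*} [NonUnitalCStarAlgebra A] [PartialOrder A] [StarOrderedRing A]
variable {h : Weight A}
variable {H : Type*} [NormedAddCommGroup H] [InnerProductSpace ℂ H] [CompleteSpace H]
variable {π : A →⋆ₙₐ[ℂ] Op H} {η : h.leftIdeal →ₗ[ℂ] H} {W : Op (HTensor H H)}
variable {δ : Comultiplication A}
variable (hπ : Function.Injective π) (hW : W ∈ sliceMult H π) (hδ : δ.IsProper)
  (hgns : h.IsGNSTriple π η) (hlsc : h.IsLowerSemicontinuous)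
  (hconv : ∀ (a : h.leftIdeal) (φ : A →L[ℂ] ℂ), ∃ hm : δ.conv φ a ∈ h.leftIdeal,
    η ⟨δ.conv φ a, hm⟩ = slice π φ W (η a))

include hπ hW in
theorem apply_eq_inner_slice (φ : A →L[ℂ] ℂ) {x y : H} {m : A} (hm : π m = vecSlice x y W) :
    φ m = ⟪x, slice π φ W y⟫_ℂ := by
  rw [isSlice_slice hπ φ hW, ← hm, strictEval_map hπ]

include hπ hW hδ hgns hlsc hconv in
theorem isKacTakesaki (hWu : star W * W = 1 ∧ W * star W = 1) :
    IsKacTakesaki δ h π η W := by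
  choose Wm hWm using exists_map_eq_vecSlice hπ hW hδ hgns hlsc hconv
  refine ⟨hWu, fun φ => slice π φ W, Wm, fun φ a => ?_, fun φ x y => ?_, fun x y z u => ?_,
    fun x y => (hWm x y).symm, fun φ => rfl⟩
  · obtain ⟨hm, he⟩ := hconv a φ
    exact ⟨hm, he.symm⟩
  · exact apply_eq_inner_slice hπ hW φ (hWm x y)
  · rw [hWm, inner_vecSlice]

include hπ hW hδ hgns hconv in
-- Both values of the weight become inner products in `H`. The operators acting on `η(a)` and on
-- `η(b)` are mutually adjoint, since the slice of `W⋆` by `φ` is the adjoint of the slice of `W` by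
-- `dualStar φ`.
theorem isStronglyRightInvariant {κ : A →ₗ.[ℂ] A}
    (hκ : ∀ φ ψ : A →L[ℂ] ℂ, (∀ a : κ.domain, ψ a = φ (κ a)) →
      slice π ψ W = slice π φ (star W)) : h.IsStronglyRightInvariant δ κ := by
  intro φ ψ hφψ a b
  obtain ⟨hm, he⟩ := hconv a (dualStar φ)
  obtain ⟨hm', he'⟩ := hconv b ψ
  obtain ⟨h1, h1'⟩ := hgns.linearExt_star_mul ⟨_, hm⟩ b
  obtain ⟨h2, h2'⟩ := hgns.linearExt_star_mul a ⟨_, hm'⟩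
  have e : δ.conv φ (star (a : A)) * b = star (δ.conv (dualStar φ) (a : A)) * b := by
    rw [hδ.conv_star]
  refine ⟨e ▸ h1, h2, ?_⟩
  have e' : (⟨δ.conv φ (star (a : A)) * b, e ▸ h1⟩ : h.finitePart) = ⟨_, h1⟩ := Subtype.ext e
  rw [e', h1', h2', he, he', hκ φ ψ hφψ, slice_star hπ φ hW,
    ContinuousLinearMap.star_eq_adjoint, ContinuousLinearMap.adjoint_inner_right]

end KacTakesaki

/-! ### Parseval identities -/

theorem HilbertBasis.hasSum_norm_sq_inner {ι E : Type*} [NormedAddCommGroup E]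
    [InnerProductSpace ℂ E] (e : HilbertBasis ι ℂ E) (v : E) :
    HasSum (fun i => ‖⟪e i, v⟫_ℂ‖ ^ 2) (‖v‖ ^ 2) := by
  have h1 := (Complex.hasSum_re (e.hasSum_inner_mul_inner v v))
  rw [inner_self_eq_norm_sq_to_K, RCLike.ofReal_eq_complex_ofReal, ← Complex.ofReal_pow,
    Complex.ofReal_re] at h1
  have h2 : ∀ i, (⟪v, e i⟫_ℂ * ⟪e i, v⟫_ℂ).re = ‖⟪e i, v⟫_ℂ‖ ^ 2 := fun i => by
    rw [← inner_conj_symm v, Complex.conj_mul', ← Complex.ofReal_pow, Complex.ofReal_re]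
  simpa only [h2] using h1

theorem HilbertBasis.tsum_ofReal_norm_sq_inner {ι E : Type*} [NormedAddCommGroup E]
    [InnerProductSpace ℂ E] (e : HilbertBasis ι ℂ E) (v : E) :
    ∑' i, ENNReal.ofReal (‖⟪e i, v⟫_ℂ‖ ^ 2) = ENNReal.ofReal (‖v‖ ^ 2) := by
  have h1 := HilbertBasis.hasSum_norm_sq_inner e v
  rw [← ENNReal.ofReal_tsum_of_nonneg (fun _ => by positivity) h1.summable, h1.tsum_eq]

/-! ### Families of isometries with orthogonal ranges -/

section Legs

variable {E X Y Z ι : Type*} [NormedAddCommGroup E] [InnerProductSpace ℂ E]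
  [NormedAddCommGroup X] [InnerProductSpace ℂ X] [CompleteSpace X]
  [NormedAddCommGroup Y] [InnerProductSpace ℂ Y] [CompleteSpace Y]
  [NormedAddCommGroup Z] [NormedSpace ℂ Z]
  (L : E →L[ℂ] X →L[ℂ] Y) (e : HilbertBasis ι ℂ E)

/-- The partial sums of `∑ L(eⱼ)L(eⱼ)⋆`. -/
noncomputable def legSum (F : Finset ι) : Op Y := ∑ j ∈ F, L (e j) ∘L (L (e j)).adjoint

variable {L} (hL : ∀ u v x y, ⟪L u x, L v y⟫_ℂ = ⟪u, v⟫_ℂ * ⟪x, y⟫_ℂ)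

include hL in
-- The partial sum `P` is a projection: `L(eᵢ)⋆P = L(eᵢ)⋆` for `i` in `F` gives `P⋆P = P`, and
-- Cauchy–Schwarz then bounds the norm.
theorem norm_legSum_le (F : Finset ι) : ‖legSum L e F‖ ≤ 1 := by
  classical
  refine ContinuousLinearMap.opNorm_le_bound _ zero_le_one fun y => ?_
  have h1 : ∀ i ∈ F, ∀ x, ⟪L (e i) x, legSum L e F y⟫_ℂ = ⟪x, (L (e i)).adjoint y⟫_ℂ := by
    intro i hi x
    simp only [legSum, sum_apply, inner_sum, ContinuousLinearMap.comp_apply,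
      hL, orthonormal_iff_ite.1 e.orthonormal]
    simp [hi]
  have h2 : ⟪legSum L e F y, legSum L e F y⟫_ℂ = ⟪y, legSum L e F y⟫_ℂ := by
    conv_lhs => enter [2]; rw [legSum]
    conv_rhs => rw [legSum]
    simp only [sum_apply, inner_sum, sum_inner, ContinuousLinearMap.comp_apply]
    refine Finset.sum_congr rfl fun i hi => ?_
    rw [h1 i hi, ContinuousLinearMap.adjoint_inner_left]
  have h3 : ‖legSum L e F y‖ * ‖legSum L e F y‖ ≤ ‖y‖ * ‖legSum L e F y‖ := by
    rw [← inner_self_eq_norm_mul_norm (𝕜 := ℂ), h2]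
    exact (RCLike.re_le_norm _).trans (norm_inner_le_norm _ _)
  rcases (norm_nonneg (legSum L e F y)).eq_or_lt with h0 | h0
  · rw [← h0]; positivity
  · rw [one_mul]; exact le_of_mul_le_mul_right h3 h0

include hL in
-- Convergence is in operator norm, not merely strong, and this is why `T` is restricted. On `L(v) ∘
-- s` the sum acts by expanding `v` in the basis, and `L` is norm continuous.
theorem tendsto_legSum_comp {T : Z →L[ℂ] Y}
    (hT : T ∈ (Submodule.span ℂ {S : Z →L[ℂ] Y | ∃ v s, S = L v ∘L s}).topologicalClosure) :
    Tendsto (fun F => legSum L e F ∘L T) atTop (𝓝 T) := by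
  refine tendsto_of_mem_topologicalClosure_span
    (F := fun F => ContinuousLinearMap.compL ℂ Z Y Y (legSum L e F))
    (G := ContinuousLinearMap.id ℂ _) (C := 1) (.of_forall fun F => ?_) ?_ hT
  · refine ContinuousLinearMap.opNorm_le_bound _ zero_le_one fun S => ?_
    refine (ContinuousLinearMap.opNorm_comp_le _ _).trans ?_
    gcongr
    exact norm_legSum_le e hL F
  · rintro _ ⟨v, s, rfl⟩
    have h1 : ∀ F : Finset ι, legSum L e F ∘L (L v ∘L s) =
        L (∑ j ∈ F, ⟪e j, v⟫_ℂ • e j) ∘L s := by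
      intro F
      refine ContinuousLinearMap.ext fun z => ?_
      have h2 : ∀ j, (L (e j)).adjoint (L v (s z)) = ⟪e j, v⟫_ℂ • s z := fun j =>
        ext_inner_left ℂ fun w => by
          rw [ContinuousLinearMap.adjoint_inner_right, hL, inner_smul_right]
      simp [legSum, h2]
    simp only [ContinuousLinearMap.compL_apply, h1]
    have h3 : Tendsto (fun F : Finset ι => ∑ j ∈ F, ⟪e j, v⟫_ℂ • e j) atTop (𝓝 v) := by
      have := e.hasSum_repr v
      simp only [e.repr_apply_apply] at this
      exact this
    exact (((ContinuousLinearMap.compL ℂ Z X Y).flip s).continuous.tendsto _).comp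
      ((L.continuous.tendsto v).comp h3)

end Legs

/-- It reduces the hypothesis of `tendsto_legSum_comp` to elementary tensors once an operator is
known to lie in a spatial tensor product. -/
theorem comp_mem_of_mem_spatialTensor {H K Z : Type*} [NormedAddCommGroup H]
    [InnerProductSpace ℂ H] [NormedAddCommGroup K] [InnerProductSpace ℂ K] [NormedAddCommGroup Z]
    [NormedSpace ℂ Z] {X : Set (Op H)} {Y : Set (Op K)} {T : Op (HTensor H K)}
    (hT : T ∈ spatialTensor X Y) {N : Submodule ℂ (Z →L[ℂ] HTensor H K)}
    (hN : IsClosed (N : Set (Z →L[ℂ] HTensor H K))) (V : Z →L[ℂ] HTensor H K)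
    (hV : ∀ S ∈ X, ∀ S' ∈ Y, opTensor S S' ∘L V ∈ N) : T ∘L V ∈ N := by
  let Φ := (ContinuousLinearMap.compL ℂ Z (HTensor H K) (HTensor H K)).flip V
  have : spatialTensor X Y ≤ N.comap Φ.toLinearMap := by
    refine Submodule.topologicalClosure_minimal _ (Submodule.span_le.2 ?_)
      (hN.preimage Φ.continuous)
    rintro _ ⟨S, hS, S', hS', rfl⟩
    exact hV S hS S' hS'
  exact this hT

/-! ### Right invariance -/

section RightInvariance

variable {A : Type*} [NonUnitalCStarAlgebra A] [PartialOrder A] [StarOrderedRing A]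

/-- Every positive functional is a vector functional of the universal representation. -/
theorem exists_vecFunctional_eq (φ : A →L[ℂ] ℂ) (hφ : ∀ a, 0 ≤ a → 0 ≤ φ a) :
    ∃ ξ : UnivSpace A, vecFunctional (univRep A) ξ ξ = φ ∧
      Tendsto (fun e => univRep A e ξ) (CStarAlgebra.approximateUnit A) (𝓝 ξ) := by
  let f : A →ₚ[ℂ] ℂ := PositiveLinearMap.mk₀ φ.toLinearMap hφ
  have hf : ∀ a, f a = φ a := fun _ => rfl
  have hau := CStarAlgebra.increasingApproximateUnit A
  -- Cauchy–Schwarz for `f(ea)`, with `f(e⋆e)` at most `‖φ‖`, followed by the limit in `e`.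
  have hbound : ∀ a, ‖f a‖ ≤ √‖φ‖ * √(f (star a * a)).re := by
    intro a
    have hlim : Tendsto (fun e => ‖f (e * a)‖) (CStarAlgebra.approximateUnit A) (𝓝 ‖f a‖) := by
      simp only [hf]
      exact ((φ.continuous.tendsto a).comp (hau.tendsto_mul_right a)).norm
    have := hau.neBot
    refine le_of_tendsto hlim ?_
    filter_upwards [hau.eventually_norm, hau.eventually_star_eq] with e he hes
    have h1 : f (e * a) = ⟪f.toPreGNS e, f.toPreGNS a⟫_ℂ := by
      rw [f.preGNS_inner_def, f.ofPreGNS_toPreGNS, f.ofPreGNS_toPreGNS, hes]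
    rw [h1]
    refine (norm_inner_le_norm _ _).trans ?_
    rw [f.preGNS_norm_def, f.preGNS_norm_def, f.ofPreGNS_toPreGNS, f.ofPreGNS_toPreGNS]
    gcongr
    refine (Complex.re_le_norm _).trans ?_
    rw [hf]
    refine (φ.le_opNorm _).trans ?_
    rw [CStarRing.norm_star_mul_self]
    nlinarith [norm_nonneg φ, norm_nonneg e, mul_le_one₀ he (norm_nonneg e) he]
  obtain ⟨ξ, -, h2, h3⟩ := exists_univRep_vector f (Real.sqrt_nonneg _) hbound
  exact ⟨ξ, ContinuousLinearMap.ext fun a => h2 a, h3⟩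

variable {δ : Comultiplication A} (hδ : δ.IsProper)

include hδ in
/-- `∑ cᵢ⋆cᵢ → (id ⊗ ω_ξ)δ(b⋆b)`, where `cᵢ = (id ⊗ ω_{xᵢ,ξ})δ(b)` for an orthonormal basis
`(xᵢ)`. -/
theorem Comultiplication.IsProper.tendsto_sum_star_conv_mul_conv {ι : Type*}
    (e : HilbertBasis ι ℂ (UnivSpace A)) {ξ : UnivSpace A}
    (hξ : Tendsto (fun e => univRep A e ξ) (CStarAlgebra.approximateUnit A) (𝓝 ξ)) (b : A) :
    Tendsto (fun F : Finset ι => ∑ i ∈ F, star (δ.conv (vecFunctional (univRep A) (e i) ξ) b) *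
      δ.conv (vecFunctional (univRep A) (e i) ξ) b) atTop
      (𝓝 (δ.conv (vecFunctional (univRep A) ξ ξ) (star b * b))) := by
  let R : UnivSpace A →L[ℂ] UnivSpace A →L[ℂ] UnivSpace₂ A := rightLegL
  have hR : ∀ u v x y, ⟪R u x, R v y⟫_ℂ = ⟪u, v⟫_ℂ * ⟪x, y⟫_ℂ := fun u v x y => by
    simp only [R, rightLegL_apply_apply, inner_tvec]; ring
  obtain ⟨T, hTdef⟩ : ∃ T : UnivSpace A →L[ℂ] UnivSpace₂ A, T = δ.toHom b ∘L R ξ := ⟨_, rfl⟩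
  have hTapp : ∀ y, T y = δ.toHom b (tvec y ξ) := fun y => by rw [hTdef]; rfl
  -- Replacing `ξ` by `univRep A g ξ` turns `δ(b)` into `δ(b)(1 ⊗ g)`, which properness places in `A
  -- ⊗ A`. The assumption on `ξ` recovers `T` as a norm limit.
  have hT : T ∈ (Submodule.span ℂ {S : UnivSpace A →L[ℂ] UnivSpace₂ A |
      ∃ v s, S = R v ∘L s}).topologicalClosure := by
    set N := (Submodule.span ℂ {S : UnivSpace A →L[ℂ] UnivSpace₂ A |
      ∃ v s, S = R v ∘L s}).topologicalClosure with hN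
    have hNc : IsClosed (N : Set (UnivSpace A →L[ℂ] UnivSpace₂ A)) :=
      Submodule.isClosed_topologicalClosure _
    have h1 : ∀ g, δ.toHom b ∘L R (univRep A g ξ) ∈ N := fun g => by
      have h2 : δ.toHom b ∘L R (univRep A g ξ) = (δ.toHom b * opTensor 1 (univRep A g)) ∘L R ξ :=
        ContinuousLinearMap.ext fun y => by
          simp only [ContinuousLinearMap.comp_apply, mul_apply_eq_comp, R, rightLegL_apply_apply,
            opTensor_tvec, one_apply_eq_self]
      rw [h2]
      refine comp_mem_of_mem_spatialTensor (hδ b g).1 hNc (R ξ) fun S _ S' _ => ?_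
      refine subset_closure (Submodule.subset_span ⟨S' ξ, S, ContinuousLinearMap.ext fun y => ?_⟩)
      simp only [ContinuousLinearMap.comp_apply, R, rightLegL_apply_apply, opTensor_tvec]
    have := (CStarAlgebra.increasingApproximateUnit A).neBot
    rw [hTdef]
    have hl : Tendsto (fun g => δ.toHom b ∘L R (univRep A g ξ)) (CStarAlgebra.approximateUnit A)
        (𝓝 (δ.toHom b ∘L R ξ)) := ((ContinuousLinearMap.compL ℂ _ _ _ (δ.toHom b)).continuous.tendsto _).comp
      ((R.continuous.tendsto ξ).comp hξ)
    exact hNc.mem_of_tendsto hl (.of_forall h1)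
  have hconv : ∀ ζ, univRep A (δ.conv (vecFunctional (univRep A) ζ ξ) b) = (R ζ).adjoint ∘L T := by
    intro ζ
    refine ContinuousLinearMap.ext fun y => ext_inner_left ℂ fun x => ?_
    rw [hδ.inner_conv_vecFunctional ζ hξ, ContinuousLinearMap.comp_apply,
      ContinuousLinearMap.adjoint_inner_right, hTapp]
    rfl
  have hlim : univRep A (δ.conv (vecFunctional (univRep A) ξ ξ) (star b * b)) =
      T.adjoint ∘L T := by
    refine ContinuousLinearMap.ext fun y => ext_inner_left ℂ fun x => ?_
    rw [hδ.inner_conv_vecFunctional ξ hξ, ContinuousLinearMap.comp_apply,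
      ContinuousLinearMap.adjoint_inner_right, map_mul, map_star, mul_apply_eq_comp,
      ContinuousLinearMap.star_eq_adjoint, ContinuousLinearMap.adjoint_inner_right, hTapp, hTapp]
  have hsum : ∀ F : Finset ι, univRep A (∑ i ∈ F,
      star (δ.conv (vecFunctional (univRep A) (e i) ξ) b) *
        δ.conv (vecFunctional (univRep A) (e i) ξ) b) = T.adjoint ∘L (legSum R e F ∘L T) := by
    intro F
    rw [map_sum]
    refine ContinuousLinearMap.ext fun y => ext_inner_left ℂ fun x => ?_
    rw [ContinuousLinearMap.comp_apply, ContinuousLinearMap.adjoint_inner_right,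
      ContinuousLinearMap.comp_apply, legSum]
    simp only [sum_apply, inner_sum]
    refine Finset.sum_congr rfl fun i _ => ?_
    rw [map_mul, map_star, mul_apply_eq_comp, ContinuousLinearMap.star_eq_adjoint,
      ContinuousLinearMap.adjoint_inner_right, hconv, ContinuousLinearMap.comp_apply,
      ContinuousLinearMap.comp_apply, ContinuousLinearMap.adjoint_inner_left,
      ContinuousLinearMap.comp_apply]
  rw [(NonUnitalStarAlgHom.isometry _ (univRep_injective A)).isEmbedding.tendsto_nhds_iff, hlim]
  refine (((ContinuousLinearMap.compL ℂ _ _ _ T.adjoint).continuous.tendsto T).comp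
    (tendsto_legSum_comp e hR hT)).congr fun F => ?_
  exact (hsum F).symm

variable {H : Type*} [NormedAddCommGroup H] [InnerProductSpace ℂ H] [CompleteSpace H]
variable {π : A →⋆ₙₐ[ℂ] Op H} {W : Op (HTensor H H)}

/-- The partial sums of `∑ mⱼ⋆mⱼ`, for the matrix elements `mⱼ` of a unitary multiplier `W`, are
bounded and converge strictly to `‖y‖²`. -/
theorem tendsto_sum_star_mul_mul (hπ : Function.Injective π) (hW : IsUnitaryMultiplier π W)
    {ι : Type*} (e : HilbertBasis ι ℂ H) (y : H) (m : ι → A)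
    (hm : ∀ j, π (m j) = vecSlice (e j) y W) :
    (∃ C, ∀ F : Finset ι, ‖∑ j ∈ F, star (m j) * m j‖ ≤ C) ∧
      ∀ g : A, Tendsto (fun F : Finset ι => (∑ j ∈ F, star (m j) * m j) * g) atTop
        (𝓝 (((‖y‖ ^ 2 : ℝ) : ℂ) • g)) := by
  let L : H →L[ℂ] H →L[ℂ] HTensor H H := leftLegL
  have hL : ∀ u v x y, ⟪L u x, L v y⟫_ℂ = ⟪u, v⟫_ℂ * ⟪x, y⟫_ℂ := fun u v x y => by
    simp only [L, leftLegL_apply_apply, inner_tvec]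
  obtain ⟨V, hVdef⟩ : ∃ V : H →L[ℂ] HTensor H H, V = W ∘L L y := ⟨_, rfl⟩
  have hV : ∀ u, V u = W (tvec y u) := fun u => by rw [hVdef]; rfl
  have hVm : ∀ j, π (m j) = (L (e j)).adjoint ∘L V := fun j => by
    rw [hm, hVdef]; rfl
  have hsum : ∀ F : Finset ι, π (∑ j ∈ F, star (m j) * m j) =
      V.adjoint ∘L (legSum L e F ∘L V) := by
    intro F
    rw [map_sum]
    refine ContinuousLinearMap.ext fun z => ext_inner_left ℂ fun x => ?_
    rw [ContinuousLinearMap.comp_apply, ContinuousLinearMap.adjoint_inner_right,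
      ContinuousLinearMap.comp_apply, legSum]
    simp only [sum_apply, inner_sum]
    refine Finset.sum_congr rfl fun i _ => ?_
    rw [map_mul, map_star, mul_apply_eq_comp, ContinuousLinearMap.star_eq_adjoint,
      ContinuousLinearMap.adjoint_inner_right, hVm, ContinuousLinearMap.comp_apply,
      ContinuousLinearMap.comp_apply, ContinuousLinearMap.adjoint_inner_left,
      ContinuousLinearMap.comp_apply]
  have hVV : V.adjoint ∘L V = ((‖y‖ ^ 2 : ℝ) : ℂ) • (1 : Op H) := by
    refine ContinuousLinearMap.ext fun z => ext_inner_left ℂ fun x => ?_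
    rw [ContinuousLinearMap.comp_apply, ContinuousLinearMap.adjoint_inner_right, hV, hV,
      ← ContinuousLinearMap.adjoint_inner_right, ← ContinuousLinearMap.star_eq_adjoint,
      ← mul_apply_eq_comp, hW.2.1, one_apply_eq_self, inner_tvec, smul_apply, one_apply_eq_self,
      inner_smul_right, inner_self_eq_norm_sq_to_K, RCLike.ofReal_eq_complex_ofReal,
      Complex.ofReal_pow]
  refine ⟨⟨‖V‖ * ‖V‖, fun F => ?_⟩, fun g => ?_⟩
  · rw [← NonUnitalStarAlgHom.norm_map π hπ, hsum]
    refine (ContinuousLinearMap.opNorm_comp_le _ _).trans ?_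
    rw [LinearIsometryEquiv.norm_map]
    gcongr
    refine (ContinuousLinearMap.opNorm_comp_le _ _).trans ?_
    exact mul_le_of_le_one_left (norm_nonneg V) (norm_legSum_le e hL F)
  -- With a compact `θ` fixing `y`, the map becomes `W(θ ⊗ π(g))` on `y ⊗ ·`, and the multiplier
  -- property of `W` applies. The factor `g` is the reason convergence is only strict.
  · have hT : V ∘L π g ∈ (Submodule.span ℂ {S : H →L[ℂ] HTensor H H |
        ∃ v s, S = L v ∘L s}).topologicalClosure := by
      obtain ⟨θ, hθ, -, hy⟩ := exists_compact_selfAdjoint_fixing y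
      have h1 : V ∘L π g = (W * opTensor θ (π g)) ∘L L y := ContinuousLinearMap.ext fun u => by
        simp only [ContinuousLinearMap.comp_apply, mul_apply_eq_comp, L, leftLegL_apply_apply,
          opTensor_tvec, hy, hV]
      rw [h1]
      refine comp_mem_of_mem_spatialTensor (hW.1 _ (opTensor_mem_spatialTensor (ρ := π) hθ g)).1
        (Submodule.isClosed_topologicalClosure _) (L y) fun S _ S' _ => ?_
      refine subset_closure (Submodule.subset_span ⟨S y, S', ContinuousLinearMap.ext fun u => ?_⟩)
      simp only [ContinuousLinearMap.comp_apply, L, leftLegL_apply_apply, opTensor_tvec]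
    have h2 : π (((‖y‖ ^ 2 : ℝ) : ℂ) • g) = V.adjoint ∘L (V ∘L π g) := by
      rw [← ContinuousLinearMap.comp_assoc, hVV, map_smul]
      exact ContinuousLinearMap.ext fun u => by simp
    rw [(NonUnitalStarAlgHom.isometry _ hπ).isEmbedding.tendsto_nhds_iff, h2]
    refine (((ContinuousLinearMap.compL ℂ _ _ _ V.adjoint).continuous.tendsto _).comp
      (tendsto_legSum_comp e hL hT)).congr fun F => ?_
    change _ = π (_ * g)
    rw [map_mul, hsum]
    rfl

/-- Unitarity of `W` is known in `H`, whereas `ξ` lives in the universal space. Strict convergence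
and boundedness of the partial sums are statements inside `A`, so they transfer to any
representation in which `ξ` is essential. -/
theorem tsum_ofReal_norm_sq_univRep (hπ : Function.Injective π) (hW : IsUnitaryMultiplier π W)
    {ι : Type*} (e : HilbertBasis ι ℂ H) (y : H) (m : ι → A)
    (hm : ∀ j, π (m j) = vecSlice (e j) y W) {ξ : UnivSpace A}
    (hξ : Tendsto (fun e => univRep A e ξ) (CStarAlgebra.approximateUnit A) (𝓝 ξ)) :
    ∑' j, ENNReal.ofReal (‖univRep A (m j) ξ‖ ^ 2) =
      ENNReal.ofReal (‖y‖ ^ 2) * ENNReal.ofReal (‖ξ‖ ^ 2) := by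
  obtain ⟨⟨C, hC⟩, hlim⟩ := tendsto_sum_star_mul_mul hπ hW e y m hm
  have h1 : Tendsto (fun F : Finset ι => univRep A (∑ j ∈ F, star (m j) * m j) ξ) atTop
      (𝓝 ((((‖y‖ ^ 2 : ℝ) : ℂ) • (1 : Op (UnivSpace A))) ξ)) := by
    refine tendsto_of_mem_topologicalClosure_span (C := C)
      (F := fun F : Finset ι => univRep A (∑ j ∈ F, star (m j) * m j))
      (S := {v | ∃ g, v = univRep A g ξ})
      (.of_forall fun F => (NonUnitalStarAlgHom.norm_apply_le _ _).trans (hC F)) ?_ ?_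
    · rintro _ ⟨g, rfl⟩
      have h2 := (((ContinuousLinearMap.apply ℂ (UnivSpace A) ξ).continuous.comp
        (NonUnitalStarAlgHom.isometry _ (univRep_injective A)).continuous).tendsto _).comp (hlim g)
      refine (h2.congr fun F => ?_).trans (le_of_eq ?_)
      · change univRep A (_ * g) ξ = _
        rw [map_mul, mul_apply_eq_comp]
      · congr 1
        change univRep A (_ • g) ξ = _
        rw [map_smul, smul_apply, smul_apply, one_apply_eq_self]
    · have := (CStarAlgebra.increasingApproximateUnit A).neBot
      exact (Submodule.isClosed_topologicalClosure _).mem_of_tendsto hξ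
        (.of_forall fun g => subset_closure (Submodule.subset_span ⟨g, rfl⟩))
  have h3 : HasSum (fun j => ‖univRep A (m j) ξ‖ ^ 2) (‖y‖ ^ 2 * ‖ξ‖ ^ 2) := by
    have h4 := (Complex.continuous_re.tendsto _).comp
      ((tendsto_const_nhds (x := ξ)).inner (𝕜 := ℂ) h1)
    refine (h4.congr fun F => ?_).trans (le_of_eq ?_)
    · rw [Function.comp, map_sum, sum_apply, inner_sum, Complex.re_sum]
      refine Finset.sum_congr rfl fun j _ => ?_
      rw [map_mul, map_star, mul_apply_eq_comp, ContinuousLinearMap.star_eq_adjoint,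
        ContinuousLinearMap.adjoint_inner_right, inner_self_eq_norm_sq_to_K,
        RCLike.ofReal_eq_complex_ofReal, ← Complex.ofReal_pow, Complex.ofReal_re]
    · rw [smul_apply, one_apply_eq_self, inner_smul_right, inner_self_eq_norm_sq_to_K,
        RCLike.ofReal_eq_complex_ofReal, ← Complex.ofReal_pow, ← Complex.ofReal_mul,
        Complex.ofReal_re]
  rw [← ENNReal.ofReal_tsum_of_nonneg (fun _ => by positivity) h3.summable, h3.tsum_eq,
    ENNReal.ofReal_mul (by positivity)]

end RightInvariance

/-! ### Countable additivity of the weight and right invariance -/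

section RightInvariance

variable {A : Type*} [NonUnitalCStarAlgebra A] [PartialOrder A] [StarOrderedRing A]
variable {h : Weight A}

theorem Weight.map_sum (h : Weight A) {ι : Type*} (F : Finset ι) (a : ι → A) (ha : ∀ i, 0 ≤ a i) :
    h (∑ i ∈ F, a i) = ∑ i ∈ F, h (a i) := by
  classical
  induction F using Finset.induction_on with
  | empty => simp [h.map_zero]
  | insert i F hi ih =>
    rw [Finset.sum_insert hi, Finset.sum_insert hi,
      h.map_add _ _ (ha i) (Finset.sum_nonneg fun j _ => ha j), ih]

/-- A lower semicontinuous weight is countably additive, in norm. -/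
theorem Weight.IsLowerSemicontinuous.tsum_eq (hlsc : h.IsLowerSemicontinuous) {ι : Type*}
    {a : ι → A} (ha : ∀ i, 0 ≤ a i) {b : A} (hb : HasSum a b) : ∑' i, h (a i) = h b := by
  have hle : ∀ F : Finset ι, ∑ i ∈ F, a i ≤ b := fun F => sum_le_hasSum F (fun i _ => ha i) hb
  refine le_antisymm (ENNReal.summable.tsum_le_of_sum_le fun F => ?_) ?_
  · rw [← h.map_sum F a ha]
    exact h.mono (Finset.sum_nonneg fun i _ => ha i) (hle F)
  · rcases eq_or_ne (∑' i, h (a i)) ∞ with h0 | h0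
    · rw [h0]; exact le_top
    · lift ∑' i, h (a i) to NNReal using h0 with t ht
      have hmem : ∀ F : Finset ι, ∑ i ∈ F, a i ∈ {a : A | 0 ≤ a ∧ h a ≤ t} := fun F => by
        refine ⟨Finset.sum_nonneg fun i _ => ha i, ?_⟩
        rw [h.map_sum F a ha, ht]
        exact ENNReal.sum_le_tsum F
      exact ((hlsc t).mem_of_tendsto hb (.of_forall hmem)).2

variable {H : Type*} [NormedAddCommGroup H] [InnerProductSpace ℂ H] [CompleteSpace H]
variable {π : A →⋆ₙₐ[ℂ] Op H} {η : h.leftIdeal →ₗ[ℂ] H} {W : Op (HTensor H H)}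
variable {δ : Comultiplication A}
variable (hπ : Function.Injective π) (hW : IsUnitaryMultiplier π W) (hδ : δ.IsProper)
  (hgns : h.IsGNSTriple π η) (hlsc : h.IsLowerSemicontinuous)
  (hconv : ∀ (a : h.leftIdeal) (φ : A →L[ℂ] ℂ), ∃ hm : δ.conv φ a ∈ h.leftIdeal,
    η ⟨δ.conv φ a, hm⟩ = slice π φ W (η a))

include hπ hW hδ hgns hlsc hconv in
-- One double sum of nonnegative terms is evaluated in both orders: over the basis of `H` first it
-- gives the weights of the `cᵢ⋆cᵢ`, over the basis of the universal space first it gives the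
-- `‖mⱼξ‖²`.
theorem apply_conv_star_mul_self (b : h.leftIdeal) {ξ : UnivSpace A}
    (hξ : Tendsto (fun e => univRep A e ξ) (CStarAlgebra.approximateUnit A) (𝓝 ξ)) :
    h (δ.conv (vecFunctional (univRep A) ξ ξ) (star (b : A) * b)) =
      ENNReal.ofReal (‖ξ‖ ^ 2) * h (star (b : A) * b) := by
  have hWs : W ∈ sliceMult H π := mem_sliceMult_of_mem_multipliers hπ hW.1
  obtain ⟨_, e, -⟩ := exists_hilbertBasis ℂ (UnivSpace A)
  obtain ⟨_, e', -⟩ := exists_hilbertBasis ℂ H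
  choose m hm using fun j => exists_map_eq_vecSlice hπ hWs hδ hgns hlsc hconv (e' j) (η b)
  have h1 : HasSum (fun i => star (δ.conv (vecFunctional (univRep A) (e i) ξ) b) *
      δ.conv (vecFunctional (univRep A) (e i) ξ) b)
      (δ.conv (vecFunctional (univRep A) ξ ξ) (star (b : A) * b)) :=
    hδ.tendsto_sum_star_conv_mul_conv e hξ b
  rw [← hlsc.tsum_eq (fun _ => star_mul_self_nonneg _) h1]
  have h2 : ∀ i, h (star (δ.conv (vecFunctional (univRep A) (e i) ξ) b) *
      δ.conv (vecFunctional (univRep A) (e i) ξ) b) =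
      ∑' j, ENNReal.ofReal (‖⟪e i, univRep A (m j) ξ⟫_ℂ‖ ^ 2) := by
    intro i
    obtain ⟨hc, hc'⟩ := hconv b (vecFunctional (univRep A) (e i) ξ)
    rw [← hgns.ofReal_norm_sq ⟨_, hc⟩, hc', ← HilbertBasis.tsum_ofReal_norm_sq_inner e']
    refine tsum_congr fun j => ?_
    rw [← apply_eq_inner_slice hπ hWs _ (hm j), vecFunctional_apply]
  simp only [h2]
  rw [ENNReal.tsum_comm]
  simp only [HilbertBasis.tsum_ofReal_norm_sq_inner]
  rw [tsum_ofReal_norm_sq_univRep hπ hW e' (η b) m hm hξ, hgns.ofReal_norm_sq, mul_comm]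

include hπ hW hδ hgns hlsc hconv in
theorem isRightInvariant : h.IsRightInvariant δ := by
  intro a ha hfin φ hφ
  obtain ⟨ξ, rfl, hξ⟩ := exists_vecFunctional_eq φ hφ
  have hbs : star (CFC.sqrt a) = CFC.sqrt a :=
    (IsSelfAdjoint.of_nonneg (CFC.sqrt_nonneg a)).star_eq
  have hbb : star (CFC.sqrt a) * CFC.sqrt a = a := by
    rw [hbs, CFC.sqrt_mul_sqrt_self a ha]
  have hb : CFC.sqrt a ∈ h.leftIdeal := by
    change h (star (CFC.sqrt a) * CFC.sqrt a) < ∞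
    rwa [hbb]
  have key := apply_conv_star_mul_self hπ hW hδ hgns hlsc hconv ⟨_, hb⟩ hξ
  rw [hbb] at key
  rw [key, strictEval_vecFunctional (univRep_injective A) ξ hξ one_mem_multRep,
    one_apply_eq_self, inner_self_eq_norm_sq_to_K, RCLike.ofReal_eq_complex_ofReal,
    ← Complex.ofReal_pow, Complex.ofReal_re]

end RightInvariance

/-! ### Gaussian regularisation -/

section Gaussian

open MeasureTheory

variable {E : Type*} [NormedAddCommGroup E] [NormedSpace ℂ E]

/-- The Gaussian kernel `exp(-N²(t - z)²)`. -/
noncomputable def gaussKernel (N : ℝ) (z : ℂ) (t : ℝ) : ℂ :=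
  Complex.exp (-(N : ℂ) ^ 2 * ((t : ℂ) - z) ^ 2)

theorem continuous_gaussKernel (N : ℝ) (z : ℂ) : Continuous (gaussKernel N z) := by
  unfold gaussKernel
  fun_prop

theorem norm_gaussKernel_le (N r : ℝ) {z : ℂ} (hz : ‖z‖ ≤ r) (t : ℝ) :
    ‖gaussKernel N z t‖ ≤ Real.exp (N ^ 2 * r ^ 2) * Real.exp (-(N ^ 2 / 2) * t ^ 2) := by
  rw [gaussKernel, Complex.norm_exp, ← Real.exp_add]
  refine Real.exp_le_exp.2 ?_
  have h1 : (-(N : ℂ) ^ 2 * ((t : ℂ) - z) ^ 2).re = -N ^ 2 * ((t - z.re) ^ 2 - z.im ^ 2) := by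
    simp [sq, Complex.mul_re, Complex.mul_im]
  have h2 : z.re ^ 2 + z.im ^ 2 ≤ r ^ 2 := by
    have h3 : ‖z‖ ^ 2 ≤ r ^ 2 := by gcongr
    rw [Complex.sq_norm, Complex.normSq_apply] at h3
    linarith
  rw [h1]
  -- With `x` the real part of `z`: `(t - x)² = t²/2 + (t - 2x)²/2 - x²`.
  nlinarith [mul_nonneg (sq_nonneg N) (sq_nonneg (t - 2 * z.re)),
    mul_nonneg (sq_nonneg N) (sub_nonneg.2 h2)]

/-- The majorant for the `z`-derivative of the kernel: `|t| + r` bounds the factor `t - z` for `‖z‖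
≤ r`. -/
theorem integrable_gaussBound {N : ℝ} (hN : 0 < N) (r C : ℝ) :
    Integrable fun t : ℝ => 2 * N ^ 2 * (|t| + r) *
      (Real.exp (N ^ 2 * r ^ 2) * Real.exp (-(N ^ 2 / 2) * t ^ 2)) * C := by
  have hb : 0 < N ^ 2 / 2 := by positivity
  have h1 := (integrable_mul_exp_neg_mul_sq hb).abs
  have h2 := (integrable_exp_neg_mul_sq hb).const_mul r
  refine ((h1.add h2).const_mul (2 * N ^ 2 * Real.exp (N ^ 2 * r ^ 2) * C)).congr ?_
  refine .of_forall fun t => ?_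
  simp only [Pi.add_apply, abs_mul, Real.abs_exp]
  ring

theorem integrable_gaussKernel_smul {N : ℝ} (hN : 0 < N) (z : ℂ) {f : ℝ → E} (hf : Continuous f)
    {C : ℝ} (hC : ∀ t, ‖f t‖ ≤ C) : Integrable fun t => gaussKernel N z t • f t := by
  have hb : 0 < N ^ 2 / 2 := by positivity
  refine (((integrable_exp_neg_mul_sq hb).const_mul
    (Real.exp (N ^ 2 * ‖z‖ ^ 2))).mul_const C).mono'
    ((continuous_gaussKernel N z).smul hf).aestronglyMeasurable (.of_forall fun t => ?_)
  rw [norm_smul]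
  gcongr
  · exact norm_gaussKernel_le N ‖z‖ le_rfl t
  · exact hC t

/-- Differentiation under the integral on the unit ball about `z₀`, where `‖z‖ ≤ ‖z₀‖ + 1`. -/
theorem differentiable_integral_gaussKernel_smul {N : ℝ} (hN : 0 < N) {f : ℝ → E}
    (hf : Continuous f) {C : ℝ} (hC : ∀ t, ‖f t‖ ≤ C) :
    Differentiable ℂ fun z => ∫ t, gaussKernel N z t • f t := by
  intro z₀
  have hC0 : 0 ≤ C := (norm_nonneg _).trans (hC 0)
  refine (hasDerivAt_integral_of_dominated_loc_of_deriv_le (μ := volume)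
    (F := fun z t => gaussKernel N z t • f t)
    (F' := fun z t => (gaussKernel N z t * (2 * (N : ℂ) ^ 2 * ((t : ℂ) - z))) • f t)
    (bound := fun t => 2 * N ^ 2 * (|t| + (‖z₀‖ + 1)) *
      (Real.exp (N ^ 2 * (‖z₀‖ + 1) ^ 2) * Real.exp (-(N ^ 2 / 2) * t ^ 2)) * C)
    (Metric.ball_mem_nhds z₀ one_pos)
    (.of_forall fun z => (integrable_gaussKernel_smul hN z hf hC).aestronglyMeasurable)
    (integrable_gaussKernel_smul hN z₀ hf hC) ?_ ?_ (integrable_gaussBound hN _ _)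
    ?_).2.differentiableAt
  · refine Continuous.aestronglyMeasurable ?_
    have := continuous_gaussKernel N z₀
    fun_prop
  · refine .of_forall fun t z hz => ?_
    have hz' : ‖z‖ ≤ ‖z₀‖ + 1 := by
      have h1 : ‖z - z₀‖ < 1 := by simpa [dist_eq_norm] using hz
      have h2 := norm_le_norm_add_norm_sub' z z₀
      linarith
    rw [norm_smul, norm_mul]
    have h1 := norm_gaussKernel_le N _ hz' t
    have h2 : ‖2 * (N : ℂ) ^ 2 * ((t : ℂ) - z)‖ ≤ 2 * N ^ 2 * (|t| + (‖z₀‖ + 1)) := by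
      rw [norm_mul, norm_mul, norm_pow, Complex.norm_real, Complex.norm_two, Real.norm_eq_abs,
        sq_abs]
      gcongr
      refine (norm_sub_le _ _).trans ?_
      rw [Complex.norm_real, Real.norm_eq_abs]
      gcongr
    rw [mul_comm ‖gaussKernel N z t‖]
    gcongr
    exact hC t
  · refine .of_forall fun t z _ => ?_
    have h1 : HasDerivAt (fun z : ℂ => -(N : ℂ) ^ 2 * ((t : ℂ) - z) ^ 2)
        (2 * (N : ℂ) ^ 2 * ((t : ℂ) - z)) z := by
      refine ((((hasDerivAt_id z).const_sub (t : ℂ)).pow 2).const_mul (-(N : ℂ) ^ 2)).congr_deriv ?_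
      simp
      ring
    exact (h1.cexp).smul_const (f t)

theorem tendsto_integral_gaussKernel_smul [CompleteSpace E] {f : ℝ → E} (hf : Continuous f) {C : ℝ}
    (hC : ∀ t, ‖f t‖ ≤ C) :
    Tendsto (fun n : ℕ => ((n : ℝ) + 1) • ∫ t, gaussKernel (n + 1) 0 t • f t) atTop
      (𝓝 ((∫ t, gaussKernel 1 0 t) • f 0)) := by
  have hC0 : 0 ≤ C := (norm_nonneg _).trans (hC 0)
  -- The substitution `s = (n + 1)t` moves the dependence on `n` from the kernel to `f`, so
  -- dominated convergence applies.
  have h1 : ∀ n : ℕ, ((n : ℝ) + 1) • ∫ t, gaussKernel (n + 1) 0 t • f t =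
      ∫ s, gaussKernel 1 0 s • f (s / (n + 1)) := by
    intro n
    have hn : (0 : ℝ) < n + 1 := by positivity
    have h2 := Measure.integral_comp_mul_left
      (fun s => gaussKernel 1 0 s • f (s / ((n : ℝ) + 1))) ((n : ℝ) + 1)
    have h3 : ∀ t : ℝ, gaussKernel 1 0 (((n : ℝ) + 1) * t) • f (((n : ℝ) + 1) * t / (n + 1)) =
        gaussKernel (n + 1) 0 t • f t := fun t => by
      rw [mul_div_cancel_left₀ _ hn.ne']
      congr 1
      simp only [gaussKernel]
      push_cast
      congr 1
      ring
    simp only [h3] at h2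
    rw [h2, abs_of_pos (by positivity), smul_smul, mul_inv_cancel₀ hn.ne', one_smul]
  simp only [h1]
  rw [← integral_smul_const]
  refine tendsto_integral_of_dominated_convergence (fun s => ‖gaussKernel 1 0 s‖ * C)
    (fun n => ?_) ?_ (fun n => .of_forall fun s => ?_) (.of_forall fun s => ?_)
  · refine Continuous.aestronglyMeasurable ?_
    have := continuous_gaussKernel 1 0
    fun_prop
  · have := integrable_gaussKernel_smul one_pos 0 (f := fun _ => (1 : ℂ)) continuous_const
      (C := 1) (by simp)
    simpa using this.norm.mul_const C
  · rw [norm_smul]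
    gcongr
    exact hC _
  · refine tendsto_const_nhds.smul ((hf.tendsto 0).comp ?_)
    exact tendsto_const_div_atTop_nhds_zero_nat s |>.comp (tendsto_add_atTop_nat 1) |>.congr
      fun n => by simp

theorem integral_gaussKernel_ne_zero : ∫ t, gaussKernel 1 0 t ≠ 0 := by
  have h1 : ∀ t : ℝ, gaussKernel 1 0 t = ((Real.exp (-1 * t ^ 2) : ℝ) : ℂ) := fun t => by
    simp [gaussKernel]
  simp only [h1]
  rw [integral_complex_ofReal, integral_gaussian]
  simpa using (Real.sqrt_pos.2 Real.pi_pos).ne'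

end Gaussian

/-! ### Density of the domain of the antipode -/

section AntipodeDense

open MeasureTheory

variable {A : Type*} [NonUnitalCStarAlgebra A] [PartialOrder A] [StarOrderedRing A]

theorem OneParamGroup.norm_apply (τ : OneParamGroup A) (t : ℝ) (a : A) : ‖τ t a‖ = ‖a‖ :=
  StarAlgEquiv.norm_map (τ t) a

theorem OneParamGroup.zero_apply (τ : OneParamGroup A) (a : A) : τ 0 a = a := by
  refine (StarAlgEquiv.isometry (τ 0)).injective ?_
  rw [← τ.map_add, add_zero]

/-- The extension is obtained by moving the centre of the Gaussian to a complex point. At a real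
centre `u`, translation invariance of the integral shows that it agrees with `τ_u` of the average.
-/
theorem OneParamGroup.exists_isHalfGenerator (τ : OneParamGroup A) {N : ℝ} (hN : 0 < N) (a : A) :
    ∃ b, τ.IsHalfGenerator (∫ t, gaussKernel N 0 t • τ t a) b := by
  have hC : ∀ t, ‖τ t a‖ ≤ ‖a‖ := fun t => (τ.norm_apply t a).le
  have hd := differentiable_integral_gaussKernel_smul hN (τ.continuous a) hC
  refine ⟨_, fun z => ∫ t, gaussKernel N z t • τ t a, hd.continuous.continuousOn,
    hd.differentiableOn, fun u => ?_, rfl⟩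
  let T : A →L[ℂ] A := ⟨{ toFun := τ u, map_add' := _root_.map_add _, map_smul' := map_smul _ },
    (StarAlgEquiv.isometry (τ u)).continuous⟩
  have h1 : τ u (∫ t, gaussKernel N 0 t • τ t a) = ∫ t, gaussKernel N 0 t • τ (u + t) a := by
    have h2 := T.integral_comp_comm (integrable_gaussKernel_smul hN 0 (τ.continuous a) hC)
    refine Eq.trans h2.symm (integral_congr_ae (.of_forall fun t => ?_))
    change τ u (gaussKernel N 0 t • τ t a) = _
    rw [map_smul, ← τ.map_add]
  rw [h1, ← integral_sub_right_eq_self _ u]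
  refine integral_congr_ae (.of_forall fun t => ?_)
  simp [gaussKernel]

theorem IsPolarDecomposition.dense_domain {κ : A →ₗ.[ℂ] A} {R : A →ₗ[ℂ] A} {τ : OneParamGroup A}
    (hpolar : IsPolarDecomposition κ R τ) : Dense (κ.domain : Set A) := by
  intro a
  have hmem : ∀ n : ℕ, ∫ t, gaussKernel ((n : ℝ) + 1) 0 t • τ t a ∈ κ.domain := fun n => by
    obtain ⟨b, hb⟩ := τ.exists_isHalfGenerator (N := (n : ℝ) + 1) (by positivity) a
    exact LinearPMap.mem_domain_of_mem_graph ((hpolar.graph _ (R b)).2 ⟨b, hb, rfl⟩)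
  have h1 := (tendsto_integral_gaussKernel_smul (τ.continuous a)
    fun t => (τ.norm_apply t a).le).const_smul (∫ t, gaussKernel 1 0 t)⁻¹
  -- Only non-vanishing of the total mass of the kernel is needed, to normalise the averages so that
  -- they tend to `a`.
  rw [smul_smul, inv_mul_cancel₀ integral_gaussKernel_ne_zero, one_smul, τ.zero_apply] at h1
  refine mem_closure_of_tendsto h1 (.of_forall fun n => ?_)
  refine Submodule.smul_mem _ _ ?_
  rw [← Complex.coe_smul]
  exact Submodule.smul_mem _ _ (hmem n)

end AntipodeDense

end WeightedHopf

/-! ### The main theorem -/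

theorem mainTheorem7 {A : Type*} [NonUnitalCStarAlgebra A] [PartialOrder A] [StarOrderedRing A]
    [TopologicalSpace.SeparableSpace A]
    (δ : WeightedHopf.Comultiplication A) (hproper : δ.IsProper) (hcanc : δ.HasCancellation)
    (κ : A →ₗ.[ℂ] A) (hκ : κ.IsClosed) (R : A →ₗ[ℂ] A) (τ : WeightedHopf.OneParamGroup A)
    (hpolar : WeightedHopf.IsPolarDecomposition κ R τ)
    (h : WeightedHopf.Weight A) (hsf : h.IsStrictlyFaithful) (hlf : h.IsLocallyFinite)
    (hlsc : h.IsLowerSemicontinuous)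
    (c : ℝ) (hc : 0 < c) (hrel : h.IsRelativelyInvariant τ c)
    {H : Type*} [NormedAddCommGroup H] [InnerProductSpace ℂ H] [CompleteSpace H]
    (π : A →⋆ₙₐ[ℂ] (H →L[ℂ] H)) (η : h.leftIdeal →ₗ[ℂ] H) (hgns : h.IsGNSTriple π η)
    (W : WeightedHopf.HTensor H H →L[ℂ] WeightedHopf.HTensor H H)
    (hW : WeightedHopf.IsUnitaryMultiplier π W)
    (h1 : ∀ (a : h.leftIdeal) (φ : A →L[ℂ] ℂ), ∃ hm : δ.conv φ a ∈ h.leftIdeal,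
      η ⟨δ.conv φ a, hm⟩ = WeightedHopf.slice π φ W (η a))
    (h2 : ∀ φ ψ : A →L[ℂ] ℂ, (∀ a : κ.domain, ψ a = φ (κ a)) →
      WeightedHopf.slice π ψ W = WeightedHopf.slice π φ (star W)) :
    WeightedHopf.IsWeightedHopf δ ∧ WeightedHopf.IsWeightedHopfWith δ κ R τ h ∧
      WeightedHopf.IsKacTakesaki δ h π η W := by
  have hπ : Function.Injective π := hgns.injective hsf hlf
  have hWs : W ∈ WeightedHopf.sliceMult H π :=
    WeightedHopf.mem_sliceMult_of_mem_multipliers hπ hW.1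
  have hwith : WeightedHopf.IsWeightedHopfWith δ κ R τ h :=
    { separable := inferInstance
      proper := hproper
      cancellation := hcanc
      antipode_closed := hκ
      antipode_dense := hpolar.dense_domain
      locallyFinite := hlf
      strictlyFaithful := hsf
      lowerSemicontinuous := hlsc
      rightInvariant := WeightedHopf.isRightInvariant hπ hW hproper hgns hlsc h1
      polar := hpolar
      relativelyInvariant := ⟨c, hc, hrel⟩
      stronglyRightInvariant :=
        WeightedHopf.isStronglyRightInvariant hπ hWs hproper hgns h1 h2 }
  exact ⟨⟨κ, R, τ, h, hwith⟩, hwith, WeightedHopf.isKacTakesaki hπ hWs hproper hgns hlsc h1 hW.2⟩
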